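/- Let $M$ be a smooth ($C^\infty$, second countable, finite-dimensional, boundaryless) Riemannian manifold, let $\mathrm{Leb}$ be its Riemannian volume on the Borel sets, and let $f:M\to M$ be a $C^{1+\alpha}$ diffeomorphism for some $0<\alpha\le 1$, that is, a $C^1$ diffeomorphism whose derivative is, in local charts, locally Hölder continuous with exponent $\alpha$. Let $\Lambda\subset M$ be a compact set with $f(\Lambda)\subset\Lambda$ that has a dominated splitting: there are a continuous $Df$-invariant splitting $T_\Lambda M=E^{cs}\oplus E^{cu}$ and a constant $0<\lambda<1$ such that, for some choice of a Riemannian metric on $M$, $$\|Df\mid E^{cs}_x\|\cdot\|Df^{-1}\mid E^{cu}_{f(x)}\|\le\lambda\qquad\text{for every }x\in\Lambda.$$ Suppose that there is a Borel set $H\subset\Lambda$ with $\mathrm{Leb}(H)>0$ such that $f$ is non-uniformly expanding along the centre-unstable direction at every point of $H$, i.e. for every $x\in H$ one has $E^{cu}_x\ne 0$ and $$\liminf_{n\to+\infty}\frac1n\sum_{j=1}^{n}\log\|Df^{-1}\mid E^{cu}_{f^j(x)}\|<0 .$$ Then $\Lambda$ contains a local unstable disk: there is a set $\gamma\subset\Lambda$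 which is a $C^1$ embedded closed disk of positive dimension, is tangent to $E^{cu}$ at each of its points (that is, $T_x\gamma=E^{cu}_x$ for every $x\in\gamma$, so that $\dim\gamma=\dim E^{cu}_x$), and is contracted exponentially fast in the past: there are $C>0$ and $0<\theta<1$ such that $\mathrm{dist}(f^{-n}(x),f^{-n}(y))\le C\theta^n$ for all $x,y\in\gamma$ and $n\ge 0$, where $\mathrm{dist}$ is the Riemannian distance. -/

import Mathlib

open Set Filter Topology MeasureTheory Manifold Bundle
open scoped ENNReal NNReal ContDiff

noncomputable section

/-! ### Riemannian volume -/

section Volume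

variable {d : ℕ} {M : Type*} [TopologicalSpace M] [ChartedSpace (EuclideanSpace ℝ (Fin d)) M]
  [RiemannianBundle (fun x : M ↦ TangentSpace (𝓡 d) x)]

/-- The density `√(det (g i j))` of the Riemannian volume in the coordinates of the chart at `c`;
here `g i j` is the inner product of the `i`-th and the `j`-th coordinate vector field. -/
def chartVolumeDensity (c : M) (y : EuclideanSpace ℝ (Fin d)) : ℝ≥0∞ :=
  ENNReal.ofReal (Real.sqrt (Matrix.det (Matrix.of fun i j : Fin d ↦
    (inner ℝ
      (mfderiv (𝓡 d) (𝓡 d) (extChartAt (𝓡 d) c).symm y (EuclideanSpace.single i (1 : ℝ)))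
      (mfderiv (𝓡 d) (𝓡 d) (extChartAt (𝓡 d) c).symm y (EuclideanSpace.single j (1 : ℝ))) : ℝ))))

/-- The Riemannian volume on the domain of the chart at `c` (and zero outside of that domain). -/
def chartVolume [MeasurableSpace M] (c : M) : Measure M :=
  (((volume : Measure (EuclideanSpace ℝ (Fin d))).withDensity
    (chartVolumeDensity c)).restrict (extChartAt (𝓡 d) c).target).map (extChartAt (𝓡 d) c).symm

variable (d M) in
/-- The Riemannian volume measure. By the change of variables formula the measures `chartVolume c`
agree on the overlaps of the chart domains; their supremum in the lattice of measures is the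
measure that restricts to `chartVolume c` on the domain of the chart at `c`, for every `c`. -/
def riemannianVolume [MeasurableSpace M] : Measure M :=
  ⨆ c : M, chartVolume (d := d) c

end Volume

section Dynamics

variable {d : ℕ} {M : Type*} [TopologicalSpace M] [ChartedSpace (EuclideanSpace ℝ (Fin d)) M]

/-- The derivative of `f`, read in charts, is locally Hölder continuous with exponent `α`. -/
def HasLocallyHolderDerivative (α : ℝ≥0) (f : M → M) : Prop :=
  ∀ x : M, ∃ C : ℝ≥0, ∃ U ∈ 𝓝 (extChartAt (𝓡 d) x x),
    HolderOnWith C α (fderiv ℝ (writtenInExtChartAt (𝓡 d) (𝓡 d) x f)) U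

/-- `F` is a continuous subbundle of the tangent bundle over `Λ`: near every point of `Λ` it is
spanned by finitely many linearly independent continuous vector fields along `Λ`. -/
def IsContinuousSubbundleOn [IsManifold (𝓡 d) ∞ M] (Λ : Set M)
    (F : ∀ x : M, Submodule ℝ (TangentSpace (𝓡 d) x)) : Prop :=
  ∀ x ∈ Λ, ∃ U : Set M, IsOpen U ∧ x ∈ U ∧
    ∃ (k : ℕ) (s : Fin k → ∀ y : M, TangentSpace (𝓡 d) y),
      (∀ i, ContinuousOn (fun y ↦ (⟨y, s i y⟩ : TangentBundle (𝓡 d) M)) (Λ ∩ U)) ∧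
      ∀ y ∈ Λ ∩ U, LinearIndependent ℝ (fun i ↦ s i y) ∧
        Submodule.span ℝ (range fun i ↦ s i y) = F y

/-- The operator norm `‖Dh | F_x‖` of the derivative of `h` at `x` restricted to `F x`. -/
def normDerivOn [RiemannianBundle (fun x : M ↦ TangentSpace (𝓡 d) x)]
    (h : M → M) (F : ∀ x : M, Submodule ℝ (TangentSpace (𝓡 d) x)) (x : M) : ℝ :=
  ‖(mfderiv (𝓡 d) (𝓡 d) h x).comp (F x).subtypeL‖

/-- `T_Λ M = Ecs ⊕ Ecu` is a dominated splitting over the compact invariant set `Λ`. The values of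
`Ecs` and `Ecu` outside of `Λ` play no role. -/
structure IsDominatedSplitting [IsManifold (𝓡 d) ∞ M] (f : M ≃ₘ^1⟮𝓡 d, 𝓡 d⟯ M) (Λ : Set M)
    (Ecs Ecu : ∀ x : M, Submodule ℝ (TangentSpace (𝓡 d) x)) : Prop where
  isCompact : IsCompact Λ
  mapsTo : MapsTo f Λ Λ
  continuous_cs : IsContinuousSubbundleOn Λ Ecs
  continuous_cu : IsContinuousSubbundleOn Λ Ecu
  isCompl : ∀ x ∈ Λ, IsCompl (Ecs x) (Ecu x)
  invariant_cs : ∀ x ∈ Λ, (Ecs x).map (mfderiv (𝓡 d) (𝓡 d) f x).toLinearMap = Ecs (f x)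
  invariant_cu : ∀ x ∈ Λ, (Ecu x).map (mfderiv (𝓡 d) (𝓡 d) f x).toLinearMap = Ecu (f x)
  /-- Domination with respect to some Riemannian metric `g` on `M`. -/
  dominated : ∃ g : ContMDiffRiemannianMetric (𝓡 d) ∞ (EuclideanSpace ℝ (Fin d))
      (fun x : M ↦ TangentSpace (𝓡 d) x),
    letI : RiemannianBundle (fun x : M ↦ TangentSpace (𝓡 d) x) := ⟨g.toRiemannianMetric⟩
    ∃ lam : ℝ, 0 < lam ∧ lam < 1 ∧
      ∀ x ∈ Λ, normDerivOn f Ecs x * normDerivOn f.symm Ecu (f x) ≤ lam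

/-- Non-uniform expansion along the centre-unstable direction at `x`, for a non-trivial
centre-unstable direction. The lower limit is taken in the extended reals. -/
def IsNonUniformlyExpandingAt [RiemannianBundle (fun x : M ↦ TangentSpace (𝓡 d) x)]
    (f : M ≃ₘ^1⟮𝓡 d, 𝓡 d⟯ M) (Ecu : ∀ x : M, Submodule ℝ (TangentSpace (𝓡 d) x)) (x : M) : Prop :=
  Ecu x ≠ ⊥ ∧
  liminf (fun n : ℕ ↦
    (((1 / (n : ℝ)) * ∑ j ∈ Finset.Icc 1 n, Real.log (normDerivOn f.symm Ecu (f^[j] x)) : ℝ) :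
      EReal)) atTop < 0

/-- The restriction of `φ` to the closed unit ball of `ℝᵏ` is a `C¹` embedding, so that the image
of that ball is an embedded `k`-dimensional disk. (An injective immersion of a compact set is a
topological embedding.) -/
structure IsEmbeddedDisk {k : ℕ} (φ : EuclideanSpace ℝ (Fin k) → M) : Prop where
  contMDiffAt : ∀ z ∈ Metric.closedBall 0 1, ContMDiffAt (𝓡 k) (𝓡 d) 1 φ z
  injOn : InjOn φ (Metric.closedBall 0 1)
  immersion : ∀ z ∈ Metric.closedBall 0 1, Function.Injective (mfderiv (𝓡 k) (𝓡 d) φ z)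

end Dynamics

/-- The distances between the backward iterates of the points of `γ` tend to zero exponentially
fast. -/
def IsBackwardExpContracted {M : Type*} [EMetricSpace M] (f : M ≃ M) (γ : Set M) : Prop :=
  ∃ C θ : ℝ, 0 < C ∧ 0 < θ ∧ θ < 1 ∧ ∀ x ∈ γ, ∀ y ∈ γ, ∀ n : ℕ,
    edist (f.symm^[n] x) (f.symm^[n] y) ≤ ENNReal.ofReal (C * θ ^ n)

/-- `γ` is a local unstable disk: an embedded disk of positive dimension which is contracted
exponentially by the backward iterates of `f` and which is tangent to `Ecu` at each of its points
(hence of the dimension of `Ecu`). -/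
def IsLocalUnstableDisk {d : ℕ} {M : Type*} [EMetricSpace M]
    [ChartedSpace (EuclideanSpace ℝ (Fin d)) M] (f : M ≃ₘ^1⟮𝓡 d, 𝓡 d⟯ M)
    (Ecu : ∀ x : M, Submodule ℝ (TangentSpace (𝓡 d) x)) (γ : Set M) : Prop :=
  IsBackwardExpContracted f.toEquiv γ ∧
  ∃ (k : ℕ) (φ : EuclideanSpace ℝ (Fin k) → M), 0 < k ∧ IsEmbeddedDisk (d := d) φ ∧
    φ '' Metric.closedBall 0 1 = γ ∧
    ∀ z ∈ Metric.closedBall 0 1, (mfderiv (𝓡 k) (𝓡 d) φ z).range = Ecu (φ z)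

end

/-!
The starting point is that a set of positive volume has, by Fubini's theorem in a chart, a slice of
positive measure along a small flat plaque `D` parallel to the centre-unstable plane of one of its
points (`IsChartSystem.exists_expanding_plaque`). The iterates of `D` are then followed along the
orbits of the points of this slice.

Along the orbit of a point of `Λ`, the diffeomorphism read in charts, in linear coordinates adapted
to the splitting, is a sequence of maps of `U × V` fixing the origin, a `DominatedChain`; the
constants are uniform because `Λ` is covered by finitely many charts (`IsChartSystem`). Domination
makes the cones around `U` invariant, so that the iterates of `D` remain graphs over `U`. At a point
with non-uniform expansion, the averages of the rates are infinitely often below a negative number,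
and the record minima of the corresponding sums are hyperbolic times (`exists_prod_le_pow`): times
`n` from which all backward products of the rates decay exponentially. The nonlinearity costs only
a small factor in each step, hence at a hyperbolic time `n` the `n`-th iterate of `D` contains a
graph over a ball whose radius does not depend on `n` and which is contracted exponentially by the
backward iterates (`DominatedChain.exists_inverse_branch`). The Hölder continuity of the derivative,
summed along this contraction, bounds the distortion of the volume
(`DominatedChain.abs_det_jac_le_mul`) and the variation of the tangent planes
(`DominatedChain.norm_slope_sub_le`) independently of `n`.

The sets of points of `D` which are mapped at a hyperbolic time onto these balls, the hyperbolic
balls, are small neighbourhoods of the points of the slice. They are not round, but they are nested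
well enough, by bounded distortion and backward contraction, for a Vitali covering argument
(`exists_measure_diff_le`). It follows that some of them are filled by points of `Λ` up to an
arbitrarily small proportion, and by bounded distortion so are their images. This gives for every
`n` a disk of a fixed size, with uniform `C^{1+α}` bounds, which is contracted by the first `n`
backward iterates and of which all but the proportion `1 / (n + 1)` is contained in `Λ`
(`IsChartSystem.exists_isGoodDisk`). At the points of `Λ` on this disk, the tangent space is
exponentially close to the centre-unstable direction, because the derivatives of the iterates
contract the cones (`OrbitChain.norm_sub_splittingProj_le`).

A limit of these disks along an ultrafilter exists by the uniform bounds and is a `C^1` disk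
(`exists_ultrafilter_limit`). It is contained in the closed set `Λ`, since the points of `Λ` become
dense on the disks, and it is tangent to the centre-unstable direction by the continuity of the
splitting (`IsChartSystem.exists_limitDisk`).
-/

noncomputable section

local notation "𝔼[" d "]" => EuclideanSpace ℝ (Fin d)

/-! ### Chains of maps with dominated splitting -/

/-- A sequence of maps `f j` of `U × V` fixing the origin, which is an orbit of a diffeomorphism
read in coordinates centred at the points of the orbit. The derivative at the origin is
block diagonal, with an invertible block `A j` on the centre-unstable factor `U` and a block `B j`
on the centre-stable factor `V`. The seminorms `NU j` and `NV j`, which are uniformly equivalent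
to the norms, are those for which the splitting is dominated; the rates `m j` of expansion are
measured in the norm of `U`. -/
structure DominatedChain (U V : Type*) [NormedAddCommGroup U] [NormedSpace ℝ U]
    [NormedAddCommGroup V] [NormedSpace ℝ V] (α C K r lam : ℝ) where
  f : ℕ → U × V → U × V
  f' : ℕ → U × V → (U × V →L[ℝ] U × V)
  A : ℕ → U ≃L[ℝ] U
  B : ℕ → V →L[ℝ] V
  NU : ℕ → Seminorm ℝ U
  NV : ℕ → Seminorm ℝ V
  m : ℕ → ℝ
  μ : ℕ → ℝ
  map_zero : ∀ j, f j 0 = 0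
  hasFDerivAt : ∀ j, ∀ p ∈ Metric.ball (0 : U × V) r, HasFDerivAt (f j) (f' j p) p
  holder : ∀ j, ∀ p ∈ Metric.ball (0 : U × V) r, ∀ q ∈ Metric.ball (0 : U × V) r,
    ‖f' j p - f' j q‖ ≤ C * ‖p - q‖ ^ α
  deriv_zero : ∀ j p, f' j 0 p = (A j p.1, B j p.2)
  norm_symm_le : ∀ j u, ‖u‖ ≤ m j * ‖A j u‖
  m_pos : ∀ j, 0 < m j
  m_le : ∀ j, m j ≤ K
  NU_le : ∀ j u, NU j u ≤ K * ‖u‖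
  le_NU : ∀ j u, ‖u‖ ≤ K * NU j u
  NV_le : ∀ j v, NV j v ≤ K * ‖v‖
  le_NV : ∀ j v, ‖v‖ ≤ K * NV j v
  μ_nonneg : ∀ j, 0 ≤ μ j
  NV_map : ∀ j v, NV (j + 1) (B j v) ≤ μ j * NV j v
  NU_map : ∀ j u, μ j * NU j u ≤ lam * NU (j + 1) (A j u)

/-- The constants of a dominated chain lie in the expected ranges. The numbers `δ` and `ε` are a
radius and a bound for the nonlinearity of the maps at the scale `δ`, on vectors of the cone. -/
structure ChainConstants (α C K r lam δ ε : ℝ) : Prop where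
  α_pos : 0 < α
  C_nonneg : 0 ≤ C
  one_le_K : 1 ≤ K
  lam_pos : 0 < lam
  δ_pos : 0 < δ
  δ_lt : δ < r
  ε_pos : 0 < ε
  holder_le : K ^ 2 * (C * δ ^ α) ≤ ε
  ε_mul_le : ε * K ≤ 1 / 2
  rate_lt_one : lam + 6 * K ^ 3 * ε < 1

namespace DominatedChain

variable {U V : Type*} [NormedAddCommGroup U] [NormedSpace ℝ U]
    [NormedAddCommGroup V] [NormedSpace ℝ V] {α C K r lam δ ε : ℝ}
    (X : DominatedChain U V α C K r lam)

/-- The centre-unstable cone at time `j`. -/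
def Cone (j : ℕ) (p : U × V) : Prop := X.NV j p.2 ≤ X.NU j p.1

variable {X} in
lemma Cone.norm_le {j : ℕ} {p : U × V} (hK : 1 ≤ K) (h : X.Cone j p) : ‖p‖ ≤ K ^ 2 * ‖p.1‖ := by
  have h1 := X.le_NV j p.2
  have h2 := X.NU_le j p.1
  have h3 : ‖p.2‖ ≤ K ^ 2 * ‖p.1‖ := by
    calc ‖p.2‖ ≤ K * X.NV j p.2 := h1
      _ ≤ K * (K * ‖p.1‖) := by gcongr; exact h.trans h2
      _ = _ := by ring
  have h4 : ‖p.1‖ ≤ K ^ 2 * ‖p.1‖ := le_mul_of_one_le_left (norm_nonneg _) (one_le_pow₀ hK)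
  exact max_le h4 h3

section Step

variable (hc : ChainConstants α C K r lam δ ε)
include hc

lemma norm_le_of_approx {j : ℕ} {w w' : U} (h : ‖w' - X.A j w‖ ≤ ε * ‖w‖) :
    ‖w‖ ≤ (1 - ε * K)⁻¹ * X.m j * ‖w'‖ := by
  have h1 := X.norm_symm_le j w
  have h2 : ‖X.A j w‖ ≤ ‖w'‖ + ε * ‖w‖ := by
    calc ‖X.A j w‖ = ‖w' - (w' - X.A j w)‖ := by simp
      _ ≤ _ := (norm_sub_le _ _).trans (by gcongr)
  have hm := X.m_pos j
  have h3 : ‖w‖ ≤ X.m j * ‖w'‖ + ε * K * ‖w‖ := by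
    calc ‖w‖ ≤ X.m j * (‖w'‖ + ε * ‖w‖) := h1.trans (by gcongr)
      _ = X.m j * ‖w'‖ + ε * X.m j * ‖w‖ := by ring
      _ ≤ _ := by have := X.m_le j; have := hc.ε_pos; gcongr
  have h4 : 0 < 1 - ε * K := by linarith [hc.ε_mul_le]
  rw [mul_assoc, inv_mul_eq_div, le_div_iff₀ h4]
  linarith

lemma norm_le_two_mul_of_approx {j : ℕ} {w w' : U} (h : ‖w' - X.A j w‖ ≤ ε * ‖w‖) :
    ‖w‖ ≤ 2 * K * ‖w'‖ := by
  refine (X.norm_le_of_approx hc h).trans ?_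
  have h4 : (1 - ε * K)⁻¹ ≤ 2 := by
    rw [inv_le_comm₀ (by linarith [hc.ε_mul_le]) two_pos]; linarith [hc.ε_mul_le]
  have := X.m_pos j
  have := X.m_le j
  gcongr

lemma norm_le_NU_of_approx {j : ℕ} {w w' : U} (h : ‖w' - X.A j w‖ ≤ ε * ‖w‖) :
    ‖w‖ ≤ 2 * K ^ 2 * X.NU (j + 1) w' := by
  have hK := hc.one_le_K
  calc ‖w‖ ≤ 2 * K * ‖w'‖ := X.norm_le_two_mul_of_approx hc h
    _ ≤ 2 * K * (K * X.NU (j + 1) w') := by gcongr; exact X.le_NU _ _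
    _ = _ := by ring

lemma mu_mul_NU_le_of_approx {j : ℕ} {w w' : U} (h : ‖w' - X.A j w‖ ≤ ε * ‖w‖) :
    X.μ j * X.NU j w ≤ lam * X.NU (j + 1) w' + K * ε * ‖w‖ := by
  have hK := hc.one_le_K
  have hl : lam ≤ 1 := by
    have := hc.rate_lt_one
    have := hc.ε_pos
    have : 0 ≤ 6 * K ^ 3 * ε := by positivity
    linarith
  have hl0 := hc.lam_pos
  have h1 : X.NU (j + 1) (X.A j w) ≤ X.NU (j + 1) w' + K * (ε * ‖w‖) := by
    calc X.NU (j + 1) (X.A j w) = X.NU (j + 1) (w' - (w' - X.A j w)) := by simp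
      _ ≤ X.NU (j + 1) w' + X.NU (j + 1) (w' - X.A j w) := map_sub_le_add _ _ _
      _ ≤ _ := by gcongr; exact (X.NU_le _ _).trans (by gcongr)
  have := hc.ε_pos
  calc X.μ j * X.NU j w ≤ lam * X.NU (j + 1) (X.A j w) := X.NU_map j w
    _ ≤ lam * (X.NU (j + 1) w' + K * (ε * ‖w‖)) := by gcongr
    _ = lam * X.NU (j + 1) w' + lam * (K * (ε * ‖w‖)) := by ring
    _ ≤ lam * X.NU (j + 1) w' + 1 * (K * (ε * ‖w‖)) := by gcongr
    _ = _ := by ring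

/-- The image of a vector of the cone under a map close to the derivative lies in the cone. -/
lemma cone_of_approx {j : ℕ} {p p' : U × V} (hp : X.Cone j p)
    (h : ‖p' - (X.A j p.1, X.B j p.2)‖ ≤ ε * ‖p.1‖) : X.Cone (j + 1) p' := by
  have hK := hc.one_le_K
  have hε := hc.ε_pos
  have h1 : ‖p'.1 - X.A j p.1‖ ≤ ε * ‖p.1‖ := (norm_fst_le _).trans h
  have h2 : ‖p'.2 - X.B j p.2‖ ≤ ε * ‖p.1‖ := (norm_snd_le _).trans h
  have h3 : X.NV (j + 1) p'.2 ≤ X.NV (j + 1) (X.B j p.2) + K * (ε * ‖p.1‖) := by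
    calc X.NV (j + 1) p'.2 = X.NV (j + 1) (X.B j p.2 + (p'.2 - X.B j p.2)) := by simp
      _ ≤ X.NV (j + 1) (X.B j p.2) + X.NV (j + 1) (p'.2 - X.B j p.2) := map_add_le_add _ _ _
      _ ≤ _ := by gcongr; exact (X.NV_le _ _).trans (by gcongr)
  have h4 : X.NV (j + 1) (X.B j p.2) ≤ X.μ j * X.NU j p.1 :=
    (X.NV_map j p.2).trans (mul_le_mul_of_nonneg_left hp (X.μ_nonneg j))
  have h5 := X.mu_mul_NU_le_of_approx hc h1
  have h6 := X.norm_le_NU_of_approx hc h1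
  have h7 : K * ε * ‖p.1‖ ≤ K * ε * (2 * K ^ 2 * X.NU (j + 1) p'.1) := by gcongr
  have h8 : 0 ≤ X.NU (j + 1) p'.1 := apply_nonneg _ _
  have h9 : (lam + 4 * K ^ 3 * ε) * X.NU (j + 1) p'.1 ≤ 1 * X.NU (j + 1) p'.1 := by
    gcongr
    have : 0 ≤ K ^ 3 * ε := by positivity
    linarith [hc.rate_lt_one]
  unfold Cone
  nlinarith

end Step

end DominatedChain

namespace DominatedChain

variable {U V : Type*} [NormedAddCommGroup U] [NormedSpace ℝ U]
    [NormedAddCommGroup V] [NormedSpace ℝ V] {α C K r lam δ ε : ℝ}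
    (X : DominatedChain U V α C K r lam)

lemma norm_deriv_sub_deriv_zero_le (hc : ChainConstants α C K r lam δ ε) {j : ℕ} {p : U × V}
    (hp : ‖p‖ ≤ δ) : ‖X.f' j p - X.f' j 0‖ ≤ C * δ ^ α := by
  have hr := hc.δ_lt
  have h0 := hc.δ_pos
  refine (X.holder j p (by simpa using hp.trans_lt hr) 0 (by simpa using h0.trans hr)).trans ?_
  have := hc.C_nonneg
  have := hc.α_pos
  rw [sub_zero]
  gcongr

lemma norm_map_sub_le (hc : ChainConstants α C K r lam δ ε) {j : ℕ} {p q : U × V}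
    (hp : ‖p‖ ≤ δ) (hq : ‖q‖ ≤ δ) (hpq : X.Cone j (p - q)) :
    ‖X.f j p - X.f j q - (X.A j (p - q).1, X.B j (p - q).2)‖ ≤ ε * ‖(p - q).1‖ := by
  have hr := hc.δ_lt
  have hC := hc.C_nonneg
  have hδ := hc.δ_pos
  have h := (convex_closedBall (0 : U × V) δ).norm_image_sub_le_of_norm_hasFDerivWithin_le'
    (f := X.f j) (f' := X.f' j) (φ := X.f' j 0) (C := C * δ ^ α)
    (fun x hx ↦ (X.hasFDerivAt j x
      (Metric.closedBall_subset_ball hr hx)).hasFDerivWithinAt)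
    (fun x hx ↦ X.norm_deriv_sub_deriv_zero_le hc (by simpa using hx))
    (x := q) (y := p) (by simpa using hq) (by simpa using hp)
  rw [X.deriv_zero] at h
  refine h.trans ?_
  calc C * δ ^ α * ‖p - q‖ ≤ C * δ ^ α * (K ^ 2 * ‖(p - q).1‖) := by
        gcongr; exact hpq.norm_le hc.one_le_K
    _ = K ^ 2 * (C * δ ^ α) * ‖(p - q).1‖ := by ring
    _ ≤ _ := by gcongr; exact hc.holder_le

/-! ### Orbits of the points of a disk -/

/-- The `j`-th iterate of the point with parameter `u` of the disk parametrized by `T`. -/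
def orbit (T : U →L[ℝ] U × V) : ℕ → U → U × V
  | 0, u => T u
  | j + 1, u => X.f j (orbit T j u)

@[simp] lemma orbit_zero (T : U →L[ℝ] U × V) (u : U) : X.orbit T 0 u = T u := rfl

lemma orbit_succ (T : U →L[ℝ] U × V) (j : ℕ) (u : U) :
    X.orbit T (j + 1) u = X.f j (X.orbit T j u) := rfl

@[simp] lemma orbit_apply_zero (T : U →L[ℝ] U × V) (j : ℕ) : X.orbit T j 0 = 0 := by
  induction j with
  | zero => simp
  | succ j ih => rw [orbit_succ, ih, X.map_zero]

/-- The parameters of the points whose orbits stay `δ`-close to the reference orbit up to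
time `n`. -/
def tube (T : U →L[ℝ] U × V) (δ : ℝ) (n : ℕ) : Set U := {u | ∀ j ≤ n, ‖X.orbit T j u‖ ≤ δ}

lemma tube_anti (T : U →L[ℝ] U × V) (δ : ℝ) {m n : ℕ} (h : m ≤ n) :
    X.tube T δ n ⊆ X.tube T δ m := fun _ hu j hj ↦ hu j (hj.trans h)

lemma zero_mem_tube (T : U →L[ℝ] U × V) (hδ : 0 ≤ δ) (n : ℕ) : 0 ∈ X.tube T δ n := by
  intro j _; simpa using hδ

/-- The linear map `T` parametrizes a plane in the initial cone. -/
structure IsInitialPlane (T : U →L[ℝ] U × V) : Prop where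
  cone : ∀ u, X.Cone 0 (T u)
  le_norm : ∀ u, ‖u‖ ≤ K * ‖(T u).1‖

section Orbit

variable {X} {T : U →L[ℝ] U × V} (hc : ChainConstants α C K r lam δ ε) (hT : X.IsInitialPlane T)
include hc hT

/-- The cones are invariant: differences of points of the disk stay in them. -/
lemma cone_orbit_sub {n : ℕ} {u u' : U} (hu : ∀ j < n, ‖X.orbit T j u‖ ≤ δ)
    (hu' : ∀ j < n, ‖X.orbit T j u'‖ ≤ δ) : X.Cone n (X.orbit T n u - X.orbit T n u') := by
  induction n with
  | zero => rw [orbit_zero, orbit_zero, ← map_sub]; exact hT.cone _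
  | succ n ih =>
    have h := ih (fun j hj ↦ hu j (by omega)) (fun j hj ↦ hu' j (by omega))
    exact X.cone_of_approx hc h (X.norm_map_sub_le hc (hu n (by omega)) (hu' n (by omega)) h)

/-- One backward step contracts the distances in the first factor by the rate `m n`, up to the factor
`(1 - ε * K)⁻¹` which accounts for the nonlinearity. -/
lemma norm_fst_orbit_sub_le_succ {n : ℕ} {u u' : U} (hu : u ∈ X.tube T δ n)
    (hu' : u' ∈ X.tube T δ n) :
    ‖(X.orbit T n u - X.orbit T n u').1‖ ≤
      (1 - ε * K)⁻¹ * X.m n * ‖(X.orbit T (n + 1) u - X.orbit T (n + 1) u').1‖ := by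
  have h := cone_orbit_sub hc hT (fun j hj ↦ hu j hj.le) (fun j hj ↦ hu' j hj.le)
  have h1 := X.norm_map_sub_le hc (hu n le_rfl) (hu' n le_rfl) h
  exact X.norm_le_of_approx hc ((norm_fst_le _).trans h1)

lemma norm_fst_orbit_sub_le_prod {n j : ℕ} (hj : j ≤ n) {u u' : U} (hu : u ∈ X.tube T δ n)
    (hu' : u' ∈ X.tube T δ n) :
    ‖(X.orbit T j u - X.orbit T j u').1‖ ≤
      (∏ i ∈ Finset.Ico j n, (1 - ε * K)⁻¹ * X.m i) *
        ‖(X.orbit T n u - X.orbit T n u').1‖ := by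
  have h4 : 0 < (1 - ε * K)⁻¹ := by
    have := hc.ε_mul_le
    rw [inv_pos]; linarith
  induction n, hj using Nat.le_induction with
  | base => simp
  | succ n hn ih =>
    refine (ih (X.tube_anti _ _ n.le_succ hu) (X.tube_anti _ _ n.le_succ hu')).trans ?_
    rw [Finset.prod_Ico_succ_top hn, mul_assoc]
    refine mul_le_mul_of_nonneg_left (norm_fst_orbit_sub_le_succ hc hT
      (X.tube_anti _ _ n.le_succ hu) (X.tube_anti _ _ n.le_succ hu')) ?_
    exact Finset.prod_nonneg fun i _ ↦ mul_nonneg h4.le (X.m_pos i).le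

lemma fst_orbit_injOn (n : ℕ) : InjOn (fun u ↦ (X.orbit T n u).1) (X.tube T δ n) := by
  intro u hu u' hu' h
  have h1 := norm_fst_orbit_sub_le_prod hc hT (Nat.zero_le n) hu hu'
  have h2 : (X.orbit T n u - X.orbit T n u').1 = 0 := by simpa [sub_eq_zero] using h
  rw [h2, norm_zero, mul_zero, orbit_zero, orbit_zero, ← map_sub] at h1
  have h3 := hT.le_norm (u - u')
  have hK := hc.one_le_K
  have h5 : ‖u - u'‖ ≤ 0 := h3.trans (by nlinarith)
  simpa [sub_eq_zero] using h5

end Orbit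

/-- The time `n` is `σ`-hyperbolic: the backward products of the rates of expansion, enlarged to
allow for the nonlinearity of the maps, decay exponentially. -/
def IsHyperbolicTime (ε σ : ℝ) (n : ℕ) : Prop :=
  ∀ j ≤ n, ∏ i ∈ Finset.Ico j n, ((1 - ε * K)⁻¹ * X.m i) ≤ σ ^ (n - j)

section Hyperbolic

variable {X} {T : U →L[ℝ] U × V} {σ : ℝ}
  (hc : ChainConstants α C K r lam δ ε) (hT : X.IsInitialPlane T)
include hc hT

/-- Backward contraction of the disk from a hyperbolic time. -/
lemma norm_fst_orbit_sub_le {n j : ℕ} (hn : X.IsHyperbolicTime ε σ n) (hj : j ≤ n) {u u' : U}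
    (hu : u ∈ X.tube T δ n) (hu' : u' ∈ X.tube T δ n) :
    ‖(X.orbit T j u - X.orbit T j u').1‖ ≤
      σ ^ (n - j) * ‖(X.orbit T n u - X.orbit T n u').1‖ :=
  (norm_fst_orbit_sub_le_prod hc hT hj hu hu').trans
    (mul_le_mul_of_nonneg_right (hn j hj) (norm_nonneg _))

lemma norm_orbit_sub_le {n j : ℕ} (hn : X.IsHyperbolicTime ε σ n) (hj : j ≤ n) {u u' : U}
    (hu : u ∈ X.tube T δ n) (hu' : u' ∈ X.tube T δ n) :
    ‖X.orbit T j u - X.orbit T j u'‖ ≤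
      K ^ 2 * (σ ^ (n - j) * ‖(X.orbit T n u - X.orbit T n u').1‖) := by
  refine ((cone_orbit_sub hc hT (fun i hi ↦ hu i (by omega))
    (fun i hi ↦ hu' i (by omega))).norm_le hc.one_le_K).trans ?_
  gcongr
  exact norm_fst_orbit_sub_le hc hT hn hj hu hu'

lemma norm_sub_le_of_mem_tube {n : ℕ} (hn : X.IsHyperbolicTime ε σ n) {u u' : U}
    (hu : u ∈ X.tube T δ n) (hu' : u' ∈ X.tube T δ n) :
    ‖u - u'‖ ≤ K * (σ ^ n * ‖(X.orbit T n u - X.orbit T n u').1‖) := by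
  refine (hT.le_norm (u - u')).trans ?_
  have hK := hc.one_le_K
  gcongr
  simpa using norm_fst_orbit_sub_le hc hT hn (Nat.zero_le n) hu hu'

/-- The graph transform: up to a hyperbolic time `n`, the image of the tube contains a disk over a
ball of radius independent of `n`. At time `j` the ball is smaller by the backward product of the
rates, which compensates exactly the expansion up to time `n`. -/
lemma exists_mem_tube_of_norm_le_prod [FiniteDimensional ℝ U] [Nontrivial U] {n j : ℕ} (hσ : σ ≤ 1)
    (hn : X.IsHyperbolicTime ε σ n) (hσ0 : 0 ≤ σ) (hj : j ≤ n) {w : U}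
    (hw : ‖w‖ ≤ (∏ i ∈ Finset.Ico j n, ((1 - ε * K)⁻¹ * X.m i)) * (δ / K ^ 2)) :
    ∃ u ∈ X.tube T δ j, (X.orbit T j u).1 = w := by
  have hK := hc.one_le_K
  have hδ := hc.δ_pos
  have h4 : 0 < (1 - ε * K)⁻¹ := by
    have := hc.ε_mul_le
    rw [inv_pos]; linarith
  -- all the balls have radius at most `δ / K ^ 2`, so that the disks over them stay `δ`-small
  have hball : ∀ i ≤ n, ∀ w : U,
      ‖w‖ ≤ (∏ i ∈ Finset.Ico i n, ((1 - ε * K)⁻¹ * X.m i)) * (δ / K ^ 2) → K ^ 2 * ‖w‖ ≤ δ := by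
    intro i hi w hw
    have h1 := (hn i hi).trans (pow_le_one₀ hσ0 hσ)
    calc K ^ 2 * ‖w‖ ≤ K ^ 2 * (1 * (δ / K ^ 2)) := by
          gcongr; exact hw.trans (by gcongr)
      _ = δ := by field_simp
  induction j generalizing w with
  | zero =>
    have hinj : Function.Injective ((ContinuousLinearMap.fst ℝ U V ∘L T : U →L[ℝ] U) : U →ₗ[ℝ] U) := by
      rw [← LinearMap.ker_eq_bot, LinearMap.ker_eq_bot']
      intro u hu
      have := hT.le_norm u
      have h0 : (T u).1 = 0 := hu
      rw [h0, norm_zero, mul_zero] at this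
      simpa using this
    obtain ⟨u, hu⟩ := LinearMap.surjective_of_injective hinj w
    have hu' : (T u).1 = w := hu
    refine ⟨u, ?_, hu'⟩
    intro i hi
    obtain rfl : i = 0 := by omega
    refine ((hT.cone u).norm_le hK).trans ?_
    rw [hu']
    exact hball 0 (by omega) w hw
  | succ j ih =>
    -- the map from the disk over the ball of radius `ρ` at time `j` to the base at time `j + 1` is
    -- `ε`-close to the linear map `A j`, so that its image contains the ball of radius `ρ'`
    set ρ := (∏ i ∈ Finset.Ico j n, ((1 - ε * K)⁻¹ * X.m i)) * (δ / K ^ 2) with hρ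
    set ρ' := (∏ i ∈ Finset.Ico (j + 1) n, ((1 - ε * K)⁻¹ * X.m i)) * (δ / K ^ 2) with hρ'
    have hρ'0 : 0 ≤ ρ' := (norm_nonneg w).trans hw
    have hρρ' : ρ = (1 - ε * K)⁻¹ * X.m j * ρ' := by
      rw [hρ, hρ', Finset.prod_eq_prod_Ico_succ_bot (by omega)]; ring
    have hm := X.m_pos j
    have hρ0 : 0 ≤ ρ := by rw [hρρ']; positivity
    choose! s hs1 hs2 using fun (w : U) (hw : ‖w‖ ≤ ρ) ↦ ih (by omega) (w := w) hw
    let g : U → U := fun w ↦ (X.orbit T (j + 1) (s w)).1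
    have hg : ApproximatesLinearOn g (X.A j : U →L[ℝ] U) (Metric.closedBall 0 ρ)
        ⟨ε, hc.ε_pos.le⟩ := by
      intro w hw w' hw'
      rw [mem_closedBall_zero_iff] at hw hw'
      have h := cone_orbit_sub hc hT (n := j) (fun i hi ↦ hs1 w hw i hi.le)
        (fun i hi ↦ hs1 w' hw' i hi.le)
      have h1 := X.norm_map_sub_le hc (hs1 w hw j le_rfl) (hs1 w' hw' j le_rfl) h
      have h2 := (norm_fst_le _).trans h1
      simp only [Prod.fst_sub, hs2 w hw, hs2 w' hw'] at h2
      exact h2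
    have h0 : (0 : U) ∈ Metric.closedBall (0 : U) ρ := by simpa using hρ0
    have hs0 : s 0 = 0 := by
      refine fst_orbit_injOn hc hT j (hs1 0 (by simpa using hρ0))
        (X.zero_mem_tube T hδ.le j) ?_
      simp [hs2 0 (by simpa using hρ0)]
    have hg0 : g 0 = 0 := by simp [g, hs0]
    have hsurj := hg.surjOn_closedBall_of_nonlinearRightInverse
      (X.A j).toNonlinearRightInverse hρ0 (b := 0) Subset.rfl
    rw [hg0] at hsurj
    have hw' : w ∈ Metric.closedBall (0 : U)
        (((((X.A j).toNonlinearRightInverse).nnnorm : ℝ)⁻¹ - (⟨ε, hc.ε_pos.le⟩ : ℝ≥0)) * ρ) := by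
      rw [mem_closedBall_zero_iff]
      refine hw.trans ?_
      have h1 : (X.m j)⁻¹ ≤ (((X.A j).toNonlinearRightInverse).nnnorm : ℝ)⁻¹ := by
        change (X.m j)⁻¹ ≤ ‖((X.A j).symm : U →L[ℝ] U)‖⁻¹
        have : 0 < ‖((X.A j).symm : U →L[ℝ] U)‖ := by
          rw [norm_pos_iff]
          intro h0
          obtain ⟨v, hv⟩ := exists_ne (0 : U)
          apply hv
          have : (X.A j).symm v = 0 := DFunLike.congr_fun h0 v
          simpa using this
        gcongr
        refine ContinuousLinearMap.opNorm_le_bound _ hm.le fun v ↦ ?_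
        simpa using X.norm_symm_le j ((X.A j).symm v)
      calc ρ' ≤ ((X.m j)⁻¹ - ε) * ρ := by
            rw [hρρ']
            have h2 : ((X.m j)⁻¹ - ε) * ((1 - ε * K)⁻¹ * X.m j * ρ')
              = (1 - ε * X.m j) / (1 - ε * K) * ρ' := by field_simp
            rw [h2]
            refine le_mul_of_one_le_left hρ'0 ?_
            rw [one_le_div (by simpa using h4)]
            have := X.m_le j
            have := hc.ε_pos
            gcongr
        _ ≤ _ := by
            refine mul_le_mul_of_nonneg_right ?_ hρ0
            exact sub_le_sub_right h1 _
    obtain ⟨z, hz, hzw⟩ := hsurj hw'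
    rw [mem_closedBall_zero_iff] at hz
    refine ⟨s z, ?_, hzw⟩
    intro i hi
    rcases Nat.lt_or_ge i (j + 1) with h | h
    · exact hs1 z hz i (by omega)
    · obtain rfl : i = j + 1 := by omega
      have h1 := cone_orbit_sub hc hT (n := j + 1) (u := s z) (u' := 0)
        (fun i hi ↦ hs1 z hz i (by omega)) (fun i hi ↦ by simpa using hδ.le)
      have h2 := h1.norm_le hK
      simp only [orbit_apply_zero, sub_zero] at h2
      refine h2.trans ?_
      change K ^ 2 * ‖g z‖ ≤ δ
      rw [hzw]
      exact hball _ (by omega) w hw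

lemma exists_mem_tube [FiniteDimensional ℝ U] [Nontrivial U] {n : ℕ} (hσ : σ ≤ 1)
    (hn : X.IsHyperbolicTime ε σ n) (hσ0 : 0 ≤ σ) {w : U} (hw : ‖w‖ ≤ δ / K ^ 2) :
    ∃ u ∈ X.tube T δ n, (X.orbit T n u).1 = w :=
  exists_mem_tube_of_norm_le_prod hc hT hσ hn hσ0 le_rfl (by simpa using hw)

end Hyperbolic

end DominatedChain

/-! ### Tangent planes of the iterated disks -/

/-- The determinant of an endomorphism of norm `c` is at most `c ^ dim`. -/
lemma ContinuousLinearMap.abs_det_le_pow {U : Type*} [NormedAddCommGroup U] [NormedSpace ℝ U]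
    [FiniteDimensional ℝ U] (L : U →L[ℝ] U) {c : ℝ} (hc : 0 ≤ c) (hL : ∀ w, ‖L w‖ ≤ c * ‖w‖) :
    |L.det| ≤ c ^ Module.finrank ℝ U := by
  let _ : MeasurableSpace U := borel U
  have : BorelSpace U := ⟨rfl⟩
  let μ : Measure U := Measure.addHaar
  have h1 := μ.addHaar_image_continuousLinearMap L (Metric.closedBall 0 1)
  have h2 : L '' Metric.closedBall 0 1 ⊆ Metric.closedBall 0 c := by
    rintro _ ⟨w, hw, rfl⟩
    rw [mem_closedBall_zero_iff] at hw ⊢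
    exact (hL w).trans (mul_le_of_le_one_right hc hw)
  have h3 := μ.addHaar_closedBall (0 : U) hc
  have h4 := μ.addHaar_closedBall (0 : U) zero_le_one
  rw [one_pow, ENNReal.ofReal_one, one_mul] at h4
  have h5 : ENNReal.ofReal |L.det| * μ (Metric.closedBall 0 1) ≤
      ENNReal.ofReal (c ^ Module.finrank ℝ U) * μ (Metric.closedBall 0 1) := by
    rw [h4, ← h3, ← h4, ← h1]
    exact measure_mono h2
  rw [ENNReal.mul_le_mul_iff_left (Metric.measure_closedBall_pos μ 0 one_pos).ne'
    measure_closedBall_lt_top.ne] at h5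
  exact (ENNReal.ofReal_le_ofReal_iff (by positivity)).1 h5

/-- Relative variation of the determinant of an invertible endomorphism. -/
lemma ContinuousLinearMap.abs_det_le_mul_exp {U : Type*} [NormedAddCommGroup U] [NormedSpace ℝ U]
    [FiniteDimensional ℝ U] (R R' : U →L[ℝ] U) {a c : ℝ} (ha : 0 ≤ a) (hc : 0 ≤ c)
    (hR : ∀ w, ‖w‖ ≤ a * ‖R w‖) (hRR' : ‖R' - R‖ ≤ c) :
    |R'.det| ≤ |R.det| * Real.exp (Module.finrank ℝ U * (a * c)) := by
  have hinj : Function.Injective (R : U →ₗ[ℝ] U) := by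
    rw [← LinearMap.ker_eq_bot, LinearMap.ker_eq_bot']
    intro u hu
    have h0 : R u = 0 := hu
    have := hR u
    rw [h0, norm_zero, mul_zero] at this
    simpa using this
  have hsurj := LinearMap.surjective_of_injective hinj
  let e : U ≃L[ℝ] U := (LinearEquiv.ofBijective (R : U →ₗ[ℝ] U)
    ⟨hinj, hsurj⟩).toContinuousLinearEquiv
  have he : ∀ w, R (e.symm w) = w := fun w ↦ e.apply_symm_apply w
  have hfac : R' = (ContinuousLinearMap.id ℝ U + (R' - R) ∘L (e.symm : U →L[ℝ] U)) ∘L R := by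
    ext w
    have : e.symm (R w) = w := e.symm_apply_apply w
    simp [this]
  have hdet : R'.det =
      (ContinuousLinearMap.id ℝ U + (R' - R) ∘L (e.symm : U →L[ℝ] U)).det * R.det := by
    conv_lhs => rw [hfac]
    simp only [ContinuousLinearMap.det, ContinuousLinearMap.toLinearMap_comp, LinearMap.det_comp]
  have h1 : |(ContinuousLinearMap.id ℝ U + (R' - R) ∘L (e.symm : U →L[ℝ] U)).det| ≤
      (1 + a * c) ^ Module.finrank ℝ U := by
    refine ContinuousLinearMap.abs_det_le_pow _ (by positivity) fun w ↦ ?_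
    have h2 : ‖e.symm w‖ ≤ a * ‖w‖ := by simpa [he] using hR (e.symm w)
    calc ‖w + (R' - R) (e.symm w)‖ ≤ ‖w‖ + c * (a * ‖w‖) := by
          refine (norm_add_le _ _).trans ?_
          gcongr
          exact ((R' - R).le_opNorm _).trans (by gcongr)
      _ = _ := by ring
  have h3 : (1 + a * c) ^ Module.finrank ℝ U ≤ Real.exp (Module.finrank ℝ U * (a * c)) := by
    rw [Real.exp_nat_mul]
    gcongr
    linarith [Real.add_one_le_exp (a * c)]
  rw [hdet, abs_mul, mul_comm]
  gcongr
  exact h1.trans h3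

lemma ContinuousLinearMap.inverse_apply_of_injective {U : Type*} [NormedAddCommGroup U]
    [NormedSpace ℝ U] [FiniteDimensional ℝ U] {R : U →L[ℝ] U} (hR : Function.Injective R) :
    (∀ w, R.inverse (R w) = w) ∧ ∀ w, R (R.inverse w) = w := by
  have hinj : Function.Injective (R : U →ₗ[ℝ] U) := hR
  have hsurj := LinearMap.surjective_of_injective hinj
  let e : U ≃L[ℝ] U := (LinearEquiv.ofBijective (R : U →ₗ[ℝ] U)
    ⟨hinj, hsurj⟩).toContinuousLinearEquiv
  have he : R = (e : U →L[ℝ] U) := by ext w; rfl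
  rw [he, ContinuousLinearMap.inverse_equiv]
  simp

/-- A summation lemma for sequences with an affine contraction. -/
lemma sum_add_le_of_contraction {t h : ℕ → ℝ} {q : ℝ} (n : ℕ)
    (ht : ∀ j < n, t (j + 1) ≤ q * t j + h j) :
    (1 - q) * ∑ j ∈ Finset.range n, t j + t n ≤ t 0 + ∑ j ∈ Finset.range n, h j := by
  induction n with
  | zero => simp
  | succ n ih =>
    have h1 := ih fun j hj ↦ ht j (by omega)
    have h2 := ht n (by omega)
    rw [Finset.sum_range_succ, Finset.sum_range_succ]
    linarith

lemma sum_range_pow_sub_le {b : ℝ} (hb0 : 0 ≤ b) (hb1 : b < 1) (n : ℕ) :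
    ∑ j ∈ Finset.range n, b ^ (n - j) ≤ (1 - b)⁻¹ := by
  have h1 : ∑ j ∈ Finset.range n, b ^ (n - j) ≤ ∑ j ∈ Finset.range n, b ^ j := by
    rw [← Finset.sum_range_reflect (fun j ↦ b ^ j)]
    refine Finset.sum_le_sum fun j hj ↦ ?_
    exact pow_le_pow_of_le_one hb0 hb1.le (by omega)
  refine h1.trans ?_
  rw [← tsum_geometric_of_lt_one hb0 hb1]
  exact (summable_geometric_of_lt_one hb0 hb1).sum_le_tsum _ (fun i _ ↦ by positivity)

namespace DominatedChain

variable {U V : Type*} [NormedAddCommGroup U] [NormedSpace ℝ U]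
    [NormedAddCommGroup V] [NormedSpace ℝ V] {α C K r lam δ ε : ℝ}
    (X : DominatedChain U V α C K r lam)

/-- The slope over `U` of the tangent plane of the `j`-th iterate of the disk. -/
def slope (T : U →L[ℝ] U × V) : ℕ → U → (U →L[ℝ] V)
  | 0, _ => (ContinuousLinearMap.snd ℝ U V ∘L T) ∘L (ContinuousLinearMap.fst ℝ U V ∘L T).inverse
  | j + 1, u =>
    (ContinuousLinearMap.snd ℝ U V ∘L X.f' j (X.orbit T j u) ∘L
      (ContinuousLinearMap.id ℝ U).prod (slope T j u)) ∘L
    (ContinuousLinearMap.fst ℝ U V ∘L X.f' j (X.orbit T j u) ∘L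
      (ContinuousLinearMap.id ℝ U).prod (slope T j u)).inverse

/-- The derivative, read over `U`, of the `j`-th map along the `j`-th iterate of the disk. -/
def stepDeriv (T : U →L[ℝ] U × V) (j : ℕ) (u : U) : U →L[ℝ] U :=
  ContinuousLinearMap.fst ℝ U V ∘L X.f' j (X.orbit T j u) ∘L
    (ContinuousLinearMap.id ℝ U).prod (X.slope T j u)

/-- The derivative of the first component of `X.orbit T j`. -/
def jac (T : U →L[ℝ] U × V) : ℕ → U → (U →L[ℝ] U)
  | 0, _ => ContinuousLinearMap.fst ℝ U V ∘L T
  | j + 1, u => X.stepDeriv T j u ∘L jac T j u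

lemma stepDeriv_apply (T : U →L[ℝ] U × V) (j : ℕ) (u w : U) :
    X.stepDeriv T j u w = (X.f' j (X.orbit T j u) (w, X.slope T j u w)).1 := rfl

section Tangent

variable {X} {T : U →L[ℝ] U × V} (hc : ChainConstants α C K r lam δ ε)
include hc

/-- On vectors of the cone, the derivative at a `δ`-small point is `ε`-close to that at the origin. -/
lemma norm_deriv_apply_sub_le {j : ℕ} {p v : U × V} (hp : ‖p‖ ≤ δ) (hv : X.Cone j v) :
    ‖X.f' j p v - (X.A j v.1, X.B j v.2)‖ ≤ ε * ‖v.1‖ := by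
  rw [← X.deriv_zero, ← sub_apply]
  have hC := hc.C_nonneg
  have hδ := hc.δ_pos
  calc ‖(X.f' j p - X.f' j 0) v‖ ≤ ‖X.f' j p - X.f' j 0‖ * ‖v‖ := ContinuousLinearMap.le_opNorm _ _
    _ ≤ (C * δ ^ α) * (K ^ 2 * ‖v.1‖) := by
      gcongr
      · exact X.norm_deriv_sub_deriv_zero_le hc hp
      · exact hv.norm_le hc.one_le_K
    _ = K ^ 2 * (C * δ ^ α) * ‖v.1‖ := by ring
    _ ≤ _ := by gcongr; exact hc.holder_le

lemma norm_stepDeriv_sub_le {j : ℕ} {u : U} (hu : ‖X.orbit T j u‖ ≤ δ)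
    (hS : ∀ w, X.Cone j (w, X.slope T j u w)) (w : U) :
    ‖X.stepDeriv T j u w - X.A j w‖ ≤ ε * ‖w‖ :=
  (norm_fst_le _).trans (norm_deriv_apply_sub_le hc hu (hS w))

lemma stepDeriv_injective {j : ℕ} {u : U} (hu : ‖X.orbit T j u‖ ≤ δ)
    (hS : ∀ w, X.Cone j (w, X.slope T j u w)) : Function.Injective (X.stepDeriv T j u) := by
  rw [injective_iff_map_eq_zero]
  intro w hw
  have h := X.norm_le_two_mul_of_approx hc (norm_stepDeriv_sub_le hc hu hS w)
  rw [hw, norm_zero, mul_zero] at h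
  simpa using h

/-- The graph of the slope at time `j + 1` is the image of the graph of the slope at time `j`. -/
lemma slope_succ_stepDeriv [FiniteDimensional ℝ U] {j : ℕ} {u : U} (hu : ‖X.orbit T j u‖ ≤ δ)
    (hS : ∀ w, X.Cone j (w, X.slope T j u w)) (w : U) :
    X.slope T (j + 1) u (X.stepDeriv T j u w) =
      (X.f' j (X.orbit T j u) (w, X.slope T j u w)).2 := by
  have h := (ContinuousLinearMap.inverse_apply_of_injective (stepDeriv_injective hc hu hS)).1 w
  change (ContinuousLinearMap.snd ℝ U V ∘L X.f' j (X.orbit T j u) ∘L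
      (ContinuousLinearMap.id ℝ U).prod (X.slope T j u))
      ((X.stepDeriv T j u).inverse (X.stepDeriv T j u w)) = _
  rw [h]
  rfl

lemma exists_stepDeriv_eq [FiniteDimensional ℝ U] {j : ℕ} {u : U} (hu : ‖X.orbit T j u‖ ≤ δ)
    (hS : ∀ w, X.Cone j (w, X.slope T j u w)) (w' : U) : ∃ w, X.stepDeriv T j u w = w' :=
  ⟨_, (ContinuousLinearMap.inverse_apply_of_injective (stepDeriv_injective hc hu hS)).2 w'⟩

variable (hT : X.IsInitialPlane T)
include hT

omit hc in
lemma fst_initial_injective : Function.Injective (ContinuousLinearMap.fst ℝ U V ∘L T) := by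
  rw [injective_iff_map_eq_zero]
  intro u hu
  have := hT.le_norm u
  have h0 : (T u).1 = 0 := hu
  rw [h0, norm_zero, mul_zero] at this
  simpa using this

omit hc in
lemma slope_zero_apply [FiniteDimensional ℝ U] (u w : U) :
    X.slope T 0 u ((T w).1) = (T w).2 := by
  have h := (ContinuousLinearMap.inverse_apply_of_injective (fst_initial_injective hT)).1 w
  change (ContinuousLinearMap.snd ℝ U V ∘L T) ((ContinuousLinearMap.fst ℝ U V ∘L T).inverse
      ((ContinuousLinearMap.fst ℝ U V ∘L T) w)) = _
  rw [h]
  rfl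

lemma cone_slope [FiniteDimensional ℝ U] {n : ℕ} {u : U} (hu : ∀ j < n, ‖X.orbit T j u‖ ≤ δ)
    (w : U) : X.Cone n (w, X.slope T n u w) := by
  induction n generalizing w with
  | zero =>
    obtain ⟨v, hv⟩ : ∃ v, (T v).1 = w :=
      ⟨_, (ContinuousLinearMap.inverse_apply_of_injective (fst_initial_injective hT)).2 w⟩
    rw [← hv, slope_zero_apply hT]
    exact hT.cone v
  | succ n ih =>
    have hS := ih (fun j hj ↦ hu j (by omega))
    obtain ⟨v, rfl⟩ := exists_stepDeriv_eq hc (hu n (by omega)) hS w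
    rw [slope_succ_stepDeriv hc (hu n (by omega)) hS]
    exact X.cone_of_approx hc (hS v) (norm_deriv_apply_sub_le hc (hu n (by omega)) (hS v))

/-- The tangent plane of the `n`-th iterate of the disk is the graph of the slope. -/
lemma hasFDerivAt_orbit [FiniteDimensional ℝ U] {n : ℕ} {u : U}
    (hu : ∀ j < n, ‖X.orbit T j u‖ ≤ δ) :
    HasFDerivAt (X.orbit T n)
      (((ContinuousLinearMap.id ℝ U).prod (X.slope T n u)) ∘L X.jac T n u) u := by
  induction n with
  | zero =>
    have : ((ContinuousLinearMap.id ℝ U).prod (X.slope T 0 u)) ∘L X.jac T 0 u = T := by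
      ext1 w
      change ((T w).1, X.slope T 0 u (T w).1) = T w
      rw [slope_zero_apply hT]
    rw [this]
    exact T.hasFDerivAt
  | succ n ih =>
    have h1 := ih (fun j hj ↦ hu j (by omega))
    have hn := hu n (by omega)
    have hS := cone_slope hc hT (n := n) (u := u) (fun j hj ↦ hu j (by omega))
    have h2 := X.hasFDerivAt n (X.orbit T n u) (by simpa using hn.trans_lt hc.δ_lt)
    have h3 := h2.comp u h1
    refine h3.congr_fderiv ?_
    ext1 w
    change X.f' n (X.orbit T n u) (X.jac T n u w, X.slope T n u (X.jac T n u w)) =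
      (X.stepDeriv T n u (X.jac T n u w), X.slope T (n + 1) u (X.stepDeriv T n u (X.jac T n u w)))
    rw [slope_succ_stepDeriv hc hn hS]
    rfl

lemma jac_injective [FiniteDimensional ℝ U] {n : ℕ} {u : U} (hu : ∀ j < n, ‖X.orbit T j u‖ ≤ δ) :
    Function.Injective (X.jac T n u) := by
  induction n with
  | zero => exact fst_initial_injective hT
  | succ n ih =>
    exact (stepDeriv_injective hc (hu n (by omega)) (cone_slope hc hT fun j hj ↦
      hu j (by omega))).comp (ih fun j hj ↦ hu j (by omega))

end Tangent

section Variation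

variable {X} {T : U →L[ℝ] U × V} (hc : ChainConstants α C K r lam δ ε)
include hc

/-- One step of the variation of the tangent planes: the image difference `L X w - L' X' w`
splits into the image of the difference of the slopes and the variation of the derivative. -/
lemma norm_deriv_apply_sub_sub_le {j : ℕ} {p q : U × V} {S S' : U →L[ℝ] V} {t h : ℝ}
    (hp : ‖p‖ ≤ δ) (ht0 : 0 ≤ t) (hS' : ∀ w, X.Cone j (w, S' w))
    (hSS' : ∀ w, X.NV j (S w - S' w) ≤ t * X.NU j w) (hh : ‖X.f' j p - X.f' j q‖ ≤ h) (w : U) :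
    ‖X.f' j p (w, S w) - X.f' j q (w, S' w) - (0, X.B j (S w - S' w))‖ ≤
      (ε * t + K ^ 2 * h) * ‖w‖ := by
  have hK := hc.one_le_K
  have hC := hc.C_nonneg
  have hδ := hc.δ_pos
  have h0 : 0 ≤ h := (norm_nonneg _).trans hh
  set z := S w - S' w with hz
  have hznorm : ‖z‖ ≤ K ^ 2 * t * ‖w‖ := by
    calc ‖z‖ ≤ K * X.NV j z := X.le_NV _ _
      _ ≤ K * (t * (K * ‖w‖)) := by
          gcongr; exact (hSS' w).trans (by gcongr; exact X.NU_le _ _)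
      _ = _ := by ring
  have e1 : (w, S w) = (w, S' w) + ((0 : U), z) := by simp [hz]
  have e2 : ((0 : U), X.B j z) = X.f' j 0 (0, z) := by simp [X.deriv_zero]
  have e3 : X.f' j p (w, S w) - X.f' j q (w, S' w) - (0, X.B j z) =
      (X.f' j p - X.f' j 0) (0, z) + (X.f' j p - X.f' j q) (w, S' w) := by
    rw [e1, e2, map_add]
    simp only [sub_apply]
    abel
  rw [e3]
  have h1 : ‖(X.f' j p - X.f' j 0) (0, z)‖ ≤ ε * t * ‖w‖ := by
    calc _ ≤ ‖X.f' j p - X.f' j 0‖ * ‖((0 : U), z)‖ := ContinuousLinearMap.le_opNorm _ _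
      _ ≤ (C * δ ^ α) * (K ^ 2 * t * ‖w‖) := by
          gcongr
          · exact X.norm_deriv_sub_deriv_zero_le hc hp
          · simpa [Prod.norm_def] using hznorm
      _ = K ^ 2 * (C * δ ^ α) * (t * ‖w‖) := by ring
      _ ≤ ε * (t * ‖w‖) := by gcongr; exact hc.holder_le
      _ = _ := by ring
  have h2 : ‖(X.f' j p - X.f' j q) (w, S' w)‖ ≤ h * (K ^ 2 * ‖w‖) := by
    calc _ ≤ ‖X.f' j p - X.f' j q‖ * ‖(w, S' w)‖ := ContinuousLinearMap.le_opNorm _ _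
      _ ≤ _ := by gcongr; exact (hS' w).norm_le hK
  calc _ ≤ ε * t * ‖w‖ + h * (K ^ 2 * ‖w‖) := (norm_add_le _ _).trans (add_le_add h1 h2)
    _ = _ := by ring

lemma norm_stepDeriv_sub_stepDeriv_le {j : ℕ} {u u' : U} {t h : ℝ}
    (hu : ‖X.orbit T j u‖ ≤ δ) (ht0 : 0 ≤ t) (hS' : ∀ w, X.Cone j (w, X.slope T j u' w))
    (hSS' : ∀ w, X.NV j (X.slope T j u w - X.slope T j u' w) ≤ t * X.NU j w)
    (hh : ‖X.f' j (X.orbit T j u) - X.f' j (X.orbit T j u')‖ ≤ h) :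
    ‖X.stepDeriv T j u - X.stepDeriv T j u'‖ ≤ ε * t + K ^ 2 * h := by
  have h0 : 0 ≤ h := (norm_nonneg _).trans hh
  have := hc.ε_pos
  refine ContinuousLinearMap.opNorm_le_bound _ (by positivity) fun w ↦ ?_
  have := (norm_fst_le _).trans (norm_deriv_apply_sub_sub_le hc hu ht0 hS' hSS' hh w)
  simpa [stepDeriv_apply] using this

/-- The graph transform contracts the variation of the slopes, thanks to the domination, up to the
variation `h` of the derivatives of the map. -/
lemma slope_sub_succ_le [FiniteDimensional ℝ U] {j : ℕ} {u u' : U} {t h : ℝ}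
    (hu : ‖X.orbit T j u‖ ≤ δ) (hu' : ‖X.orbit T j u'‖ ≤ δ)
    (ht0 : 0 ≤ t) (hS : ∀ w, X.Cone j (w, X.slope T j u w))
    (hS' : ∀ w, X.Cone j (w, X.slope T j u' w))
    (hSS' : ∀ w, X.NV j (X.slope T j u w - X.slope T j u' w) ≤ t * X.NU j w)
    (hh : ‖X.f' j (X.orbit T j u) - X.f' j (X.orbit T j u')‖ ≤ h) (w : U) :
    X.NV (j + 1) (X.slope T (j + 1) u w - X.slope T (j + 1) u' w) ≤
      ((lam + 6 * K ^ 3 * ε) * t + 4 * K ^ 5 * h) * X.NU (j + 1) w := by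
  have hK := hc.one_le_K
  have hε := hc.ε_pos
  have h0 : 0 ≤ h := (norm_nonneg _).trans hh
  obtain ⟨w, rfl⟩ := exists_stepDeriv_eq hc hu hS w
  have hmain := norm_deriv_apply_sub_sub_le hc hu ht0 hS' hSS' hh w
  set R := X.stepDeriv T j u with hR
  set R' := X.stepDeriv T j u' with hR'
  set S := X.slope T j u with hSdef
  set S' := X.slope T j u' with hSdef'
  set e := X.f' j (X.orbit T j u) (w, S w) - X.f' j (X.orbit T j u') (w, S' w) -
    (0, X.B j (S w - S' w)) with he
  have happ := norm_stepDeriv_sub_le hc hu hS w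
  have hNU := X.norm_le_NU_of_approx hc happ
  have hmu := X.mu_mul_NU_le_of_approx hc happ
  have hcone' := cone_of_approx X hc (hS' w) (norm_deriv_apply_sub_le hc hu' (hS' w))
  have key : X.slope T (j + 1) u (R w) - X.slope T (j + 1) u' (R w) =
      X.B j (S w - S' w) + (e.2 - X.slope T (j + 1) u' e.1) := by
    have h1 : X.slope T (j + 1) u (R w) = (X.f' j (X.orbit T j u) (w, S w)).2 :=
      slope_succ_stepDeriv hc hu hS w
    have h2 : X.slope T (j + 1) u' (R' w) = (X.f' j (X.orbit T j u') (w, S' w)).2 :=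
      slope_succ_stepDeriv hc hu' hS' w
    have h3 : R w = R' w + e.1 := by simp [he, hR, hR', stepDeriv_apply, hSdef, hSdef']
    have h4 : e.2 = (X.f' j (X.orbit T j u) (w, S w)).2 -
      (X.f' j (X.orbit T j u') (w, S' w)).2 - X.B j (S w - S' w) := rfl
    rw [h1, h3, map_add, h2, h4]
    abel
  -- the cone condition for the image slope at `u'`
  have hcone'' : X.NV (j + 1) (X.slope T (j + 1) u' e.1) ≤ X.NU (j + 1) e.1 := by
    obtain ⟨y, hy⟩ := exists_stepDeriv_eq hc hu' hS' e.1
    rw [← hy, slope_succ_stepDeriv hc hu' hS']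
    exact cone_of_approx X hc (hS' y) (norm_deriv_apply_sub_le hc hu' (hS' y))
  have hb1 : X.NV (j + 1) (X.B j (S w - S' w)) ≤
      t * (lam * X.NU (j + 1) (R w) + K * ε * ‖w‖) := by
    calc _ ≤ X.μ j * X.NV j (S w - S' w) := X.NV_map _ _
      _ ≤ X.μ j * (t * X.NU j w) := by
          have := X.μ_nonneg j
          gcongr; exact hSS' w
      _ = t * (X.μ j * X.NU j w) := by ring
      _ ≤ _ := by gcongr
  have hb2 : X.NV (j + 1) e.2 ≤ K * ((ε * t + K ^ 2 * h) * ‖w‖) :=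
    (X.NV_le _ _).trans (by gcongr; exact (norm_snd_le _).trans hmain)
  have hb3 : X.NV (j + 1) (X.slope T (j + 1) u' e.1) ≤ K * ((ε * t + K ^ 2 * h) * ‖w‖) :=
    hcone''.trans ((X.NU_le _ _).trans (by gcongr; exact (norm_fst_le _).trans hmain))
  rw [key]
  have hb4 : X.NV (j + 1) (X.B j (S w - S' w) + (e.2 - X.slope T (j + 1) u' e.1)) ≤
      t * (lam * X.NU (j + 1) (R w) + K * ε * ‖w‖) + (K * ((ε * t + K ^ 2 * h) * ‖w‖) +
        K * ((ε * t + K ^ 2 * h) * ‖w‖)) :=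
    (map_add_le_add _ _ _).trans (add_le_add hb1
      ((map_sub_le_add _ _ _).trans (add_le_add hb2 hb3)))
  refine hb4.trans ?_
  have h9 : (3 * K * ε * t + 2 * K ^ 3 * h) * ‖w‖ ≤
      (3 * K * ε * t + 2 * K ^ 3 * h) * (2 * K ^ 2 * X.NU (j + 1) (R w)) := by gcongr
  calc _ = t * lam * X.NU (j + 1) (R w) + (3 * K * ε * t + 2 * K ^ 3 * h) * ‖w‖ := by ring
    _ ≤ t * lam * X.NU (j + 1) (R w) +
        (3 * K * ε * t + 2 * K ^ 3 * h) * (2 * K ^ 2 * X.NU (j + 1) (R w)) := by gcongr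
    _ = _ := by ring

end Variation

end DominatedChain

namespace DominatedChain

variable {U V : Type*} [NormedAddCommGroup U] [NormedSpace ℝ U]
    [NormedAddCommGroup V] [NormedSpace ℝ V] {α C K r lam δ ε σ : ℝ}
    {X : DominatedChain U V α C K r lam}

/-! ### Bounded distortion at hyperbolic times -/

/-- The sequence which bounds the variation of the slopes when the variation of the derivatives
of the maps is bounded by `h`. -/
def slopeVariation (K lam ε : ℝ) (h : ℕ → ℝ) : ℕ → ℝ
  | 0 => 0
  | j + 1 => (lam + 6 * K ^ 3 * ε) * slopeVariation K lam ε h j + 4 * K ^ 5 * h j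

lemma slopeVariation_nonneg (hc : ChainConstants α C K r lam δ ε) {h : ℕ → ℝ} (hh : ∀ j, 0 ≤ h j)
    (j : ℕ) : 0 ≤ slopeVariation K lam ε h j := by
  induction j with
  | zero => simp [slopeVariation]
  | succ j ih =>
    have := hc.lam_pos
    have := hc.ε_pos
    have := hc.one_le_K
    have := hh j
    unfold slopeVariation
    positivity

/-- The Hölder bound for the variation of the derivatives between points whose first components are
at distance `t`. -/
def variationConst (α C K : ℝ) (t : ℝ) : ℝ := C * (K ^ 2 * t) ^ α

section

variable {T : U →L[ℝ] U × V} (hc : ChainConstants α C K r lam δ ε) (hT : X.IsInitialPlane T)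
include hc hT

/-- Before a hyperbolic time the derivatives vary by a geometric sequence, as the orbits approach
each other in the past. -/
lemma norm_deriv_orbit_sub_le (hσ0 : 0 ≤ σ) {n j : ℕ} (hn : X.IsHyperbolicTime ε σ n) (hj : j ≤ n)
    {u u' : U} (hu : u ∈ X.tube T δ n) (hu' : u' ∈ X.tube T δ n) :
    ‖X.f' j (X.orbit T j u) - X.f' j (X.orbit T j u')‖ ≤
      variationConst α C K ‖(X.orbit T n u - X.orbit T n u').1‖ * (σ ^ α) ^ (n - j) := by
  have hr := hc.δ_lt
  refine (X.holder j _ (by simpa using (hu j hj).trans_lt hr) _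
    (by simpa using (hu' j hj).trans_lt hr)).trans ?_
  have h1 := norm_orbit_sub_le hc hT hn hj hu hu'
  have hC := hc.C_nonneg
  have hα := hc.α_pos
  rw [variationConst, mul_assoc]
  gcongr
  rw [Real.rpow_pow_comm hσ0, ← Real.mul_rpow (by positivity) (by positivity)]
  gcongr
  linarith

lemma slope_sub_le [FiniteDimensional ℝ U] {n : ℕ} {h : ℕ → ℝ} (hh0 : ∀ j, 0 ≤ h j) {u u' : U}
    (hu : u ∈ X.tube T δ n) (hu' : u' ∈ X.tube T δ n)
    (hh : ∀ j ≤ n, ‖X.f' j (X.orbit T j u) - X.f' j (X.orbit T j u')‖ ≤ h j) {j : ℕ} (hj : j ≤ n)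
    (w : U) :
    X.NV j (X.slope T j u w - X.slope T j u' w) ≤ slopeVariation K lam ε h j * X.NU j w := by
  induction j generalizing w with
  | zero =>
    have : X.slope T 0 u w - X.slope T 0 u' w = 0 := by simp [slope]
    simp [this, slopeVariation]
  | succ j ih =>
    exact slope_sub_succ_le hc (hu j (by omega)) (hu' j (by omega))
      (slopeVariation_nonneg hc hh0 j)
      (cone_slope hc hT fun i hi ↦ hu i (by omega)) (cone_slope hc hT fun i hi ↦ hu' i (by omega))
      (fun w ↦ ih (by omega) w) (hh j (by omega)) w

/-- The distortion is controlled by the sum of the variations of the slopes and of the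
derivatives. -/
lemma abs_det_jac_le [FiniteDimensional ℝ U] {n : ℕ} {h : ℕ → ℝ} (hh0 : ∀ j, 0 ≤ h j) {u u' : U}
    (hu : u ∈ X.tube T δ n) (hu' : u' ∈ X.tube T δ n)
    (hh : ∀ j ≤ n, ‖X.f' j (X.orbit T j u) - X.f' j (X.orbit T j u')‖ ≤ h j) {j : ℕ}
    (hj : j ≤ n) :
    |(X.jac T j u).det| ≤ |(X.jac T j u').det| * Real.exp (Module.finrank ℝ U * (2 * K *
      ∑ i ∈ Finset.range j, (slopeVariation K lam ε h i + K ^ 2 * h i))) := by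
  induction j with
  | zero => simp [jac]
  | succ j ih =>
    have hK := hc.one_le_K
    have h1 := ih (by omega)
    have h0 := slopeVariation_nonneg hc hh0 j
    have h2 : ‖X.stepDeriv T j u - X.stepDeriv T j u'‖ ≤
        slopeVariation K lam ε h j + K ^ 2 * h j := by
      refine (norm_stepDeriv_sub_stepDeriv_le hc (hu j (by omega)) h0
        (cone_slope hc hT fun i hi ↦ hu' i (by omega))
        (fun w ↦ slope_sub_le hc hT hh0 hu hu' hh (by omega) w) (hh j (by omega))).trans ?_
      gcongr
      refine mul_le_of_le_one_left h0 ?_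
      have := hc.ε_mul_le
      have := hc.ε_pos
      nlinarith
    have hcone := cone_slope hc hT (n := j) (u := u') fun i hi ↦ hu' i (by omega)
    have h3 := ContinuousLinearMap.abs_det_le_mul_exp (X.stepDeriv T j u') (X.stepDeriv T j u)
      (a := 2 * K) (by positivity) ((norm_nonneg _).trans h2)
      (fun w ↦ X.norm_le_two_mul_of_approx hc
        (norm_stepDeriv_sub_le hc (hu' j (by omega)) hcone w)) h2
    have hdet : ∀ v, (X.jac T (j + 1) v).det = (X.stepDeriv T j v).det * (X.jac T j v).det := by
      intro v
      simp only [jac, ContinuousLinearMap.det, ContinuousLinearMap.toLinearMap_comp,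
        LinearMap.det_comp]
    rw [hdet, hdet, abs_mul, abs_mul, Finset.sum_range_succ, mul_add, mul_add, Real.exp_add]
    calc _ ≤ (|(X.stepDeriv T j u').det| * Real.exp (Module.finrank ℝ U * (2 * K *
          (slopeVariation K lam ε h j + K ^ 2 * h j)))) *
          (|(X.jac T j u').det| * Real.exp (Module.finrank ℝ U * (2 * K *
      ∑ i ∈ Finset.range j, (slopeVariation K lam ε h i + K ^ 2 * h i)))) := by gcongr
      _ = _ := by ring

omit hT in
/-- The sums of the variations of the slopes and of the derivatives are bounded independently
of the time. -/
lemma slopeVariation_le {c b : ℝ} (hcc : 0 ≤ c) (hb0 : 0 ≤ b) (hb1 : b < 1) (n : ℕ) :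
    slopeVariation K lam ε (fun j ↦ c * b ^ (n - j)) n ≤ 4 * K ^ 5 * c * (1 - b)⁻¹ ∧
    ∑ i ∈ Finset.range n, (slopeVariation K lam ε (fun j ↦ c * b ^ (n - j)) i +
      K ^ 2 * (c * b ^ (n - i))) ≤
      (1 - (lam + 6 * K ^ 3 * ε))⁻¹ * (4 * K ^ 5 * c * (1 - b)⁻¹) +
        K ^ 2 * (c * (1 - b)⁻¹) := by
  have hK := hc.one_le_K
  set t := slopeVariation K lam ε (fun j ↦ c * b ^ (n - j)) with ht
  have hq : 0 < 1 - (lam + 6 * K ^ 3 * ε) := by linarith [hc.rate_lt_one]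
  have ht0 : ∀ j, 0 ≤ t j := slopeVariation_nonneg hc (fun j ↦ by positivity)
  have h1 := sum_add_le_of_contraction (t := t) (h := fun j ↦ 4 * K ^ 5 * (c * b ^ (n - j)))
    (q := lam + 6 * K ^ 3 * ε) n (fun j _ ↦ le_rfl)
  have h2 := sum_range_pow_sub_le hb0 hb1 n
  have h3 : ∑ j ∈ Finset.range n, 4 * K ^ 5 * (c * b ^ (n - j)) ≤ 4 * K ^ 5 * c * (1 - b)⁻¹ := by
    rw [← Finset.mul_sum, ← Finset.mul_sum, ← mul_assoc]
    gcongr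
  have h4 : t 0 = 0 := rfl
  rw [h4, zero_add] at h1
  have h5 : 0 ≤ ∑ j ∈ Finset.range n, t j := Finset.sum_nonneg fun j _ ↦ ht0 j
  constructor
  · have := mul_nonneg hq.le h5
    linarith
  · rw [Finset.sum_add_distrib, ← Finset.mul_sum, ← Finset.mul_sum]
    gcongr
    rw [inv_mul_eq_div, le_div_iff₀ hq]
    linarith [ht0 n]

/-- The tangent planes at a hyperbolic time vary in a Hölder way, uniformly in the time. -/
lemma norm_slope_sub_le [FiniteDimensional ℝ U] (hσ0 : 0 < σ) (hσ1 : σ < 1) {n : ℕ}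
    (hn : X.IsHyperbolicTime ε σ n) {u u' : U} (hu : u ∈ X.tube T δ n) (hu' : u' ∈ X.tube T δ n) :
    ‖X.slope T n u - X.slope T n u'‖ ≤ K ^ 2 * (4 * K ^ 5 *
      variationConst α C K ‖(X.orbit T n u - X.orbit T n u').1‖ * (1 - σ ^ α)⁻¹) := by
  have hK := hc.one_le_K
  have hC := hc.C_nonneg
  have hb1 : σ ^ α < 1 := Real.rpow_lt_one hσ0.le hσ1 hc.α_pos
  have hb0 : 0 ≤ σ ^ α := by positivity
  set c := variationConst α C K ‖(X.orbit T n u - X.orbit T n u').1‖ with hcdef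
  have hc0 : 0 ≤ c := by rw [hcdef, variationConst]; positivity
  have hb2 : 0 < 1 - σ ^ α := by linarith
  refine ContinuousLinearMap.opNorm_le_bound _ (by positivity) fun w ↦ ?_
  have h1 := slope_sub_le hc hT (h := fun j ↦ c * (σ ^ α) ^ (n - j)) (fun j ↦ by positivity) hu hu'
    (fun j hj ↦ norm_deriv_orbit_sub_le hc hT hσ0.le hn hj hu hu') le_rfl w
  have h2 := (slopeVariation_le hc hc0 hb0 hb1 n).1
  calc ‖(X.slope T n u - X.slope T n u') w‖
      ≤ K * X.NV n (X.slope T n u w - X.slope T n u' w) := X.le_NV _ _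
    _ ≤ K * ((4 * K ^ 5 * c * (1 - σ ^ α)⁻¹) * (K * ‖w‖)) := by
        gcongr
        refine h1.trans ?_
        gcongr
        exact X.NU_le _ _
    _ = _ := by ring

lemma norm_slope_le [FiniteDimensional ℝ U] {n : ℕ} {u : U} (hu : u ∈ X.tube T δ n) :
    ‖X.slope T n u‖ ≤ K ^ 2 := by
  have hK := hc.one_le_K
  refine ContinuousLinearMap.opNorm_le_bound _ (by positivity) fun w ↦ ?_
  have h := (cone_slope hc hT (n := n) (u := u) (fun j hj ↦ hu j hj.le) w).norm_le hK
  exact (norm_snd_le (w, X.slope T n u w)).trans h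

/-- Bounded distortion: at a hyperbolic time the Jacobians at two points of the tube are
comparable, uniformly in the time. -/
lemma abs_det_jac_le_mul [FiniteDimensional ℝ U] (hσ0 : 0 < σ) (hσ1 : σ < 1) {n : ℕ}
    (hn : X.IsHyperbolicTime ε σ n) {u u' : U} (hu : u ∈ X.tube T δ n) (hu' : u' ∈ X.tube T δ n) :
    |(X.jac T n u).det| ≤ |(X.jac T n u').det| * Real.exp (Module.finrank ℝ U * (2 * K *
      ((1 - (lam + 6 * K ^ 3 * ε))⁻¹ *
        (4 * K ^ 5 * variationConst α C K (2 * δ) * (1 - σ ^ α)⁻¹) +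
        K ^ 2 * (variationConst α C K (2 * δ) * (1 - σ ^ α)⁻¹)))) := by
  have hK := hc.one_le_K
  have hC := hc.C_nonneg
  have hδ := hc.δ_pos
  have hb1 : σ ^ α < 1 := Real.rpow_lt_one hσ0.le hσ1 hc.α_pos
  have hb0 : 0 ≤ σ ^ α := by positivity
  have ht : ‖(X.orbit T n u - X.orbit T n u').1‖ ≤ 2 * δ := by
    refine (norm_fst_le _).trans ((norm_sub_le _ _).trans ?_)
    linarith [hu n le_rfl, hu' n le_rfl]
  set c := variationConst α C K (2 * δ) with hcdef
  have hc0 : 0 ≤ c := by rw [hcdef, variationConst]; positivity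
  have h1 := abs_det_jac_le hc hT (h := fun j ↦ c * (σ ^ α) ^ (n - j)) (fun j ↦ by positivity)
    hu hu' (fun j hj ↦ (norm_deriv_orbit_sub_le hc hT hσ0.le hn hj hu hu').trans (by
      have := hc.α_pos
      rw [hcdef, variationConst, variationConst]; gcongr)) le_rfl
  refine h1.trans ?_
  have h2 := (slopeVariation_le hc hc0 hb0 hb1 n).2
  gcongr

/-! ### The inverse branches at hyperbolic times -/

/-- At a hyperbolic time, the disk has a parametrization by a ball of uniform size, whose
backward iterates contract. -/
lemma exists_inverse_branch [FiniteDimensional ℝ U] [Nontrivial U] (hσ0 : 0 < σ) (hσ1 : σ < 1)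
    {n : ℕ} (hn : X.IsHyperbolicTime ε σ n) :
    ∃ ψ : U → U, ψ 0 = 0 ∧
      (∀ w ∈ Metric.closedBall (0 : U) (δ / K ^ 2),
        ψ w ∈ X.tube T δ n ∧ (X.orbit T n (ψ w)).1 = w) ∧
      (∀ u ∈ X.tube T δ n, ‖(X.orbit T n u).1‖ ≤ δ / K ^ 2 → ψ (X.orbit T n u).1 = u) ∧
      (∀ w ∈ Metric.closedBall (0 : U) (δ / K ^ 2), ∀ w' ∈ Metric.closedBall (0 : U) (δ / K ^ 2),
        ‖ψ w - ψ w'‖ ≤ K * σ ^ n * ‖w - w'‖) ∧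
      (∀ w ∈ Metric.ball (0 : U) (δ / K ^ 2), HasFDerivAt (fun w ↦ X.orbit T n (ψ w))
        ((ContinuousLinearMap.id ℝ U).prod (X.slope T n (ψ w))) w) := by
  have hK := hc.one_le_K
  have hδ := hc.δ_pos
  choose! ψ hψ1 hψ2 using fun (w : U) (hw : w ∈ Metric.closedBall (0 : U) (δ / K ^ 2)) ↦
    exists_mem_tube hc hT hσ1.le hn hσ0.le (w := w) (by simpa using hw)
  have hinv : ∀ u ∈ X.tube T δ n, ‖(X.orbit T n u).1‖ ≤ δ / K ^ 2 → ψ (X.orbit T n u).1 = u := by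
    intro u hu hu'
    have h : (X.orbit T n u).1 ∈ Metric.closedBall (0 : U) (δ / K ^ 2) := by simpa using hu'
    exact fst_orbit_injOn hc hT n (hψ1 _ h) hu (hψ2 _ h)
  have hlip : ∀ w ∈ Metric.closedBall (0 : U) (δ / K ^ 2),
      ∀ w' ∈ Metric.closedBall (0 : U) (δ / K ^ 2),
        ‖ψ w - ψ w'‖ ≤ K * σ ^ n * ‖w - w'‖ := by
    intro w hw w' hw'
    have h := norm_sub_le_of_mem_tube hc hT hn (hψ1 w hw) (hψ1 w' hw')
    simpa [hψ2 w hw, hψ2 w' hw', mul_assoc] using h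
  refine ⟨ψ, ?_, fun w hw ↦ ⟨hψ1 w hw, hψ2 w hw⟩, hinv, hlip, ?_⟩
  · have := hinv 0 (X.zero_mem_tube T hδ.le n) (by simp; positivity)
    simpa using this
  · intro w hw
    have hwc := Metric.ball_subset_closedBall hw
    have htube := hψ1 w hwc
    have hF := hasFDerivAt_orbit hc hT (n := n) (u := ψ w) fun j hj ↦ htube j hj.le
    have hF1 : HasFDerivAt (fun u ↦ (X.orbit T n u).1) (X.jac T n (ψ w)) (ψ w) := hF.fst
    have hinj := jac_injective hc hT (n := n) (u := ψ w) fun j hj ↦ htube j hj.le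
    let e : U ≃L[ℝ] U := (LinearEquiv.ofInjectiveEndo (X.jac T n (ψ w) : U →ₗ[ℝ] U)
      hinj).toContinuousLinearEquiv
    have he : (e : U →L[ℝ] U) = X.jac T n (ψ w) := by ext v; rfl
    have hnhds : Metric.ball (0 : U) (δ / K ^ 2) ∈ 𝓝 w := Metric.isOpen_ball.mem_nhds hw
    have hcont : ContinuousAt ψ w := by
      refine ContinuousOn.continuousAt (s := Metric.ball (0 : U) (δ / K ^ 2)) ?_ hnhds
      refine (LipschitzOnWith.of_dist_le_mul (K := Real.toNNReal (K * σ ^ n))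
        fun x hx y hy ↦ ?_).continuousOn
      rw [dist_eq_norm, dist_eq_norm, Real.coe_toNNReal _ (by positivity)]
      exact hlip x (Metric.ball_subset_closedBall hx) y (Metric.ball_subset_closedBall hy)
    have hψ' : HasFDerivAt ψ (e.symm : U →L[ℝ] U) w := by
      refine HasFDerivAt.of_local_left_inverse (f := fun u ↦ (X.orbit T n u).1) hcont
        (by rw [he]; exact hF1) ?_
      filter_upwards [hnhds] with y hy using hψ2 y (Metric.ball_subset_closedBall hy)
    refine (hF.comp w hψ').congr_fderiv ?_
    ext1 v
    have : X.jac T n (ψ w) (e.symm v) = v := e.apply_symm_apply v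
    simp only [ContinuousLinearMap.comp_apply, ContinuousLinearEquiv.coe_coe, this]

end

end DominatedChain

/-! ### Hyperbolic times as record minima -/

/-- A sequence of partial sums which is unbounded below has arbitrarily late record minima. -/
lemma exists_record_minimum {b : ℕ → ℝ} (hb : ∀ x : ℝ, ∃ᶠ n in atTop, b n < x) (N : ℕ) :
    ∃ n ≥ N, ∀ j ≤ n, b n ≤ b j := by
  classical
  obtain ⟨i, -, hi⟩ := Finset.exists_min_image (Finset.range (N + 1)) b ⟨0, by simp⟩
  have hex : ∃ n, b n < b i := (hb (b i)).exists
  have hlt := Nat.find_spec hex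
  have hN : N < Nat.find hex := by
    by_contra! h
    exact absurd (hi (Nat.find hex) (Finset.mem_range.2 (Nat.lt_succ_of_le h))) (not_le.2 hlt)
  refine ⟨Nat.find hex, hN.le, fun j hj ↦ ?_⟩
  rcases hj.eq_or_lt with rfl | hj
  · exact le_rfl
  · exact hlt.le.trans (not_lt.1 (Nat.find_min hex hj))

/-- If the averages of `log (m i)` are infinitely often below `-c`, there are arbitrarily late
times at which all the backward products of the numbers `θ * m i` decay exponentially. -/
lemma exists_prod_le_pow {m : ℕ → ℝ} {c θ σ : ℝ} (hm : ∀ i, 0 < m i) (hθ : 0 < θ) (hσ : 0 < σ)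
    (hc : Real.log θ - Real.log σ < c)
    (hfreq : ∃ᶠ n : ℕ in atTop, (1 / (n : ℝ)) * ∑ i ∈ Finset.range n, Real.log (m i) < -c) (N : ℕ) :
    ∃ n ≥ N, ∀ j ≤ n, ∏ i ∈ Finset.Ico j n, (θ * m i) ≤ σ ^ (n - j) := by
  set a : ℕ → ℝ := fun i ↦ Real.log (m i) + (Real.log θ - Real.log σ) with ha
  set b : ℕ → ℝ := fun n ↦ ∑ i ∈ Finset.range n, a i with hb
  have hunb : ∀ x : ℝ, ∃ᶠ n in atTop, b n < x := by
    intro x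
    have h1 : ∀ᶠ n : ℕ in atTop, (Real.log θ - Real.log σ - c) * n < x := by
      have : Tendsto (fun n : ℕ ↦ (Real.log θ - Real.log σ - c) * (n : ℝ)) atTop atBot :=
        tendsto_natCast_atTop_atTop.const_mul_atTop_of_neg (by linarith)
      exact this.eventually_lt_atBot x
    refine (hfreq.and_eventually (h1.and (eventually_gt_atTop 0))).mono ?_
    rintro n ⟨h2, h3, h4⟩
    have hn : (0 : ℝ) < n := by exact_mod_cast h4
    rw [one_div, inv_mul_eq_div, div_lt_iff₀ hn] at h2
    simp only [hb, ha, Finset.sum_add_distrib, Finset.sum_const, Finset.card_range, nsmul_eq_mul]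
    linarith
  obtain ⟨n, hnN, hn⟩ := exists_record_minimum hunb N
  refine ⟨n, hnN, fun j hj ↦ ?_⟩
  have h1 := hn j hj
  have h2 : ∑ i ∈ Finset.Ico j n, a i ≤ 0 := by
    rw [Finset.sum_Ico_eq_sub _ hj]
    linarith
  have h3 : ∏ i ∈ Finset.Ico j n, (θ * m i) =
      σ ^ (n - j) * Real.exp (∑ i ∈ Finset.Ico j n, a i) := by
    rw [Real.exp_sum, ← Nat.card_Ico j n, ← Finset.prod_const, ← Finset.prod_mul_distrib]
    refine Finset.prod_congr rfl fun i _ ↦ ?_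
    rw [ha]
    simp only
    rw [Real.exp_add, Real.exp_sub, Real.exp_log (hm i), Real.exp_log hθ, Real.exp_log hσ]
    field_simp
  rw [h3]
  exact mul_le_of_le_one_right (by positivity) (Real.exp_le_one_iff.2 h2)

/-! ### Measure estimates -/

section Measure

variable {U : Type*} [NormedAddCommGroup U] [NormedSpace ℝ U] [FiniteDimensional ℝ U]
  [MeasurableSpace U] [BorelSpace U] (μ : Measure U) [μ.IsAddHaarMeasure]

/-- If the Jacobian of `F` on `s` is at most `D` times the Jacobian on `t`, then `F` expands the
measure of `s` at most `D` times as much as that of `t`. -/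
lemma measure_image_mul_le {F : U → U} {F' : U → U →L[ℝ] U} {s t : Set U} {D : ℝ}
    (hs : MeasurableSet s) (ht : MeasurableSet t)
    (hFs : ∀ x ∈ s, HasFDerivWithinAt F (F' x) s x) (hFt : ∀ x ∈ t, HasFDerivWithinAt F (F' x) t x)
    (hinjs : InjOn F s) (hinjt : InjOn F t)
    (hD : ∀ x ∈ s, ∀ y ∈ t, |(F' x).det| ≤ |(F' y).det| * D) :
    μ (F '' s) * μ t ≤ ENNReal.ofReal D * (μ (F '' t) * μ s) := by
  rw [← lintegral_abs_det_fderiv_eq_addHaar_image μ hs hFs hinjs,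
    ← lintegral_abs_det_fderiv_eq_addHaar_image μ ht hFt hinjt]
  have key : ∀ y ∈ t, ∫⁻ x in s, ENNReal.ofReal |(F' x).det| ∂μ ≤
      ENNReal.ofReal D * ENNReal.ofReal |(F' y).det| * μ s := by
    intro y hy
    calc ∫⁻ x in s, ENNReal.ofReal |(F' x).det| ∂μ
        ≤ ∫⁻ x in s, ENNReal.ofReal D * ENNReal.ofReal |(F' y).det| ∂μ := by
          refine setLIntegral_mono' hs fun x hx ↦ ?_
          rw [mul_comm, ← ENNReal.ofReal_mul (abs_nonneg _)]
          exact ENNReal.ofReal_le_ofReal (hD x hx y hy)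
      _ = _ := by rw [setLIntegral_const]
  calc (∫⁻ x in s, ENNReal.ofReal |(F' x).det| ∂μ) * μ t
      = ∫⁻ y in t, (∫⁻ x in s, ENNReal.ofReal |(F' x).det| ∂μ) ∂μ := by rw [setLIntegral_const]
    _ ≤ ∫⁻ y in t, ENNReal.ofReal D * μ s * ENNReal.ofReal |(F' y).det| ∂μ := by
        refine setLIntegral_mono' ht fun y hy ↦ (key y hy).trans (le_of_eq (by ring))
    _ ≤ ENNReal.ofReal D * μ s * ∫⁻ y in t, ENNReal.ofReal |(F' y).det| ∂μ := by
        rw [lintegral_const_mul'']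
        exact (aemeasurable_ofReal_abs_det_fderivWithin μ ht hFt)
    _ = _ := by ring

omit [NormedSpace ℝ U] [FiniteDimensional ℝ U] [BorelSpace U] in
/-- A density point argument for families of small sets which are not balls. The sets `W i` are
nested in the controlled enlargements `P i` when they meet a set `W j` of a smaller generation,
which replaces the geometry of balls in the Vitali covering argument. The set `A` is not assumed
to be measurable. -/
lemma exists_measure_diff_le {ι : Type*} (ν : Measure U) [ν.OuterRegular] [SFinite ν] {t : Set ι}
    {ctr : ι → U} {n : ι → ℕ} {W P : ι → Set U} {R : ℕ → ℝ} (hR : Tendsto R atTop (𝓝 0))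
    {A G : Set U} (hA0 : ν A ≠ 0) (hA : ν A ≠ ⊤) (hAG : A ⊆ G) (hG : MeasurableSet G)
    (hfine : ∀ x ∈ A, ∀ N, ∃ i ∈ t, ctr i = x ∧ N ≤ n i)
    (hP : ∀ i ∈ t, P i ⊆ Metric.closedBall (ctr i) (R (n i)))
    (hW : ∀ i ∈ t, ctr i ∈ W i) (hWm : ∀ i ∈ t, MeasurableSet (W i)) (hW0 : ∀ i ∈ t, 0 < ν (W i))
    {Q : ℝ≥0∞} (hQ0 : Q ≠ 0) (hQ : Q ≠ ⊤) (hPW : ∀ i ∈ t, ν (P i) ≤ Q * ν (W i))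
    (hnest : ∀ i ∈ t, ∀ j ∈ t, n j ≤ n i → (W i ∩ W j).Nonempty → W i ⊆ P j)
    {η : ℝ≥0∞} (hη0 : η ≠ 0) (N : ℕ) :
    ∃ i ∈ t, N ≤ n i ∧ ν (W i \ G) ≤ η * ν (W i) := by
  by_contra! hcon
  have hε : η * ν A / Q ≠ 0 := by
    simp [ENNReal.div_eq_zero_iff, hη0, hA0, hQ]
  -- the open set `O` exceeds `A` so little that no family as below can have a share `η` outside `G`
  obtain ⟨O, hAO, hO, hνO⟩ := A.exists_isOpen_lt_add hA hε
  set t' := {i ∈ t | N ≤ n i ∧ P i ⊆ O} with ht'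
  have hfine' : ∀ x ∈ A, ∃ i ∈ t', ctr i = x := by
    intro x hx
    obtain ⟨ρ, hρ, hball⟩ := Metric.isOpen_iff.1 hO x (hAO hx)
    obtain ⟨N', hN'⟩ := eventually_atTop.1 (hR.eventually_lt_const hρ)
    obtain ⟨i, hi, rfl, hni⟩ := hfine x hx (max N N')
    refine ⟨i, ⟨hi, (le_max_left _ _).trans hni, (hP i hi).trans ?_⟩, rfl⟩
    exact (Metric.closedBall_subset_ball (hN' _ ((le_max_right _ _).trans hni))).trans hball
  obtain ⟨u, hut, hdisj, hcov⟩ := Vitali.exists_disjoint_subfamily_covering_enlargement W t'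
    (fun i ↦ (1 / 2 : ℝ) ^ n i) (3 / 2) (by norm_num) (fun i _ ↦ by positivity) 1
    (fun i _ ↦ pow_le_one₀ (by norm_num) (by norm_num)) (fun i hi ↦ ⟨_, hW i hi.1⟩)
  have hcount : u.Countable := by
    have h1 : (Set.univ : Set u).Countable := by
      have := Measure.countable_meas_pos_of_disjoint_iUnion (μ := ν) (As := fun i : u ↦ W i)
        (fun i ↦ hWm i (hut i.2).1) (fun i j hij ↦ hdisj i.2 j.2 (fun h ↦ hij (Subtype.ext h)))
      exact this.mono fun i _ ↦ hW0 i (hut i.2).1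
    exact Set.countable_univ_iff.1 h1
  have hsub : A ⊆ ⋃ i ∈ u, P i := by
    intro x hx
    obtain ⟨i, hi, rfl⟩ := hfine' x hx
    obtain ⟨j, hj, hne, hle⟩ := hcov i hi
    refine mem_iUnion₂.2 ⟨j, hj, hnest i hi.1 j (hut hj).1 ?_ hne (hW i hi.1)⟩
    -- a factor `3 / 2 < 2` between the sizes orders the generations
    by_contra! hlt
    have h1 : (1 / 2 : ℝ) ^ n j ≤ (1 / 2) ^ (n i + 1) :=
      pow_le_pow_of_le_one (by norm_num) (by norm_num) hlt
    have h2 : (0 : ℝ) < (1 / 2) ^ n i := by positivity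
    rw [pow_succ] at h1
    linarith
  have hWP : ∀ i ∈ u, W i ⊆ P i := fun i hi ↦
    hnest i (hut hi).1 i (hut hi).1 le_rfl ⟨_, hW i (hut hi).1, hW i (hut hi).1⟩
  have h1 : ν A ≤ Q * ∑' i : u, ν (W i) := by
    calc ν A ≤ ν (⋃ i ∈ u, P i) := measure_mono hsub
      _ ≤ ∑' i : u, ν (P i) := measure_biUnion_le ν hcount _
      _ ≤ ∑' i : u, Q * ν (W i) := ENNReal.tsum_le_tsum fun i ↦ hPW i (hut i.2).1
      _ = _ := ENNReal.tsum_mul_left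
  have h2 : η * ∑' i : u, ν (W i) ≤ ν (O \ G) := by
    calc η * ∑' i : u, ν (W i) = ∑' i : u, η * ν (W i) := ENNReal.tsum_mul_left.symm
      _ ≤ ∑' i : u, ν (W i \ G) :=
          ENNReal.tsum_le_tsum fun i ↦ (hcon i (hut i.2).1 (hut i.2).2.1).le
      _ = ν (⋃ i ∈ u, W i \ G) := by
          rw [measure_biUnion hcount]
          · exact fun i hi j hj hij ↦ (hdisj hi hj hij).mono sdiff_subset sdiff_subset
          · exact fun i hi ↦ (hWm i (hut hi).1).diff hG
      _ ≤ ν (O \ G) := by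
          refine measure_mono (iUnion₂_subset fun i hi ↦ sdiff_subset_sdiff_left ?_)
          exact (hWP i hi).trans (hut hi).2.2
  -- only the set `G` is measurable, so that `O` is split along `G` and not along `A`
  have h3 : ν (O \ G) + ν A < ν A + η * ν A / Q := by
    calc ν (O \ G) + ν A ≤ ν (O \ G) + ν (O ∩ G) := by
          gcongr; exact subset_inter hAO hAG
      _ = ν O := by rw [add_comm]; exact measure_inter_add_sdiff O hG
      _ < _ := hνO
  have h4 : ν (O \ G) < η * ν A / Q := by
    rw [add_comm] at h3
    exact lt_of_add_lt_add_left h3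
  have h5 : η * ν A ≤ Q * ν (O \ G) := by
    calc η * ν A ≤ η * (Q * ∑' i : u, ν (W i)) := by gcongr
      _ = Q * (η * ∑' i : u, ν (W i)) := by ring
      _ ≤ _ := by gcongr
  have h6 : Q * ν (O \ G) < η * ν A := by
    calc Q * ν (O \ G) < Q * (η * ν A / Q) := ENNReal.mul_lt_mul_right hQ0 hQ h4
      _ = _ := ENNReal.mul_div_cancel hQ0 hQ
  exact absurd h5 (not_le.2 h6)

end Measure

/-! ### Limits of maps with equi-Hölder derivatives -/

lemma Ultrafilter.exists_tendsto_of_norm_le {F : Type*} [NormedAddCommGroup F] [NormedSpace ℝ F]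
    [FiniteDimensional ℝ F] (l : Ultrafilter ℕ) {x : ℕ → F} {A : ℝ} (hx : ∀ n, ‖x n‖ ≤ A) :
    ∃ y, Tendsto x l (𝓝 y) := by
  have : ProperSpace F := FiniteDimensional.proper ℝ F
  obtain ⟨y, -, hy⟩ := (isCompact_closedBall (0 : F) A).ultrafilter_le_nhds' (l.map x)
    (Filter.mem_map.2 (Filter.univ_mem' fun n ↦ by simpa using hx n))
  exact ⟨y, hy⟩

/-- Along an ultrafilter, a bounded sequence of `C¹` maps whose derivatives are bounded and
equi-Hölder converges pointwise, together with its derivatives. -/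
lemma exists_ultrafilter_limit {U E : Type*} [NormedAddCommGroup U] [NormedSpace ℝ U]
    [FiniteDimensional ℝ U] [NormedAddCommGroup E] [NormedSpace ℝ E] [FiniteDimensional ℝ E]
    (l : Ultrafilter ℕ) {e : ℕ → U → E} {e' : ℕ → U → U →L[ℝ] E} {R A H α : ℝ}
    (hα : 0 < α) (hH : 0 ≤ H)
    (he : ∀ n, ∀ w ∈ Metric.ball (0 : U) R, HasFDerivAt (e n) (e' n w) w)
    (heA : ∀ n, ∀ w ∈ Metric.ball (0 : U) R, ‖e n w‖ ≤ A)
    (he'A : ∀ n, ∀ w ∈ Metric.ball (0 : U) R, ‖e' n w‖ ≤ A)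
    (he'H : ∀ n, ∀ w ∈ Metric.ball (0 : U) R, ∀ w' ∈ Metric.ball (0 : U) R,
      ‖e' n w - e' n w'‖ ≤ H * ‖w - w'‖ ^ α) :
    ∃ (g : U → E) (g' : U → U →L[ℝ] E),
      (∀ w ∈ Metric.ball (0 : U) R, Tendsto (fun n ↦ e n w) l (𝓝 (g w))) ∧
      (∀ w ∈ Metric.ball (0 : U) R, Tendsto (fun n ↦ e' n w) l (𝓝 (g' w))) ∧
      (∀ w ∈ Metric.ball (0 : U) R, HasFDerivAt g (g' w) w) ∧
      ContinuousOn g' (Metric.ball (0 : U) R) := by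
  choose! g hg using fun w (hw : w ∈ Metric.ball (0 : U) R) ↦
    Ultrafilter.exists_tendsto_of_norm_le l fun n ↦ heA n w hw
  choose! g' hg' using fun w (hw : w ∈ Metric.ball (0 : U) R) ↦
    Ultrafilter.exists_tendsto_of_norm_le l fun n ↦ he'A n w hw
  have htaylor : ∀ w ∈ Metric.ball (0 : U) R, ∀ w' ∈ Metric.ball (0 : U) R,
      ‖g w' - g w - g' w (w' - w)‖ ≤ H * ‖w' - w‖ ^ α * ‖w' - w‖ := by
    intro w hw w' hw'
    have hn : ∀ n, ‖e n w' - e n w - e' n w (w' - w)‖ ≤ H * ‖w' - w‖ ^ α * ‖w' - w‖ := by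
      intro n
      have hconv : Convex ℝ (Metric.ball (0 : U) R ∩ Metric.closedBall w ‖w' - w‖) :=
        (convex_ball _ _).inter (convex_closedBall _ _)
      refine hconv.norm_image_sub_le_of_norm_hasFDerivWithin_le' (f := e n) (f' := e' n)
        (fun x hx ↦ (he n x hx.1).hasFDerivWithinAt) (fun x hx ↦ ?_)
        (x := w) (y := w') ⟨hw, by simp⟩ ⟨hw', by simp [dist_eq_norm]⟩
      refine (he'H n x hx.1 w hw).trans ?_
      gcongr
      simpa [dist_eq_norm] using hx.2
    have h1 : Tendsto (fun n ↦ ‖e n w' - e n w - e' n w (w' - w)‖) l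
        (𝓝 ‖g w' - g w - g' w (w' - w)‖) :=
      (((hg w' hw').sub (hg w hw)).sub
        (((ContinuousLinearMap.apply ℝ E (w' - w)).continuous.tendsto _).comp (hg' w hw))).norm
    exact le_of_tendsto h1 (Eventually.of_forall hn)
  have hHol : ∀ w ∈ Metric.ball (0 : U) R, ∀ w' ∈ Metric.ball (0 : U) R,
      ‖g' w - g' w'‖ ≤ H * ‖w - w'‖ ^ α := fun w hw w' hw' ↦
    le_of_tendsto ((hg' w hw).sub (hg' w' hw')).norm
      (Eventually.of_forall fun n ↦ he'H n w hw w' hw')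
  have hsmall : ∀ w : U, Tendsto (fun w' ↦ H * ‖w' - w‖ ^ α) (𝓝 w) (𝓝 0) := by
    intro w
    have h : Continuous fun w' : U ↦ H * ‖w' - w‖ ^ α := by
      have := hα.le
      exact continuous_const.mul ((continuous_id.sub continuous_const).norm.rpow_const
        fun _ ↦ Or.inr this)
    have := h.tendsto w
    simpa [Real.zero_rpow hα.ne'] using this
  refine ⟨g, g', hg, hg', fun w hw ↦ ?_, fun w hw ↦ ?_⟩
  · rw [hasFDerivAt_iff_isLittleO, Asymptotics.isLittleO_iff]
    intro c hc
    filter_upwards [Metric.isOpen_ball.mem_nhds hw, (hsmall w).eventually_le_const hc]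
      with w' hw' hc'
    exact (htaylor w hw w' hw').trans (by gcongr)
  · refine ContinuousAt.continuousWithinAt ?_
    rw [ContinuousAt, tendsto_iff_norm_sub_tendsto_zero]
    refine squeeze_zero' (Eventually.of_forall fun _ ↦ norm_nonneg _) ?_ (hsmall w)
    filter_upwards [Metric.isOpen_ball.mem_nhds hw] with w' hw' using hHol w' hw' w hw

/-! ### Maps with locally Hölder derivative -/

section HolderDerivative

variable {E F G : Type*} [NormedAddCommGroup E] [NormedSpace ℝ E] [NormedAddCommGroup F]
  [NormedSpace ℝ F] [NormedAddCommGroup G] [NormedSpace ℝ G]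

/-- On the ball of radius `r` around `x` the map `f` is differentiable, and its derivative is
Hölder continuous with exponent `α` and bounded by the same constant `C`. -/
def IsHolderC1On (α C r : ℝ) (f : E → F) (x : E) : Prop :=
  (∀ y ∈ Metric.ball x r, DifferentiableAt ℝ f y) ∧
  (∀ y ∈ Metric.ball x r, ‖fderiv ℝ f y‖ ≤ C) ∧
  ∀ y ∈ Metric.ball x r, ∀ z ∈ Metric.ball x r,
    ‖fderiv ℝ f y - fderiv ℝ f z‖ ≤ C * ‖y - z‖ ^ α

/-- The map `f` has near `x` a Hölder continuous derivative with exponent `α`. -/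
def IsHolderC1At (α : ℝ) (f : E → F) (x : E) : Prop :=
  ∃ C r : ℝ, 0 < r ∧ IsHolderC1On α C r f x

lemma IsHolderC1On.mono {α C C' r r' : ℝ} {f : E → F} {x x' : E} (h : IsHolderC1On α C r f x)
    (hC : C ≤ C') (hball : Metric.ball x' r' ⊆ Metric.ball x r) : IsHolderC1On α C' r' f x' := by
  refine ⟨fun y hy ↦ h.1 y (hball hy), fun y hy ↦ (h.2.1 y (hball hy)).trans hC,
    fun y hy z hz ↦ (h.2.2 y (hball hy) z (hball hz)).trans ?_⟩
  gcongr

lemma IsHolderC1At.of_nhds {α : ℝ} (hα : 0 < α) {f : E → F} {x : E} {s : Set E} (hs : s ∈ 𝓝 x)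
    {C : ℝ} (hd : ∀ y ∈ s, DifferentiableAt ℝ f y)
    (h : ∀ y ∈ s, ∀ z ∈ s, ‖fderiv ℝ f y - fderiv ℝ f z‖ ≤ C * ‖y - z‖ ^ α) :
    IsHolderC1At α f x := by
  obtain ⟨r, hr, hrs⟩ := Metric.mem_nhds_iff.1 hs
  have hxs : x ∈ s := mem_of_mem_nhds hs
  have hsub : Metric.ball x (min r 1) ⊆ s :=
    (Metric.ball_subset_ball (min_le_left _ _)).trans hrs
  refine ⟨|C| + ‖fderiv ℝ f x‖, min r 1, by positivity, fun y hy ↦ hd y (hsub hy),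
    fun y hy ↦ ?_, fun y hy z hz ↦ (h y (hsub hy) z (hsub hz)).trans ?_⟩
  · have h1 := h y (hsub hy) x hxs
    have h2 : ‖y - x‖ ^ α ≤ 1 := Real.rpow_le_one (norm_nonneg _)
      (by rw [← dist_eq_norm]; exact (hy.le.trans (min_le_right _ _))) hα.le
    calc ‖fderiv ℝ f y‖ = ‖(fderiv ℝ f y - fderiv ℝ f x) + fderiv ℝ f x‖ := by simp
      _ ≤ ‖fderiv ℝ f y - fderiv ℝ f x‖ + ‖fderiv ℝ f x‖ := norm_add_le _ _
      _ ≤ |C| * 1 + ‖fderiv ℝ f x‖ := by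
          gcongr
          refine h1.trans ?_
          gcongr
          exact le_abs_self C
      _ = _ := by ring
  · gcongr
    exact (le_abs_self C).trans (by simp)

lemma IsHolderC1At.of_contDiffAt {α : ℝ} (hα : 0 < α) (hα1 : α ≤ 1) {f : E → F} {x : E}
    (hf : ContDiffAt ℝ 2 f x) : IsHolderC1At α f x := by
  have h1 : ContDiffAt ℝ 1 (fderiv ℝ f) x := hf.fderiv_right (by norm_num)
  obtain ⟨L, s, hs, hL⟩ := h1.exists_lipschitzOnWith
  have h2 : ∀ᶠ y in 𝓝 x, DifferentiableAt ℝ f y :=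
    (hf.eventually (by norm_num)).mono fun y hy ↦ hy.differentiableAt (by norm_num)
  refine IsHolderC1At.of_nhds hα (C := L)
    (inter_mem (inter_mem hs h2) (Metric.ball_mem_nhds x (by norm_num : (0 : ℝ) < 1 / 2)))
    (fun y hy ↦ hy.1.2) fun y hy z hz ↦ ?_
  have h3 := hL.dist_le_mul y hy.1.1 z hz.1.1
  rw [dist_eq_norm, dist_eq_norm] at h3
  refine h3.trans ?_
  have h4 : ‖y - z‖ ≤ 1 := by
    rw [← dist_eq_norm]
    have h5 := (Metric.mem_ball.1 hy.2).le
    have h6 := (Metric.mem_ball.1 hz.2).le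
    have := dist_triangle_right y z x
    linarith
  gcongr
  calc ‖y - z‖ = ‖y - z‖ ^ (1 : ℝ) := (Real.rpow_one _).symm
    _ ≤ ‖y - z‖ ^ α := Real.rpow_le_rpow_of_exponent_ge' (norm_nonneg _) h4 hα.le hα1

lemma IsHolderC1On.norm_image_sub_le {α C r : ℝ} {f : E → F} {x y z : E}
    (h : IsHolderC1On α C r f x) (hy : y ∈ Metric.ball x r) (hz : z ∈ Metric.ball x r) :
    ‖f y - f z‖ ≤ C * ‖y - z‖ :=
  (convex_ball x r).norm_image_sub_le_of_norm_fderiv_le h.1 h.2.1 hz hy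

lemma IsHolderC1At.congr {α : ℝ} {f g : E → F} {x : E} (h : IsHolderC1At α f x)
    (hfg : g =ᶠ[𝓝 x] f) : IsHolderC1At α g x := by
  obtain ⟨C, r, hr, h⟩ := h
  obtain ⟨r', hr', hfg⟩ := Metric.mem_nhds_iff.1 hfg.eventuallyEq_nhds
  have hfg' : ∀ y ∈ Metric.ball x (min r r'), g =ᶠ[𝓝 y] f := fun y hy ↦
    hfg (Metric.ball_subset_ball (min_le_right _ _) hy)
  have h' := h.mono le_rfl (Metric.ball_subset_ball (min_le_left r r'))
  refine ⟨C, min r r', lt_min hr hr', fun y hy ↦ (h'.1 y hy).congr_of_eventuallyEq (hfg' y hy),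
    fun y hy ↦ ?_, fun y hy z hz ↦ ?_⟩
  · rw [(hfg' y hy).fderiv_eq]; exact h'.2.1 y hy
  · rw [(hfg' y hy).fderiv_eq, (hfg' z hz).fderiv_eq]; exact h'.2.2 y hy z hz

/-- Compositions: the derivative is locally bounded, so that Hölder continuity of the two factors
passes to the product in the chain rule. -/
lemma IsHolderC1At.comp {α : ℝ} (hα : 0 < α) {g : F → G} {f : E → F} {x : E}
    (hg : IsHolderC1At α g (f x)) (hf : IsHolderC1At α f x) : IsHolderC1At α (g ∘ f) x := by
  obtain ⟨C, r, hr, hf⟩ := hf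
  obtain ⟨D, s, hs, hg⟩ := hg
  have hC : 0 ≤ C := (norm_nonneg _).trans (hf.2.1 x (Metric.mem_ball_self hr))
  have hD : 0 ≤ D := (norm_nonneg _).trans (hg.2.1 (f x) (Metric.mem_ball_self hs))
  have hcont : ContinuousAt f x := (hf.1 x (Metric.mem_ball_self hr)).continuousAt
  refine IsHolderC1At.of_nhds hα (C := D * C + D * C ^ α * C)
    (inter_mem (Metric.ball_mem_nhds x hr) (hcont.preimage_mem_nhds (Metric.ball_mem_nhds _ hs)))
    (fun y hy ↦ (hg.1 _ hy.2).comp y (hf.1 y hy.1)) ?_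
  rintro y ⟨hy, hy'⟩ z ⟨hz, hz'⟩
  rw [fderiv_comp y (hg.1 _ hy') (hf.1 y hy), fderiv_comp z (hg.1 _ hz') (hf.1 z hz)]
  have e : fderiv ℝ g (f y) ∘L fderiv ℝ f y - fderiv ℝ g (f z) ∘L fderiv ℝ f z =
      fderiv ℝ g (f y) ∘L (fderiv ℝ f y - fderiv ℝ f z) +
        (fderiv ℝ g (f y) - fderiv ℝ g (f z)) ∘L fderiv ℝ f z := by
    ext1 v; simp
  rw [e]
  calc _ ≤ ‖fderiv ℝ g (f y)‖ * ‖fderiv ℝ f y - fderiv ℝ f z‖ +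
        ‖fderiv ℝ g (f y) - fderiv ℝ g (f z)‖ * ‖fderiv ℝ f z‖ :=
        (norm_add_le _ _).trans (add_le_add (ContinuousLinearMap.opNorm_comp_le _ _)
          (ContinuousLinearMap.opNorm_comp_le _ _))
    _ ≤ D * (C * ‖y - z‖ ^ α) + D * (C * ‖y - z‖) ^ α * C := by
        gcongr
        · exact hg.2.1 _ hy'
        · exact hf.2.2 y hy z hz
        · refine (hg.2.2 _ hy' _ hz').trans ?_
          gcongr
          exact hf.norm_image_sub_le hy hz
        · exact hf.2.1 z hz
    _ = _ := by rw [Real.mul_rpow hC (norm_nonneg _)]; ring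

end HolderDerivative

/-! ### Coordinates on the tangent bundle -/

section Charts

variable {d : ℕ} {M : Type*} [TopologicalSpace M] [ChartedSpace (EuclideanSpace ℝ (Fin d)) M]

variable [IsManifold (𝓡 d) ∞ M]

/-- The coordinates of the tangent vectors at `y` in the chart at `c`, that is, the derivative at
`y` of that chart. Meaningful for `y` in the domain of the chart. -/
def tangentCoord (c y : M) : TangentSpace (𝓡 d) y →L[ℝ] 𝔼[d] :=
  (trivializationAt 𝔼[d] (fun x : M ↦ TangentSpace (𝓡 d) x) c).continuousLinearMapAt ℝ y

/-- The inverse of `tangentCoord c y`. -/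
def tangentCoordSymm (c y : M) : 𝔼[d] →L[ℝ] TangentSpace (𝓡 d) y :=
  (trivializationAt 𝔼[d] (fun x : M ↦ TangentSpace (𝓡 d) x) c).symmL ℝ y

lemma tangentCoord_eq_mfderiv {c y : M} (hy : y ∈ (extChartAt (𝓡 d) c).source) :
    tangentCoord c y = mfderiv (𝓡 d) 𝓘(ℝ, 𝔼[d]) (extChartAt (𝓡 d) c) y := by
  rw [extChartAt_source] at hy
  exact TangentBundle.continuousLinearMapAt_trivializationAt hy

lemma tangentCoordSymm_tangentCoord {c y : M} (hy : y ∈ (extChartAt (𝓡 d) c).source)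
    (v : TangentSpace (𝓡 d) y) : tangentCoordSymm c y (tangentCoord c y v) = v := by
  rw [extChartAt_source] at hy
  exact (trivializationAt 𝔼[d] (fun x : M ↦ TangentSpace (𝓡 d) x)
    c).symmL_continuousLinearMapAt (R := ℝ) hy v

lemma tangentCoord_tangentCoordSymm {c y : M} (hy : y ∈ (extChartAt (𝓡 d) c).source) (v : 𝔼[d]) :
    tangentCoord c y (tangentCoordSymm c y v) = v := by
  rw [extChartAt_source] at hy
  exact (trivializationAt 𝔼[d] (fun x : M ↦ TangentSpace (𝓡 d) x)
    c).continuousLinearMapAt_symmL (R := ℝ) hy v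

lemma hasMFDerivAt_extChartAt_tangentCoord {c y : M} (hy : y ∈ (extChartAt (𝓡 d) c).source) :
    HasMFDerivAt (𝓡 d) 𝓘(ℝ, 𝔼[d]) (extChartAt (𝓡 d) c) y (tangentCoord c y) := by
  rw [tangentCoord_eq_mfderiv hy]
  rw [extChartAt_source] at hy
  exact (mdifferentiableAt_extChartAt hy).hasMFDerivAt

lemma hasMFDerivAt_extChartAt_symm {c : M} {z : 𝔼[d]} (hz : z ∈ (extChartAt (𝓡 d) c).target) :
    HasMFDerivAt 𝓘(ℝ, 𝔼[d]) (𝓡 d) (extChartAt (𝓡 d) c).symm z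
      (tangentCoordSymm c ((extChartAt (𝓡 d) c).symm z)) := by
  have hy := (extChartAt (𝓡 d) c).map_target hz
  have h1 := mdifferentiableWithinAt_extChartAt_symm (I := 𝓡 d) hz
  rw [ModelWithCorners.Boundaryless.range_eq_univ, mdifferentiableWithinAt_univ] at h1
  have h3 : tangentCoordSymm c ((extChartAt (𝓡 d) c).symm z) =
      mfderivWithin 𝓘(ℝ, 𝔼[d]) (𝓡 d) (extChartAt (𝓡 d) c).symm (range (𝓡 d))
        (extChartAt (𝓡 d) c ((extChartAt (𝓡 d) c).symm z)) := by
    rw [extChartAt_source] at hy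
    exact TangentBundle.symmL_trivializationAt hy
  rw [ModelWithCorners.Boundaryless.range_eq_univ, mfderivWithin_univ] at h3
  rw [h3, (extChartAt (𝓡 d) c).right_inv hz]
  exact h1.hasMFDerivAt

/-- The map `f` in the charts at `c` and at `c'`. -/
def inCharts (f : M → M) (c c' : M) : 𝔼[d] → 𝔼[d] :=
  extChartAt (𝓡 d) c' ∘ f ∘ (extChartAt (𝓡 d) c).symm

lemma hasFDerivAt_inCharts {f : M → M} {c c' : M} {z : 𝔼[d]}
    (hz : z ∈ (extChartAt (𝓡 d) c).target)
    (hz' : f ((extChartAt (𝓡 d) c).symm z) ∈ (extChartAt (𝓡 d) c').source)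
    (hf : MDifferentiableAt (𝓡 d) (𝓡 d) f ((extChartAt (𝓡 d) c).symm z)) :
    HasFDerivAt (inCharts f c c') (tangentCoord c' (f ((extChartAt (𝓡 d) c).symm z)) ∘L
      mfderiv (𝓡 d) (𝓡 d) f ((extChartAt (𝓡 d) c).symm z) ∘L
        tangentCoordSymm c ((extChartAt (𝓡 d) c).symm z)) z := by
  have h1 := hasMFDerivAt_extChartAt_symm hz
  have h2 := hf.hasMFDerivAt
  have h3 := hasMFDerivAt_extChartAt_tangentCoord hz'
  exact (HasMFDerivAt.comp (I' := 𝓡 d) z h3 (HasMFDerivAt.comp (I' := 𝓡 d) z h2 h1)).hasFDerivAt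

/-- The derivative in charts, applied to the coordinates of a tangent vector. -/
lemma fderiv_inCharts_tangentCoord {f : M → M} {c c' y : M}
    (hy : y ∈ (extChartAt (𝓡 d) c).source) (hy' : f y ∈ (extChartAt (𝓡 d) c').source)
    (hf : MDifferentiableAt (𝓡 d) (𝓡 d) f y) (v : TangentSpace (𝓡 d) y) :
    fderiv ℝ (inCharts f c c') (extChartAt (𝓡 d) c y) (tangentCoord c y v) =
      tangentCoord c' (f y) (mfderiv (𝓡 d) (𝓡 d) f y v) := by
  obtain ⟨z, hz, rfl⟩ : ∃ z ∈ (extChartAt (𝓡 d) c).target, (extChartAt (𝓡 d) c).symm z = y :=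
    ⟨_, (extChartAt (𝓡 d) c).map_source hy, (extChartAt (𝓡 d) c).left_inv hy⟩
  rw [(extChartAt (𝓡 d) c).right_inv hz, (hasFDerivAt_inCharts hz hy' hf).fderiv]
  simp only [ContinuousLinearMap.comp_apply]
  rw [tangentCoordSymm_tangentCoord hy]

lemma contDiffAt_chart_transition {c c' x : M} (hx : x ∈ (extChartAt (𝓡 d) c).source)
    (hx' : x ∈ (extChartAt (𝓡 d) c').source) :
    ContDiffAt ℝ ∞ (extChartAt (𝓡 d) c' ∘ (extChartAt (𝓡 d) c).symm) (extChartAt (𝓡 d) c x) := by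
  have h := contDiffWithinAt_ext_coord_change (I := 𝓡 d) (n := ∞) c' c
    (y := extChartAt (𝓡 d) c x) (by
      rw [PartialEquiv.trans_source]
      refine ⟨(extChartAt (𝓡 d) c).map_source hx, ?_⟩
      rwa [mem_preimage, (extChartAt (𝓡 d) c).left_inv hx])
  rwa [ModelWithCorners.Boundaryless.range_eq_univ, contDiffWithinAt_univ] at h

omit [IsManifold (𝓡 d) ∞ M] in
lemma tendsto_extChartAt_symm {c x : M} (hx : x ∈ (extChartAt (𝓡 d) c).source) :
    Tendsto (extChartAt (𝓡 d) c).symm (𝓝 (extChartAt (𝓡 d) c x)) (𝓝 x) := by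
  have := continuousAt_extChartAt_symm' (I := 𝓡 d) hx
  rwa [ContinuousAt, (extChartAt (𝓡 d) c).left_inv hx] at this

/-- In any two charts, the map `f` has a locally Hölder derivative. -/
lemma isHolderC1At_inCharts {α : ℝ≥0} (hα₀ : 0 < α) (hα₁ : α ≤ 1) {f : M → M}
    (hf : HasLocallyHolderDerivative (d := d) α f) (hf1 : ContMDiff (𝓡 d) (𝓡 d) 1 f)
    {c c' x : M} (hx : x ∈ (extChartAt (𝓡 d) c).source)
    (hx' : f x ∈ (extChartAt (𝓡 d) c').source) :
    IsHolderC1At (α : ℝ) (inCharts f c c') (extChartAt (𝓡 d) c x) := by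
  have hα0 : (0 : ℝ) < α := by exact_mod_cast hα₀
  have hα1 : (α : ℝ) ≤ 1 := by exact_mod_cast hα₁
  -- the map in the preferred charts at `x` and at `f x`
  obtain ⟨C, U, hU, hC⟩ := hf x
  have hcont : ContinuousAt f x := hf1.continuous.continuousAt
  have hmain : IsHolderC1At (α : ℝ) (inCharts f x (f x)) (extChartAt (𝓡 d) x x) := by
    have h1 : ∀ᶠ z in 𝓝 (extChartAt (𝓡 d) x x), DifferentiableAt ℝ (inCharts f x (f x)) z := by
      have h2 := tendsto_extChartAt_symm (mem_extChartAt_source (I := 𝓡 d) x)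
      filter_upwards [extChartAt_target_mem_nhds (I := 𝓡 d) x,
        (hcont.tendsto.comp h2).eventually (extChartAt_source_mem_nhds (I := 𝓡 d) (f x))]
        with z hz hz'
      exact (hasFDerivAt_inCharts hz hz' (hf1.mdifferentiable one_ne_zero _)).differentiableAt
    refine IsHolderC1At.of_nhds hα0 (inter_mem hU h1) (fun y hy ↦ hy.2) (C := C) ?_
    intro y hy z hz
    have h2 := hC.dist_le hy.1 hz.1
    rw [dist_eq_norm, dist_eq_norm] at h2
    exact h2
  have e1 : (extChartAt (𝓡 d) x ∘ (extChartAt (𝓡 d) c).symm) (extChartAt (𝓡 d) c x) =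
      extChartAt (𝓡 d) x x := by
    simp only [Function.comp_apply]
    rw [(extChartAt (𝓡 d) c).left_inv hx]
  have e2 : inCharts f x (f x) (extChartAt (𝓡 d) x x) = extChartAt (𝓡 d) (f x) (f x) := by
    simp only [inCharts, Function.comp_apply]
    rw [extChartAt_to_inv]
  have hT1 : IsHolderC1At (α : ℝ) (extChartAt (𝓡 d) x ∘ (extChartAt (𝓡 d) c).symm)
      (extChartAt (𝓡 d) c x) := IsHolderC1At.of_contDiffAt hα0 hα1
    ((contDiffAt_chart_transition hx (mem_extChartAt_source x)).of_le ENat.LEInfty.out)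
  have hT2 : IsHolderC1At (α : ℝ) (extChartAt (𝓡 d) c' ∘ (extChartAt (𝓡 d) (f x)).symm)
      (extChartAt (𝓡 d) (f x) (f x)) := IsHolderC1At.of_contDiffAt hα0 hα1
    ((contDiffAt_chart_transition (mem_extChartAt_source _) hx').of_le ENat.LEInfty.out)
  have h3 := IsHolderC1At.comp hα0 (e2 ▸ hT2) hmain
  have h4 := IsHolderC1At.comp hα0 (e1.symm ▸ h3) hT1
  refine h4.congr ?_
  have hsymm := tendsto_extChartAt_symm hx
  filter_upwards [hsymm.eventually (extChartAt_source_mem_nhds (I := 𝓡 d) x),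
    (hcont.tendsto.comp hsymm).eventually (extChartAt_source_mem_nhds (I := 𝓡 d) (f x))] with z h5 h6
  simp only [inCharts, Function.comp_apply] at h6 ⊢
  rw [(extChartAt (𝓡 d) x).left_inv h5, (extChartAt (𝓡 d) (f x)).left_inv h6]

/-! ### Norms and distances in charts -/

lemma isContinuousRiemannianBundle_of_isContMDiff
    (R : RiemannianBundle (fun x : M ↦ TangentSpace (𝓡 d) x))
    [h : IsContMDiffRiemannianBundle (𝓡 d) ∞ 𝔼[d] (fun x : M ↦ TangentSpace (𝓡 d) x)] :
    IsContinuousRiemannianBundle 𝔼[d] (fun x : M ↦ TangentSpace (𝓡 d) x) := by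
  obtain ⟨g, hg, hg'⟩ := h.exists_contMDiff
  exact ⟨g, hg.continuous, hg'⟩

/-- A family of seminorms on the tangent spaces is locally equivalent to the norms of the
coordinates in charts. -/
def IsLocallyEquivalent (N : ∀ x : M, Seminorm ℝ (TangentSpace (𝓡 d) x)) : Prop :=
  ∀ c : M, ∃ C : ℝ, ∀ᶠ y in 𝓝 c, ∀ v : TangentSpace (𝓡 d) y,
    ‖tangentCoord c y v‖ ≤ C * N y v ∧ N y v ≤ C * ‖tangentCoord c y v‖

lemma isLocallyEquivalent_norm [RiemannianBundle (fun x : M ↦ TangentSpace (𝓡 d) x)]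
    [IsContinuousRiemannianBundle 𝔼[d] (fun x : M ↦ TangentSpace (𝓡 d) x)] :
    IsLocallyEquivalent (fun x : M ↦ normSeminorm ℝ (TangentSpace (𝓡 d) x)) := by
  intro c
  obtain ⟨C1, h1, h1'⟩ := eventually_norm_trivializationAt_lt 𝔼[d]
    (fun x : M ↦ TangentSpace (𝓡 d) x) c
  obtain ⟨C2, h2, h2'⟩ := eventually_norm_symmL_trivializationAt_lt 𝔼[d]
    (fun x : M ↦ TangentSpace (𝓡 d) x) c
  refine ⟨max C1 C2, ?_⟩
  filter_upwards [h1', h2', extChartAt_source_mem_nhds (I := 𝓡 d) c] with y hy1 hy2 hy3 v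
  constructor
  · refine ((tangentCoord c y).le_opNorm v).trans ?_
    exact mul_le_mul_of_nonneg_right (hy1.le.trans (le_max_left _ _)) (norm_nonneg _)
  · have e : ‖v‖ = ‖tangentCoordSymm c y (tangentCoord c y v)‖ := by
      rw [tangentCoordSymm_tangentCoord hy3]
    change ‖v‖ ≤ _
    rw [e]
    refine (ContinuousLinearMap.le_opNorm (tangentCoordSymm (d := d) c y) _).trans ?_
    exact mul_le_mul_of_nonneg_right (hy2.le.trans (le_max_right _ _)) (norm_nonneg _)

end Charts

section Distance

variable {d : ℕ} {M : Type*} [EMetricSpace M] [ChartedSpace (EuclideanSpace ℝ (Fin d)) M]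
  [IsManifold (𝓡 d) ∞ M] [RiemannianBundle (fun x : M ↦ TangentSpace (𝓡 d) x)]
  [IsContMDiffRiemannianBundle (𝓡 d) ∞ 𝔼[d] (fun x : M ↦ TangentSpace (𝓡 d) x)]
  [IsRiemannianManifold (𝓡 d) M]

/-- Near the centre of a chart, the inverse of the chart is Lipschitz for the Riemannian
distance: push forward the segments. -/
lemma exists_edist_extChartAt_symm_le (c : M) :
    ∃ C : ℝ≥0, ∃ r > 0, Metric.ball (extChartAt (𝓡 d) c c) r ⊆ (extChartAt (𝓡 d) c).target ∧
      ∀ p ∈ Metric.ball (extChartAt (𝓡 d) c c) r, ∀ q ∈ Metric.ball (extChartAt (𝓡 d) c c) r,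
        edist ((extChartAt (𝓡 d) c).symm p) ((extChartAt (𝓡 d) c).symm q) ≤ C * edist p q := by
  have := isContinuousRiemannianBundle_of_isContMDiff (d := d) (M := M) inferInstance
  obtain ⟨C, hC⟩ := isLocallyEquivalent_norm (d := d) (M := M) c
  obtain ⟨r, r_pos, hr⟩ := Metric.mem_nhds_iff.1
    (inter_mem (extChartAt_target_mem_nhds (I := 𝓡 d) c)
      ((tendsto_extChartAt_symm (mem_extChartAt_source (I := 𝓡 d) c)).eventually hC))
  have hC' : ∀ z ∈ Metric.ball (extChartAt (𝓡 d) c c) r, ∀ v : 𝔼[d],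
      ‖tangentCoordSymm c ((extChartAt (𝓡 d) c).symm z) v‖ₑ ≤ C.toNNReal * ‖v‖ₑ := by
    intro z hz v
    have h1 := ((hr hz).2 (tangentCoordSymm c ((extChartAt (𝓡 d) c).symm z) v)).2
    rw [tangentCoord_tangentCoordSymm ((extChartAt (𝓡 d) c).map_target (hr hz).1)] at h1
    rw [← ofReal_norm, ← ofReal_norm, ← ENNReal.ofReal.eq_1,
      ← ENNReal.ofReal_mul' (norm_nonneg _)]
    exact ENNReal.ofReal_le_ofReal h1
  refine ⟨C.toNNReal, r, r_pos, hr.trans inter_subset_left, fun p hp q hq ↦ ?_⟩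
  let η := ContinuousAffineMap.lineMap (R := ℝ) p q
  set γ := (extChartAt (𝓡 d) c).symm ∘ η
  have hη : ∀ t ∈ Icc (0 : ℝ) 1, η t ∈ Metric.ball (extChartAt (𝓡 d) c c) r := by
    intro t ht
    refine (convex_ball (extChartAt (𝓡 d) c c) r).segment_subset hp hq ?_
    rw [segment_eq_image_lineMap]
    exact ⟨t, ht, by simp [η, ContinuousAffineMap.coe_lineMap_eq]⟩
  have η_smooth : ContMDiffOn 𝓘(ℝ, ℝ) 𝓘(ℝ, 𝔼[d]) 1 η (Icc 0 1) := by
    apply ContMDiff.contMDiffOn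
    rw [contMDiff_iff_contDiff]
    exact ContinuousAffineMap.contDiff _
  have hle : edist ((extChartAt (𝓡 d) c).symm p) ((extChartAt (𝓡 d) c).symm q) ≤
      Manifold.pathELength (𝓡 d) γ 0 1 := by
    rw [IsRiemannianManifold.out (I := 𝓡 d)]
    apply riemannianEDist_le_pathELength _ _ _ zero_le_one
    · exact (contMDiffOn_extChartAt_symm c).comp η_smooth fun t ht ↦ (hr (hη t ht)).1
    · simp [γ, η, ContinuousAffineMap.coe_lineMap_eq]
    · simp [γ, η, ContinuousAffineMap.coe_lineMap_eq]
  refine hle.trans ?_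
  rw [← lintegral_fderiv_lineMap_eq_edist, pathELength_eq_lintegral_mfderivWithin_Icc,
    ← lintegral_const_mul' _ _ ENNReal.coe_ne_top]
  refine setLIntegral_mono' measurableSet_Icc fun t ht ↦ ?_
  have h1 : mfderivWithin 𝓘(ℝ, ℝ) (𝓡 d) γ (Icc 0 1) t =
      (tangentCoordSymm c ((extChartAt (𝓡 d) c).symm (η t))) ∘L
        (mfderivWithin 𝓘(ℝ, ℝ) 𝓘(ℝ, 𝔼[d]) η (Icc 0 1) t) := by
    have hu : UniqueMDiffWithinAt 𝓘(ℝ, ℝ) (Icc (0 : ℝ) 1) t := by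
      rw [uniqueMDiffWithinAt_iff_uniqueDiffWithinAt]
      exact uniqueDiffOn_Icc zero_lt_one t ht
    refine HasMFDerivWithinAt.mfderivWithin ?_ hu
    exact (hasMFDerivAt_extChartAt_symm (hr (hη t ht)).1).comp_hasMFDerivWithinAt t
      (η_smooth.mdifferentiableOn one_ne_zero t ht).hasMFDerivWithinAt
  have h2 : mfderivWithin 𝓘(ℝ, ℝ) (𝓡 d) γ (Icc 0 1) t 1 =
      tangentCoordSymm c ((extChartAt (𝓡 d) c).symm (η t))
        (fderivWithin ℝ η (Icc 0 1) t 1) := by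
    have := DFunLike.congr_fun h1 1
    rw [mfderivWithin_eq_fderivWithin] at this
    exact this
  rw [h2]
  exact hC' _ (hη t ht) _

end Distance

/-! ### The projections of a continuous splitting -/

section Splitting

variable {d : ℕ} {M : Type*} [TopologicalSpace M] [ChartedSpace (EuclideanSpace ℝ (Fin d)) M]
  [IsManifold (𝓡 d) ∞ M]

open scoped Classical in
/-- The projection onto `F y` along `G y`, in the coordinates of the chart at `c`. -/
def splittingProj (F G : ∀ x : M, Submodule ℝ (TangentSpace (𝓡 d) x)) (c y : M) :
    𝔼[d] →ₗ[ℝ] 𝔼[d] :=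
  if h : IsCompl (F y) (G y) then
    (tangentCoord c y).toLinearMap ∘ₗ (F y).subtype ∘ₗ (F y).projectionOnto (G y) h ∘ₗ
      (tangentCoordSymm c y).toLinearMap
  else 0

variable {F G : ∀ x : M, Submodule ℝ (TangentSpace (𝓡 d) x)} {c y : M}

lemma splittingProj_apply (h : IsCompl (F y) (G y)) (v : 𝔼[d]) :
    splittingProj F G c y v = tangentCoord c y
      (((F y).projectionOnto (G y) h (tangentCoordSymm c y v) : F y) : TangentSpace (𝓡 d) y) := by
  rw [splittingProj, dif_pos h]; rfl

lemma splittingProj_of_mem (h : IsCompl (F y) (G y)) (hy : y ∈ (extChartAt (𝓡 d) c).source)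
    {v : TangentSpace (𝓡 d) y} (hv : v ∈ F y) :
    splittingProj F G c y (tangentCoord c y v) = tangentCoord c y v := by
  rw [splittingProj_apply h, tangentCoordSymm_tangentCoord hy]
  congr 1
  exact congrArg Subtype.val (Submodule.projectionOnto_apply_left h ⟨v, hv⟩)

lemma splittingProj_of_mem_right (h : IsCompl (F y) (G y))
    (hy : y ∈ (extChartAt (𝓡 d) c).source)
    {v : TangentSpace (𝓡 d) y} (hv : v ∈ G y) :
    splittingProj F G c y (tangentCoord c y v) = 0 := by
  rw [splittingProj_apply h, tangentCoordSymm_tangentCoord hy,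
    (Submodule.projectionOnto_apply_eq_zero_iff h).2 hv]
  simp

/-- A vector is in `F y` as soon as its coordinates are fixed by the projection. -/
lemma mem_of_splittingProj_eq (h : IsCompl (F y) (G y)) (hy : y ∈ (extChartAt (𝓡 d) c).source)
    {v : 𝔼[d]} (hv : splittingProj F G c y v = v) : tangentCoordSymm c y v ∈ F y := by
  rw [← hv, splittingProj_apply h, tangentCoordSymm_tangentCoord hy]
  exact Subtype.mem _

/-- The coordinates of a continuous vector field along `Λ` are continuous. -/
lemma continuousOn_tangentCoord {S : Set M} {s : ∀ y : M, TangentSpace (𝓡 d) y}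
    (hs : ContinuousOn (fun y ↦ (⟨y, s y⟩ : TangentBundle (𝓡 d) M)) S) (c : M) :
    ContinuousOn (fun y ↦ tangentCoord c y (s y)) (S ∩ (extChartAt (𝓡 d) c).source) := by
  set e := trivializationAt 𝔼[d] (fun x : M ↦ TangentSpace (𝓡 d) x) c with he
  have hsource : ∀ y ∈ (extChartAt (𝓡 d) c).source, y ∈ e.baseSet := by
    intro y hy
    rwa [extChartAt_source] at hy
  have h1 : ContinuousOn (fun y ↦ (e ⟨y, s y⟩).2) (S ∩ (extChartAt (𝓡 d) c).source) := by
    refine continuous_snd.comp_continuousOn (e.continuousOn.comp (hs.mono inter_subset_left) ?_)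
    intro y hy
    rw [e.mem_source]
    exact hsource y hy.2
  refine h1.congr fun y hy ↦ ?_
  change e.continuousLinearMapAt ℝ y (s y) = _
  rw [Trivialization.continuousLinearMapAt_apply,
    Trivialization.coe_linearMapAt_of_mem e (hsource y hy.2)]

/-- The projection of a continuous splitting is continuous: in terms of continuous frames of the
two bundles it is `Θ ∘ D ∘ Θ⁻¹` with a constant `D`. -/
lemma continuousWithinAt_splittingProj {Λ : Set M} (hF : IsContinuousSubbundleOn Λ F)
    (hG : IsContinuousSubbundleOn Λ G) (hFG : ∀ x ∈ Λ, IsCompl (F x) (G x)) {c x : M} (hx : x ∈ Λ)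
    (hxc : x ∈ (extChartAt (𝓡 d) c).source) :
    ContinuousWithinAt (fun y ↦ (splittingProj F G c y).toContinuousLinearMap) Λ x := by
  obtain ⟨O₁, hO₁, hx₁, k, s, hs, hs'⟩ := hF x hx
  obtain ⟨O₂, hO₂, hx₂, l, t, ht, ht'⟩ := hG x hx
  set S := Λ ∩ (O₁ ∩ O₂ ∩ (extChartAt (𝓡 d) c).source) with hS
  have hSnhds : S ∈ 𝓝[Λ] x := by
    refine inter_mem_nhdsWithin _ ((hO₁.inter hO₂).inter (isOpen_extChartAt_source c) |>.mem_nhds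
      ⟨⟨hx₁, hx₂⟩, hxc⟩)
  let b : M → Fin k ⊕ Fin l → 𝔼[d] := fun y ↦
    Sum.elim (fun i ↦ tangentCoord c y (s i y)) (fun j ↦ tangentCoord c y (t j y))
  let Θ : M → ((Fin k ⊕ Fin l → ℝ) →L[ℝ] 𝔼[d]) := fun y ↦
    ∑ i, (ContinuousLinearMap.proj (R := ℝ) (φ := fun _ : Fin k ⊕ Fin l ↦ ℝ) i).smulRight (b y i)
  let D : (Fin k ⊕ Fin l → ℝ) →L[ℝ] (Fin k ⊕ Fin l → ℝ) := ContinuousLinearMap.pi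
    (Sum.elim (fun i ↦ ContinuousLinearMap.proj (Sum.inl i)) (fun _ ↦ 0))
  have hbcont : ∀ i, ContinuousOn (fun y ↦ b y i) S := by
    rintro (i | j)
    · refine (continuousOn_tangentCoord (hs i) c).mono ?_
      exact fun y hy ↦ ⟨⟨hy.1, hy.2.1.1⟩, hy.2.2⟩
    · refine (continuousOn_tangentCoord (ht j) c).mono ?_
      exact fun y hy ↦ ⟨⟨hy.1, hy.2.1.2⟩, hy.2.2⟩
  have hΘcont : ContinuousOn Θ S := by
    refine continuousOn_finsetSum _ fun i _ ↦ ?_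
    exact (ContinuousLinearMap.smulRightL ℝ (Fin k ⊕ Fin l → ℝ) 𝔼[d]
      (ContinuousLinearMap.proj i)).continuous.comp_continuousOn (hbcont i)
  have hΘ : ∀ y a, Θ y a = tangentCoord c y (∑ i, a (Sum.inl i) • s i y) +
      tangentCoord c y (∑ j, a (Sum.inr j) • t j y) := by
    intro y a
    simp [Θ, b, Fintype.sum_sum_type]
  have hbij : ∀ y ∈ S, Function.Bijective (Θ y) := by
    intro y hy
    obtain ⟨hli, hsp⟩ := hs' y ⟨hy.1, hy.2.1.1⟩
    obtain ⟨hli', hsp'⟩ := ht' y ⟨hy.1, hy.2.1.2⟩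
    have hcompl := hFG y hy.1
    have hmemF : ∀ a : Fin k → ℝ, ∑ i, a i • s i y ∈ F y := fun a ↦ by
      rw [← hsp, Submodule.mem_span_range_iff_exists_fun]; exact ⟨a, rfl⟩
    have hmemG : ∀ a : Fin l → ℝ, ∑ j, a j • t j y ∈ G y := fun a ↦ by
      rw [← hsp', Submodule.mem_span_range_iff_exists_fun]; exact ⟨a, rfl⟩
    constructor
    · rw [injective_iff_map_eq_zero]
      intro a ha
      rw [hΘ, ← map_add] at ha
      have h0 : (∑ i, a (Sum.inl i) • s i y) + ∑ j, a (Sum.inr j) • t j y = 0 := by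
        rw [← tangentCoordSymm_tangentCoord hy.2.2
          ((∑ i, a (Sum.inl i) • s i y) + ∑ j, a (Sum.inr j) • t j y), ha, map_zero]
      have h1 : ∑ i, a (Sum.inl i) • s i y = 0 := by
        refine Submodule.disjoint_def.1 hcompl.disjoint _ (hmemF fun i ↦ a (Sum.inl i)) ?_
        rw [eq_neg_of_add_eq_zero_left h0]
        exact neg_mem (hmemG fun j ↦ a (Sum.inr j))
      rw [h1, zero_add] at h0
      have h2 := Fintype.linearIndependent_iff.1 hli (fun i ↦ a (Sum.inl i)) h1
      have h3 := Fintype.linearIndependent_iff.1 hli' (fun j ↦ a (Sum.inr j)) h0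
      ext (i | j)
      · exact h2 i
      · exact h3 j
    · intro v
      have hv : tangentCoordSymm c y v ∈ F y ⊔ G y := by
        rw [hcompl.sup_eq_top]; trivial
      obtain ⟨u, hu, w, hw, huw⟩ := Submodule.mem_sup.1 hv
      rw [← hsp, Submodule.mem_span_range_iff_exists_fun] at hu
      rw [← hsp', Submodule.mem_span_range_iff_exists_fun] at hw
      obtain ⟨a, rfl⟩ := hu
      obtain ⟨a', rfl⟩ := hw
      refine ⟨Sum.elim a a', ?_⟩
      rw [hΘ, ← map_add]
      simp only [Sum.elim_inl, Sum.elim_inr]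
      rw [huw, tangentCoord_tangentCoordSymm hy.2.2]
  have hxS : x ∈ S := ⟨hx, ⟨hx₁, hx₂⟩, hxc⟩
  have heq : ∀ y ∈ S, (splittingProj F G c y).toContinuousLinearMap =
      Θ y ∘L D ∘L (Θ y).inverse := by
    intro y hy
    let e := (LinearEquiv.ofBijective (Θ y).toLinearMap (hbij y hy)).toContinuousLinearEquiv
    have he : Θ y = (e : (Fin k ⊕ Fin l → ℝ) →L[ℝ] 𝔼[d]) := by ext1 a; rfl
    ext1 v
    obtain ⟨a, rfl⟩ := (hbij y hy).2 v
    have h1 : (Θ y).inverse (Θ y a) = a := by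
      rw [he, ContinuousLinearMap.inverse_equiv]
      exact e.symm_apply_apply a
    simp only [ContinuousLinearMap.comp_apply]
    rw [h1]
    change splittingProj F G c y (Θ y a) = Θ y (D a)
    obtain ⟨hli, hsp⟩ := hs' y ⟨hy.1, hy.2.1.1⟩
    obtain ⟨hli', hsp'⟩ := ht' y ⟨hy.1, hy.2.1.2⟩
    rw [hΘ, hΘ, map_add, splittingProj_of_mem (hFG y hy.1) hy.2.2,
      splittingProj_of_mem_right (hFG y hy.1) hy.2.2]
    · simp [D]
    · rw [← hsp', Submodule.mem_span_range_iff_exists_fun]; exact ⟨_, rfl⟩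
    · rw [← hsp, Submodule.mem_span_range_iff_exists_fun]; exact ⟨_, rfl⟩
  have hcont : ContinuousWithinAt (fun y ↦ Θ y ∘L D ∘L (Θ y).inverse) S x := by
    have h1 := hΘcont x hxS
    let e := (LinearEquiv.ofBijective (Θ x).toLinearMap (hbij x hxS)).toContinuousLinearEquiv
    have he : Θ x = (e : (Fin k ⊕ Fin l → ℝ) →L[ℝ] 𝔼[d]) := by ext1 a; rfl
    have h2 : ContinuousAt ContinuousLinearMap.inverse (Θ x) := by
      rw [he]
      exact (contDiffAt_map_inverse (n := 0) e).continuousAt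
    exact h1.clm_comp (continuousWithinAt_const.clm_comp (h2.comp_continuousWithinAt h1))
  refine (hcont.mono_of_mem_nhdsWithin hSnhds).congr_of_eventuallyEq ?_ (heq x hxS)
  filter_upwards [hSnhds] with y hy using heq y hy

/-- The dimension of a continuous subbundle is locally constant. -/
lemma eventually_finrank_eq {Λ : Set M} (hF : IsContinuousSubbundleOn Λ F) {x : M} (hx : x ∈ Λ) :
    ∀ᶠ y in 𝓝[Λ] x, Module.finrank ℝ (F y) = Module.finrank ℝ (F x) := by
  obtain ⟨O, hO, hxO, k, s, -, hs'⟩ := hF x hx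
  have h : ∀ y ∈ Λ ∩ O, Module.finrank ℝ (F y) = k := by
    intro y hy
    obtain ⟨hli, hsp⟩ := hs' y hy
    rw [← hsp, finrank_span_eq_card hli, Fintype.card_fin]
  filter_upwards [inter_mem_nhdsWithin Λ (hO.mem_nhds hxO)] with y hy
  rw [h y hy, h x ⟨hx, hxO⟩]

end Splitting

/-! ### Uniform choices over compact and finite sets -/

lemma IsCompact.exists_pos_forall {X : Type*} [TopologicalSpace X] {S : Set X} (hS : IsCompact S)
    {P : ℝ → X → Prop} (hmono : ∀ a b x, 0 < a → a ≤ b → P b x → P a x)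
    (hloc : ∀ x ∈ S, ∃ a > 0, ∀ᶠ y in 𝓝[S] x, P a y) : ∃ a > 0, ∀ x ∈ S, P a x := by
  refine hS.induction_on (p := fun T ↦ ∃ a > 0, ∀ x ∈ T, P a x) ⟨1, one_pos, by simp⟩ ?_ ?_ ?_
  · rintro s t hst ⟨a, ha, h⟩
    exact ⟨a, ha, fun x hx ↦ h x (hst hx)⟩
  · rintro s t ⟨a, ha, h⟩ ⟨b, hb, h'⟩
    refine ⟨min a b, lt_min ha hb, ?_⟩
    rintro x (hx | hx)
    · exact hmono _ _ x (lt_min ha hb) (min_le_left _ _) (h x hx)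
    · exact hmono _ _ x (lt_min ha hb) (min_le_right _ _) (h' x hx)
  · intro x hx
    obtain ⟨a, ha, h⟩ := hloc x hx
    exact ⟨{y | P a y}, h, a, ha, fun y hy ↦ hy⟩

lemma Set.Finite.exists_pos_forall {X : Type*} {S : Set X} (hS : S.Finite)
    {P : ℝ → X → Prop} (hmono : ∀ a b x, 0 < a → a ≤ b → P b x → P a x)
    (hloc : ∀ x ∈ S, ∃ a > 0, P a x) : ∃ a > 0, ∀ x ∈ S, P a x := by
  let _ : TopologicalSpace X := ⊥
  have : DiscreteTopology X := ⟨rfl⟩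
  refine hS.isCompact.exists_pos_forall hmono fun x hx ↦ ?_
  obtain ⟨a, ha, h⟩ := hloc x hx
  exact ⟨a, ha, nhdsWithin_le_nhds (by simpa [nhds_discrete] using h)⟩

/-! ### Rates of domination and of expansion -/

section Rates

variable {d : ℕ} {M : Type*} [TopologicalSpace M] [ChartedSpace (EuclideanSpace ℝ (Fin d)) M]
  [IsManifold (𝓡 d) ∞ M]

omit [IsManifold (𝓡 d) ∞ M] in
/-- The derivative of `f.symm` at `f x` inverts that of `f` at `x`. The norms of the tangent
spaces at the equal points `f.symm (f x)` and `x` are identified. -/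
lemma seminorm_mfderiv_symm_mfderiv (f : M ≃ₘ^1⟮𝓡 d, 𝓡 d⟯ M)
    (N : ∀ x : M, Seminorm ℝ (TangentSpace (𝓡 d) x)) (x : M) (v : TangentSpace (𝓡 d) x) :
    N (f.symm (f x)) (mfderiv (𝓡 d) (𝓡 d) f.symm (f x) (mfderiv (𝓡 d) (𝓡 d) f x v)) = N x v := by
  have h1 : HasMFDerivAt (𝓡 d) (𝓡 d) f x (mfderiv (𝓡 d) (𝓡 d) f x) :=
    (f.contMDiff.mdifferentiable one_ne_zero x).hasMFDerivAt
  have h2 : HasMFDerivAt (𝓡 d) (𝓡 d) f.symm (f x) (mfderiv (𝓡 d) (𝓡 d) f.symm (f x)) :=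
    (f.symm.contMDiff.mdifferentiable one_ne_zero (f x)).hasMFDerivAt
  have h3 := HasMFDerivAt.comp x h2 h1
  have h4 : HasMFDerivAt (𝓡 d) (𝓡 d) (f.symm ∘ f) x
      (ContinuousLinearMap.id ℝ (TangentSpace (𝓡 d) x)) :=
    (hasMFDerivAt_id x).congr_of_eventuallyEq (Eventually.of_forall fun y ↦ by simp)
  have h5 := hasMFDerivAt_unique h3 h4
  have h6 : mfderiv (𝓡 d) (𝓡 d) f.symm (f x) (mfderiv (𝓡 d) (𝓡 d) f x v) = v :=
    DFunLike.congr_fun h5 v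
  have h7 : ∀ z : M, z = x → N z (v : EuclideanSpace ℝ (Fin d)) = N x v := by
    rintro z rfl; rfl
  exact (congrArg (N (f.symm (f x))) h6).trans (h7 _ (by simp))

omit [IsManifold (𝓡 d) ∞ M] in
lemma normDerivOn_nonneg [RiemannianBundle (fun x : M ↦ TangentSpace (𝓡 d) x)] (f : M → M)
    (F : ∀ x : M, Submodule ℝ (TangentSpace (𝓡 d) x)) (x : M) : 0 ≤ normDerivOn f F x := by
  unfold normDerivOn
  exact ContinuousLinearMap.opNorm_nonneg _

omit [IsManifold (𝓡 d) ∞ M] in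
lemma norm_mfderiv_le_normDerivOn [RiemannianBundle (fun x : M ↦ TangentSpace (𝓡 d) x)] (f : M → M)
    (F : ∀ x : M, Submodule ℝ (TangentSpace (𝓡 d) x)) {x : M} {v : TangentSpace (𝓡 d) x}
    (hv : v ∈ F x) : ‖mfderiv (𝓡 d) (𝓡 d) f x v‖ ≤ normDerivOn f F x * ‖v‖ :=
  ((mfderiv (𝓡 d) (𝓡 d) f x).comp (F x).subtypeL).le_opNorm ⟨v, hv⟩

variable {f : M ≃ₘ^1⟮𝓡 d, 𝓡 d⟯ M} {Λ : Set M}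
  {Ecs Ecu : ∀ x : M, Submodule ℝ (TangentSpace (𝓡 d) x)}

omit [IsManifold (𝓡 d) ∞ M] in
lemma norm_le_normDerivOn_symm [RiemannianBundle (fun x : M ↦ TangentSpace (𝓡 d) x)] {x : M}
    {v : TangentSpace (𝓡 d) x}
    (hv : mfderiv (𝓡 d) (𝓡 d) f x v ∈ Ecu (f x)) :
    ‖v‖ ≤ normDerivOn f.symm Ecu (f x) * ‖mfderiv (𝓡 d) (𝓡 d) f x v‖ := by
  have h := seminorm_mfderiv_symm_mfderiv f
    (fun x ↦ normSeminorm ℝ (TangentSpace (𝓡 d) x)) x v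
  change ‖mfderiv (𝓡 d) (𝓡 d) f.symm (f x) (mfderiv (𝓡 d) (𝓡 d) f x v)‖ = ‖v‖ at h
  rw [← h]
  exact norm_mfderiv_le_normDerivOn f.symm Ecu hv

/-- The dominated splitting, expressed by means of the norms of the metric for which it is
dominated, without reference to that metric. -/
lemma IsDominatedSplitting.exists_seminorms (hΛ : IsDominatedSplitting f Λ Ecs Ecu) :
    ∃ (N : ∀ x : M, Seminorm ℝ (TangentSpace (𝓡 d) x)) (lam : ℝ) (μ : M → ℝ),
      IsLocallyEquivalent N ∧ 0 < lam ∧ lam < 1 ∧ (∀ x, 0 ≤ μ x) ∧ ∀ x ∈ Λ,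
        (∀ v ∈ Ecs x, N (f x) (mfderiv (𝓡 d) (𝓡 d) f x v) ≤ μ x * N x v) ∧
        (∀ v ∈ Ecu x, μ x * N x v ≤ lam * N (f x) (mfderiv (𝓡 d) (𝓡 d) f x v)) := by
  obtain ⟨g, lam, h0, h1, hdom⟩ := hΛ.dominated
  let R : RiemannianBundle (fun x : M ↦ TangentSpace (𝓡 d) x) := ⟨g.toRiemannianMetric⟩
  have hR : IsContMDiffRiemannianBundle (𝓡 d) ∞ 𝔼[d] (fun x : M ↦ TangentSpace (𝓡 d) x) :=
    inferInstance
  have := isContinuousRiemannianBundle_of_isContMDiff R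
  refine ⟨fun x ↦ normSeminorm ℝ (TangentSpace (𝓡 d) x), lam, normDerivOn f Ecs,
    isLocallyEquivalent_norm, h0, h1, normDerivOn_nonneg f Ecs, fun x hx ↦ ⟨fun v hv ↦
      norm_mfderiv_le_normDerivOn f Ecs hv, fun v hv ↦ ?_⟩⟩
  have hmem : mfderiv (𝓡 d) (𝓡 d) f x v ∈ Ecu (f x) := by
    rw [← hΛ.invariant_cu x hx]; exact ⟨v, hv, rfl⟩
  have h2 := norm_le_normDerivOn_symm hmem
  change normDerivOn f Ecs x * ‖v‖ ≤ lam * ‖mfderiv (𝓡 d) (𝓡 d) f x v‖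
  calc normDerivOn f Ecs x * ‖v‖
      ≤ normDerivOn f Ecs x *
        (normDerivOn f.symm Ecu (f x) * ‖mfderiv (𝓡 d) (𝓡 d) f x v‖) :=
        mul_le_mul_of_nonneg_left h2 (normDerivOn_nonneg f Ecs x)
    _ = normDerivOn f Ecs x * normDerivOn f.symm Ecu (f x) *
        ‖mfderiv (𝓡 d) (𝓡 d) f x v‖ := by ring
    _ ≤ _ := mul_le_mul_of_nonneg_right (hdom x hx) (norm_nonneg _)

end Rates

/-! ### A finite system of charts with uniform estimates -/

section ChartSystem

variable {d : ℕ} {M : Type*} [EMetricSpace M] [ChartedSpace (EuclideanSpace ℝ (Fin d)) M]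
  [IsManifold (𝓡 d) ∞ M] [RiemannianBundle (fun x : M ↦ TangentSpace (𝓡 d) x)]

/-- Finitely many charts, centred at the points of `Z`, with compact subsets `dom c` of `Λ` covering
`Λ`, such that everything is uniform on the coordinate balls of radius `r` around the points of
`dom c`. -/
structure IsChartSystem (f : M ≃ₘ^1⟮𝓡 d, 𝓡 d⟯ M) (Λ : Set M)
    (Ecs Ecu : ∀ x : M, Submodule ℝ (TangentSpace (𝓡 d) x))
    (N : ∀ x : M, Seminorm ℝ (TangentSpace (𝓡 d) x)) (α : ℝ)
    (Z : Set M) (dom : M → Set M) (r K : ℝ) : Prop where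
  r_pos : 0 < r
  one_le_K : 1 ≤ K
  finite : Z.Finite
  exists_center : ∀ x ∈ Λ, ∃ c ∈ Z, dom c ∈ 𝓝[Λ] x
  isCompact : ∀ c ∈ Z, IsCompact (dom c)
  subset : ∀ c ∈ Z, dom c ⊆ Λ
  subset_source : ∀ c ∈ Z, dom c ⊆ (extChartAt (𝓡 d) c).source
  ball_subset : ∀ c ∈ Z, ∀ x ∈ dom c,
    Metric.ball (extChartAt (𝓡 d) c x) r ⊆ (extChartAt (𝓡 d) c).target
  edist_le : ∀ c ∈ Z, ∀ x ∈ dom c, ∀ p ∈ Metric.ball (extChartAt (𝓡 d) c x) r,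
    ∀ q ∈ Metric.ball (extChartAt (𝓡 d) c x) r,
    edist ((extChartAt (𝓡 d) c).symm p) ((extChartAt (𝓡 d) c).symm q) ≤
      ENNReal.ofReal (K * ‖p - q‖)
  norm_le : ∀ c ∈ Z, ∀ x ∈ dom c, ∀ v : TangentSpace (𝓡 d) x,
    ‖tangentCoord c x v‖ ≤ K * ‖v‖ ∧ ‖v‖ ≤ K * ‖tangentCoord c x v‖
  seminorm_le : ∀ c ∈ Z, ∀ x ∈ dom c, ∀ z ∈ Metric.ball (extChartAt (𝓡 d) c x) r,
    ∀ v : TangentSpace (𝓡 d) ((extChartAt (𝓡 d) c).symm z),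
    ‖tangentCoord c ((extChartAt (𝓡 d) c).symm z) v‖ ≤ K * N _ v ∧
      N _ v ≤ K * ‖tangentCoord c ((extChartAt (𝓡 d) c).symm z) v‖
  proj_le : ∀ c ∈ Z, ∀ x ∈ dom c, ∀ v, ‖splittingProj Ecu Ecs c x v‖ ≤ K * ‖v‖
  holder : ∀ c ∈ Z, ∀ c' ∈ Z, ∀ x ∈ dom c, f x ∈ dom c' →
    IsHolderC1On α K r (inCharts f c c') (extChartAt (𝓡 d) c x)
  maps : ∀ c ∈ Z, ∀ c' ∈ Z, ∀ x ∈ dom c, f x ∈ dom c' →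
    ∀ z ∈ Metric.ball (extChartAt (𝓡 d) c x) r,
      f ((extChartAt (𝓡 d) c).symm z) ∈ (extChartAt (𝓡 d) c').source
  rate_le : ∀ x ∈ Λ, normDerivOn f.symm Ecu (f x) ≤ K
  close : ∀ δ > 0, ∃ η > 0, ∀ c ∈ Z, ∀ x ∈ dom c, ∀ y, edist y x < ENNReal.ofReal η →
    y ∈ (extChartAt (𝓡 d) c).source ∧ ‖extChartAt (𝓡 d) c y - extChartAt (𝓡 d) c x‖ < δ

variable {f : M ≃ₘ^1⟮𝓡 d, 𝓡 d⟯ M} {Λ : Set M}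
  {Ecs Ecu : ∀ x : M, Submodule ℝ (TangentSpace (𝓡 d) x)}
  {N : ∀ x : M, Seminorm ℝ (TangentSpace (𝓡 d) x)}

omit [IsManifold (𝓡 d) ∞ M] [RiemannianBundle (fun x : M ↦ TangentSpace (𝓡 d) x)] in
/-- Points which are close to a compact subset of the domain of a chart have close coordinates. -/
lemma exists_uniform_close {c : M} {S : Set M} (hS : IsCompact S)
    (hSc : S ⊆ (extChartAt (𝓡 d) c).source) {δ : ℝ} (hδ : 0 < δ) :
    ∃ η > 0, ∀ x ∈ S, ∀ y, edist y x < ENNReal.ofReal η →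
      y ∈ (extChartAt (𝓡 d) c).source ∧ ‖extChartAt (𝓡 d) c y - extChartAt (𝓡 d) c x‖ < δ := by
  refine hS.exists_pos_forall (P := fun η x ↦ ∀ y, edist y x < ENNReal.ofReal η →
      y ∈ (extChartAt (𝓡 d) c).source ∧ ‖extChartAt (𝓡 d) c y - extChartAt (𝓡 d) c x‖ < δ)
    (fun a b x _ hab h y hy ↦ h y (hy.trans_le (ENNReal.ofReal_le_ofReal hab))) fun x hx ↦ ?_
  have h1 : ∀ᶠ y in 𝓝 x, y ∈ (extChartAt (𝓡 d) c).source ∧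
      dist (extChartAt (𝓡 d) c y) (extChartAt (𝓡 d) c x) < δ / 2 :=
    Filter.Eventually.and (extChartAt_source_mem_nhds' (I := 𝓡 d) (hSc hx))
      ((continuousAt_extChartAt' (hSc hx)).eventually (Metric.ball_mem_nhds _ (half_pos hδ)))
  obtain ⟨e, he, h⟩ := EMetric.mem_nhds_iff.1 h1
  obtain ⟨η, hη, hηe⟩ : ∃ η : ℝ, 0 < η ∧ ENNReal.ofReal η + ENNReal.ofReal η ≤ e := by
    obtain ⟨t, ht0, ht⟩ := ENNReal.lt_iff_exists_nnreal_btwn.1 he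
    have ht0' : (0 : ℝ) < t := by exact_mod_cast ht0
    refine ⟨t / 2, by positivity, ?_⟩
    rw [← ENNReal.ofReal_add (by positivity) (by positivity), add_halves, ENNReal.ofReal_coe_nnreal]
    exact ht.le
  have hη' : 0 < ENNReal.ofReal η := ENNReal.ofReal_pos.2 hη
  refine ⟨η, hη, nhdsWithin_le_nhds ?_⟩
  filter_upwards [Metric.eball_mem_nhds x hη'] with x' hx' y hy
  have hx'' : x' ∈ Metric.eball x e :=
    Metric.eball_subset_eball (le_self_add.trans hηe) hx'
  have hy' : y ∈ Metric.eball x e := by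
    refine (edist_triangle y x' x).trans_lt ((ENNReal.add_lt_add hy hx').trans_le hηe)
  refine ⟨(h hy').1, ?_⟩
  rw [← dist_eq_norm]
  have := (h hy').2
  have := (h hx'').2
  have := dist_triangle_right (extChartAt (𝓡 d) c y) (extChartAt (𝓡 d) c x')
    (extChartAt (𝓡 d) c x)
  linarith

/-- The uniform estimates near the centre of one chart. -/
lemma exists_chart_radius [IsContMDiffRiemannianBundle (𝓡 d) ∞ 𝔼[d]
      (fun x : M ↦ TangentSpace (𝓡 d) x)] [IsRiemannianManifold (𝓡 d) M]
    (hΛ : IsDominatedSplitting f Λ Ecs Ecu) (hN : IsLocallyEquivalent N) {c : M} (hc : c ∈ Λ) :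
    ∃ ρ > 0, ∃ K : ℝ, Metric.ball (extChartAt (𝓡 d) c c) ρ ⊆ (extChartAt (𝓡 d) c).target ∧
      (∀ p ∈ Metric.ball (extChartAt (𝓡 d) c c) ρ, ∀ q ∈ Metric.ball (extChartAt (𝓡 d) c c) ρ,
        edist ((extChartAt (𝓡 d) c).symm p) ((extChartAt (𝓡 d) c).symm q) ≤
          ENNReal.ofReal (K * ‖p - q‖)) ∧
      ∀ y, y ∈ (extChartAt (𝓡 d) c).symm '' Metric.ball (extChartAt (𝓡 d) c c) ρ →
        (∀ v : TangentSpace (𝓡 d) y, ‖tangentCoord c y v‖ ≤ K * ‖v‖ ∧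
          ‖v‖ ≤ K * ‖tangentCoord c y v‖) ∧
        (∀ v : TangentSpace (𝓡 d) y, ‖tangentCoord c y v‖ ≤ K * N y v ∧
          N y v ≤ K * ‖tangentCoord c y v‖) ∧
        (y ∈ Λ → ∀ v, ‖splittingProj Ecu Ecs c y v‖ ≤ K * ‖v‖) := by
  have := isContinuousRiemannianBundle_of_isContMDiff (d := d) (M := M) inferInstance
  obtain ⟨C₁, ρ₁, hρ₁, htar, hC₁⟩ := exists_edist_extChartAt_symm_le (d := d) c
  obtain ⟨C₂, hC₂⟩ := isLocallyEquivalent_norm (d := d) (M := M) c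
  obtain ⟨C₃, hC₃⟩ := hN c
  have hP := (continuousWithinAt_splittingProj hΛ.continuous_cu hΛ.continuous_cs
    (fun x hx ↦ (hΛ.isCompl x hx).symm) hc (mem_extChartAt_source (I := 𝓡 d) c)).norm
  set C₄ := ‖(splittingProj Ecu Ecs c c).toContinuousLinearMap‖ + 1 with hC₄def
  have hC₄ : ∀ᶠ y in 𝓝 c, y ∈ Λ → ‖(splittingProj Ecu Ecs c y).toContinuousLinearMap‖ ≤ C₄ := by
    rw [← eventually_nhdsWithin_iff]
    exact hP.eventually_le_const (lt_add_one _)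
  have hev := (tendsto_extChartAt_symm (mem_extChartAt_source (I := 𝓡 d) c)).eventually
    (hC₂.and (hC₃.and hC₄))
  obtain ⟨ρ₂, hρ₂, hball⟩ := Metric.eventually_nhds_iff_ball.1 hev
  set K := max (max (C₁ : ℝ) C₂) (max C₃ C₄) with hK
  have hK1 : C₁ ≤ K := (le_max_left _ _).trans (le_max_left _ _)
  have hK2 : C₂ ≤ K := (le_max_right _ _).trans (le_max_left _ _)
  have hK3 : C₃ ≤ K := (le_max_left _ _).trans (le_max_right _ _)
  have hK4 : C₄ ≤ K := (le_max_right _ _).trans (le_max_right _ _)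
  have hsub1 := Metric.ball_subset_ball (x := extChartAt (𝓡 d) c c) (min_le_left ρ₁ ρ₂)
  have hsub2 := Metric.ball_subset_ball (x := extChartAt (𝓡 d) c c) (min_le_right ρ₁ ρ₂)
  refine ⟨min ρ₁ ρ₂, lt_min hρ₁ hρ₂, K, hsub1.trans htar, fun p hp q hq ↦ ?_, ?_⟩
  · refine (hC₁ p (hsub1 hp) q (hsub1 hq)).trans ?_
    rw [edist_dist, dist_eq_norm, ← ENNReal.ofReal_coe_nnreal,
      ← ENNReal.ofReal_mul (NNReal.coe_nonneg _)]
    exact ENNReal.ofReal_le_ofReal (by gcongr)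
  · rintro _ ⟨z, hz, rfl⟩
    obtain ⟨h2, h3, h4⟩ := hball z (hsub2 hz)
    refine ⟨fun v ↦ ⟨(h2 v).1.trans ?_, (h2 v).2.trans ?_⟩,
      fun v ↦ ⟨(h3 v).1.trans ?_, (h3 v).2.trans ?_⟩, fun hy v ↦ ?_⟩
    · exact mul_le_mul_of_nonneg_right hK2 (apply_nonneg _ _)
    · exact mul_le_mul_of_nonneg_right hK2 (norm_nonneg _)
    · exact mul_le_mul_of_nonneg_right hK3 (apply_nonneg _ _)
    · exact mul_le_mul_of_nonneg_right hK3 (norm_nonneg _)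
    · refine ((splittingProj Ecu Ecs c _).toContinuousLinearMap.le_opNorm v).trans ?_
      exact mul_le_mul_of_nonneg_right ((h4 hy).trans hK4) (norm_nonneg _)

/-- The rates of expansion are bounded near every point. -/
lemma exists_rate_le [IsContinuousRiemannianBundle 𝔼[d] (fun x : M ↦ TangentSpace (𝓡 d) x)]
    {α : ℝ≥0} (hα₀ : 0 < α) (hα₁ : α ≤ 1)
    (hf : HasLocallyHolderDerivative (d := d) α f) (x : M) :
    ∃ a > 0, ∀ᶠ y in 𝓝 x, ∀ v : TangentSpace (𝓡 d) y,
      ‖v‖ ≤ a * ‖mfderiv (𝓡 d) (𝓡 d) f y v‖ := by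
  obtain ⟨C₁, hC₁⟩ := isLocallyEquivalent_norm (d := d) (M := M) x
  obtain ⟨C₂, hC₂⟩ := isLocallyEquivalent_norm (d := d) (M := M) (f x)
  have hα0 : (0 : ℝ) < α := by exact_mod_cast hα₀
  have hmd : ∀ y, MDifferentiableAt (𝓡 d) (𝓡 d) f y :=
    f.contMDiff.mdifferentiable one_ne_zero
  obtain ⟨C, r, hr, hh⟩ := isHolderC1At_inCharts hα₀ hα₁ hf f.contMDiff
    (mem_extChartAt_source (I := 𝓡 d) x) (mem_extChartAt_source (I := 𝓡 d) (f x))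
  set L : 𝔼[d] → 𝔼[d] →L[ℝ] 𝔼[d] := fderiv ℝ (inCharts f x (f x)) with hL
  have hLcont : ContinuousAt L (extChartAt (𝓡 d) x x) := by
    rw [ContinuousAt, tendsto_iff_norm_sub_tendsto_zero]
    have h : Continuous fun w' : 𝔼[d] ↦ C * ‖w' - extChartAt (𝓡 d) x x‖ ^ (α : ℝ) :=
      continuous_const.mul ((continuous_id.sub continuous_const).norm.rpow_const
        fun _ ↦ Or.inr hα0.le)
    have h0 := h.tendsto (extChartAt (𝓡 d) x x)
    simp only [sub_self, norm_zero, Real.zero_rpow hα0.ne', mul_zero] at h0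
    refine squeeze_zero' (Eventually.of_forall fun _ ↦ norm_nonneg _) ?_ h0
    filter_upwards [Metric.ball_mem_nhds _ hr] with z hz
    exact hh.2.2 z hz _ (Metric.mem_ball_self hr)
  have hinj : Function.Injective (L (extChartAt (𝓡 d) x x)) := by
    rw [injective_iff_map_eq_zero]
    intro ξ hξ
    have h1 := fderiv_inCharts_tangentCoord (f := f) (mem_extChartAt_source (I := 𝓡 d) x)
      (mem_extChartAt_source (I := 𝓡 d) (f x)) (hmd x) (tangentCoordSymm x x ξ)
    rw [tangentCoord_tangentCoordSymm (mem_extChartAt_source (I := 𝓡 d) x)] at h1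
    have h2 : mfderiv (𝓡 d) (𝓡 d) f x (tangentCoordSymm x x ξ) = 0 := by
      rw [← tangentCoordSymm_tangentCoord (mem_extChartAt_source (I := 𝓡 d) (f x))
        (mfderiv (𝓡 d) (𝓡 d) f x (tangentCoordSymm x x ξ)), ← h1]
      exact (congrArg _ hξ).trans (map_zero _)
    have h3 := seminorm_mfderiv_symm_mfderiv f (fun x ↦ normSeminorm ℝ (TangentSpace (𝓡 d) x)) x
      (tangentCoordSymm x x ξ)
    rw [h2, map_zero, map_zero] at h3
    have h4 : tangentCoordSymm x x ξ = 0 := norm_eq_zero.1 h3.symm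
    rw [← tangentCoord_tangentCoordSymm (mem_extChartAt_source (I := 𝓡 d) x) ξ, h4, map_zero]
  obtain ⟨a, ha, hanti⟩ := (L (extChartAt (𝓡 d) x x)).toLinearMap.exists_antilipschitzWith
    (LinearMap.ker_eq_bot.2 hinj)
  have ha' : (0 : ℝ) < a := by exact_mod_cast ha
  have hsmall := (tendsto_iff_norm_sub_tendsto_zero.1 hLcont).eventually_lt_const
    (show (0 : ℝ) < 1 / (2 * a) by positivity)
  have hlow : ∀ᶠ z in 𝓝 (extChartAt (𝓡 d) x x), ∀ ξ, ‖ξ‖ ≤ 2 * a * ‖L z ξ‖ := by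
    filter_upwards [hsmall] with z hz ξ
    have h1 : ‖ξ‖ ≤ a * ‖L (extChartAt (𝓡 d) x x) ξ‖ := by
      simpa using hanti.le_mul_dist ξ 0
    have h2 : ‖L (extChartAt (𝓡 d) x x) ξ‖ ≤ ‖L z ξ‖ + 1 / (2 * a) * ‖ξ‖ := by
      have e : L (extChartAt (𝓡 d) x x) ξ = L z ξ - (L z - L (extChartAt (𝓡 d) x x)) ξ := by simp
      rw [e]
      refine (norm_sub_le _ _).trans ?_
      gcongr
      exact (ContinuousLinearMap.le_opNorm _ _).trans (by gcongr)
    have h3 : ‖ξ‖ ≤ a * ‖L z ξ‖ + 1 / 2 * ‖ξ‖ := by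
      calc ‖ξ‖ ≤ a * (‖L z ξ‖ + 1 / (2 * a) * ‖ξ‖) := h1.trans (by gcongr)
        _ = _ := by field_simp
    linarith
  refine ⟨max C₁ 1 * (2 * a * max C₂ 1), by positivity, ?_⟩
  filter_upwards [hC₁, f.contMDiff.continuous.continuousAt.eventually hC₂,
    (continuousAt_extChartAt x).eventually hlow, extChartAt_source_mem_nhds (I := 𝓡 d) x,
    f.contMDiff.continuous.continuousAt.eventually (extChartAt_source_mem_nhds (I := 𝓡 d) (f x))]
    with y h1 h2 h3 h4 h5 v
  have h6 := h3 (tangentCoord x y v)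
  rw [hL, fderiv_inCharts_tangentCoord h4 h5 (hmd y)] at h6
  have h7 := (h2 (mfderiv (𝓡 d) (𝓡 d) f y v)).1
  have h8 := (h1 v).2
  change ‖_‖ ≤ C₂ * ‖mfderiv (𝓡 d) (𝓡 d) f y v‖ at h7
  change ‖v‖ ≤ C₁ * ‖tangentCoord x y v‖ at h8
  have h9 : ‖tangentCoord (f x) (f y) (mfderiv (𝓡 d) (𝓡 d) f y v)‖ ≤
      max C₂ 1 * ‖mfderiv (𝓡 d) (𝓡 d) f y v‖ :=
    h7.trans (mul_le_mul_of_nonneg_right (le_max_left _ _) (norm_nonneg _))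
  have h10 : ‖v‖ ≤ max C₁ 1 * ‖tangentCoord x y v‖ :=
    h8.trans (mul_le_mul_of_nonneg_right (le_max_left _ _) (norm_nonneg _))
  calc ‖v‖ ≤ max C₁ 1 * ‖tangentCoord x y v‖ := h10
    _ ≤ max C₁ 1 * (2 * a * (max C₂ 1 * ‖mfderiv (𝓡 d) (𝓡 d) f y v‖)) := by
        gcongr
        exact h6.trans (by gcongr)
    _ = _ := by ring

end ChartSystem

section ChartSystemExistence

variable {d : ℕ} {M : Type*} [EMetricSpace M] [ChartedSpace (EuclideanSpace ℝ (Fin d)) M]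
  [IsManifold (𝓡 d) ∞ M] [RiemannianBundle (fun x : M ↦ TangentSpace (𝓡 d) x)]

variable {f : M ≃ₘ^1⟮𝓡 d, 𝓡 d⟯ M} {Λ : Set M}
  {Ecs Ecu : ∀ x : M, Submodule ℝ (TangentSpace (𝓡 d) x)}
  {N : ∀ x : M, Seminorm ℝ (TangentSpace (𝓡 d) x)}

omit [RiemannianBundle (fun x : M ↦ TangentSpace (𝓡 d) x)] in
/-- Uniform Hölder bounds for `f`, read in two given charts, along a compact set. -/
lemma exists_uniform_holder {α : ℝ≥0} (hα₀ : 0 < α) (hα₁ : α ≤ 1)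
    (hf : HasLocallyHolderDerivative (d := d) α f) {c c' : M} {S : Set M} (hS : IsCompact S)
    (hSc : S ⊆ (extChartAt (𝓡 d) c).source)
    (hSc' : ∀ x ∈ S, f x ∈ (extChartAt (𝓡 d) c').source) :
    ∃ a > 0, ∀ x ∈ S, IsHolderC1On (α : ℝ) (1 / a) a (inCharts f c c') (extChartAt (𝓡 d) c x) ∧
      ∀ z ∈ Metric.ball (extChartAt (𝓡 d) c x) a,
        f ((extChartAt (𝓡 d) c).symm z) ∈ (extChartAt (𝓡 d) c').source := by
  refine hS.exists_pos_forall (P := fun a x ↦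
    IsHolderC1On (α : ℝ) (1 / a) a (inCharts f c c') (extChartAt (𝓡 d) c x) ∧
      ∀ z ∈ Metric.ball (extChartAt (𝓡 d) c x) a,
        f ((extChartAt (𝓡 d) c).symm z) ∈ (extChartAt (𝓡 d) c').source) ?_ fun x hx ↦ ?_
  · intro a b x ha hab h
    have hsub := Metric.ball_subset_ball (x := extChartAt (𝓡 d) c x) hab
    exact ⟨h.1.mono (one_div_le_one_div_of_le ha hab) hsub, fun z hz ↦ h.2 z (hsub hz)⟩
  · obtain ⟨C, r, hr, hh⟩ := isHolderC1At_inCharts hα₀ hα₁ hf f.contMDiff (hSc hx) (hSc' x hx)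
    have hcont : Tendsto (fun z ↦ f ((extChartAt (𝓡 d) c).symm z)) (𝓝 (extChartAt (𝓡 d) c x))
        (𝓝 (f x)) := f.contMDiff.continuous.continuousAt.tendsto.comp
          (tendsto_extChartAt_symm (hSc hx))
    obtain ⟨r', hr', hr'm⟩ := Metric.eventually_nhds_iff_ball.1
      (hcont.eventually (extChartAt_source_mem_nhds' (I := 𝓡 d) (hSc' x hx)))
    have hCpos : 0 < max C 1 := by positivity
    refine ⟨min (min r r' / 2) (1 / max C 1), by positivity, nhdsWithin_le_nhds ?_⟩
    have hnear : ∀ᶠ y in 𝓝 x, extChartAt (𝓡 d) c y ∈ Metric.ball (extChartAt (𝓡 d) c x)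
        (min r r' / 2) := (continuousAt_extChartAt' (hSc hx)).eventually
      (Metric.ball_mem_nhds _ (by positivity))
    filter_upwards [hnear] with y hy
    have hsub : Metric.ball (extChartAt (𝓡 d) c y) (min (min r r' / 2) (1 / max C 1)) ⊆
        Metric.ball (extChartAt (𝓡 d) c x) (min r r') := by
      refine (Metric.ball_subset_ball (min_le_left _ _)).trans
        (Metric.ball_subset_ball' ?_)
      have := (Metric.mem_ball.1 hy).le
      linarith
    refine ⟨hh.mono ?_ (hsub.trans (Metric.ball_subset_ball (min_le_left _ _))),
      fun z hz ↦ hr'm z (Metric.ball_subset_ball (min_le_right _ _) (hsub hz))⟩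
    rw [le_div_iff₀ (by positivity)]
    calc C * min (min r r' / 2) (1 / max C 1) ≤ max C 1 * (1 / max C 1) := by
          gcongr
          · exact le_max_left _ _
          · exact min_le_right _ _
      _ = 1 := by field_simp

/-- The derivative of `f` expands the centre-unstable directions by a factor bounded away
from zero. -/
lemma exists_normDerivOn_symm_le [IsContinuousRiemannianBundle 𝔼[d]
      (fun x : M ↦ TangentSpace (𝓡 d) x)] {α : ℝ≥0} (hα₀ : 0 < α) (hα₁ : α ≤ 1)
    (hf : HasLocallyHolderDerivative (d := d) α f) (hΛ : IsDominatedSplitting f Λ Ecs Ecu) :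
    ∃ a > 0, ∀ x ∈ Λ, normDerivOn f.symm Ecu (f x) ≤ 1 / a := by
  refine hΛ.isCompact.exists_pos_forall (P := fun a x ↦ x ∈ Λ →
    normDerivOn f.symm Ecu (f x) ≤ 1 / a)
    (fun a b x ha hab h hx ↦ (h hx).trans (one_div_le_one_div_of_le ha hab)) (fun x hx ↦ ?_)
    |>.imp fun a ha ↦ ⟨ha.1, fun x hx ↦ ha.2 x hx hx⟩
  obtain ⟨a, ha, hev⟩ := exists_rate_le (d := d) hα₀ hα₁ hf x
  refine ⟨1 / a, by positivity, nhdsWithin_le_nhds ?_⟩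
  filter_upwards [hev] with y hy hyΛ
  rw [one_div_one_div]
  refine ContinuousLinearMap.opNorm_le_bound _ ha.le fun v ↦ ?_
  obtain ⟨w, hw, hwv⟩ : (v : TangentSpace (𝓡 d) (f y)) ∈
      (Ecu y).map (mfderiv (𝓡 d) (𝓡 d) f y).toLinearMap := by
    rw [hΛ.invariant_cu y hyΛ]; exact v.2
  change mfderiv (𝓡 d) (𝓡 d) f y w = v at hwv
  have h1 := seminorm_mfderiv_symm_mfderiv f (fun x ↦ normSeminorm ℝ (TangentSpace (𝓡 d) x)) y w
  rw [hwv] at h1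
  have h2 := hy w
  rw [hwv] at h2
  exact h1.le.trans h2

/-- By compactness of the invariant set, finitely many charts suffice for uniform estimates. -/
lemma exists_isChartSystem [IsContMDiffRiemannianBundle (𝓡 d) ∞ 𝔼[d]
      (fun x : M ↦ TangentSpace (𝓡 d) x)] [IsRiemannianManifold (𝓡 d) M]
    {α : ℝ≥0} (hα₀ : 0 < α) (hα₁ : α ≤ 1)
    (hf : HasLocallyHolderDerivative (d := d) α f)
    (hΛ : IsDominatedSplitting f Λ Ecs Ecu) (hN : IsLocallyEquivalent N) :
    ∃ (Z : Set M) (dom : M → Set M) (r K : ℝ), IsChartSystem f Λ Ecs Ecu N α Z dom r K := by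
  have := isContinuousRiemannianBundle_of_isContMDiff (d := d) (M := M) inferInstance
  choose! ρ hρ K hK using fun c (hc : c ∈ Λ) ↦ exists_chart_radius hΛ hN hc
  set S : M → Set M := fun c ↦ (extChartAt (𝓡 d) c).symm ''
    Metric.closedBall (extChartAt (𝓡 d) c c) (ρ c / 3) with hS
  have hρ3 : ∀ c ∈ Λ, 0 < ρ c / 3 := fun c hc ↦ by have := hρ c hc; positivity
  have hcb : ∀ c ∈ Λ, Metric.closedBall (extChartAt (𝓡 d) c c) (ρ c / 3) ⊆
      Metric.ball (extChartAt (𝓡 d) c c) (ρ c) := fun c hc ↦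
    Metric.closedBall_subset_ball (by have := hρ c hc; linarith)
  have hSn : ∀ c ∈ Λ, S c ∈ 𝓝 c := fun c hc ↦ by
    filter_upwards [extChartAt_source_mem_nhds (I := 𝓡 d) c,
      (continuousAt_extChartAt (I := 𝓡 d) c).eventually (Metric.closedBall_mem_nhds _ (hρ3 c hc))]
      with y hy hy'
    exact ⟨_, hy', (extChartAt (𝓡 d) c).left_inv hy⟩
  have hScomp : ∀ c ∈ Λ, IsCompact (S c) := fun c hc ↦
    (isCompact_closedBall _ _).image_of_continuousOn
      ((continuousOn_extChartAt_symm c).mono ((hcb c hc).trans (hK c hc).1))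
  obtain ⟨Z, hZΛ, hcover⟩ := hΛ.isCompact.elim_nhds_subcover (fun c ↦ interior (S c))
    fun c hc ↦ interior_mem_nhds.2 (hSn c hc)
  have hmem : ∀ c ∈ Z, ∀ x ∈ S c, x ∈ (extChartAt (𝓡 d) c).source ∧
      extChartAt (𝓡 d) c x ∈ Metric.closedBall (extChartAt (𝓡 d) c c) (ρ c / 3) := by
    rintro c hc _ ⟨z, hz, rfl⟩
    have hz' := (hK c (hZΛ c hc)).1 (hcb c (hZΛ c hc) hz)
    exact ⟨(extChartAt (𝓡 d) c).map_target hz', by rwa [(extChartAt (𝓡 d) c).right_inv hz']⟩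
  have hdomc : ∀ c ∈ Z, IsCompact (Λ ∩ S c) := fun c hc ↦
    hΛ.isCompact.inter_right (hScomp c (hZΛ c hc)).isClosed
  -- the constants, uniform over the finite set of charts
  obtain ⟨a₁, ha₁, h₁⟩ := Z.finite_toSet.exists_pos_forall (P := fun a c ↦ a ≤ ρ c / 3)
    (fun a b x _ hab h ↦ hab.trans h) fun c hc ↦ ⟨_, hρ3 c (hZΛ c hc), le_rfl⟩
  obtain ⟨a₂, ha₂, h₂⟩ := Z.finite_toSet.exists_pos_forall (P := fun a c ↦ K c ≤ 1 / a)
    (fun a b x ha hab h ↦ h.trans (one_div_le_one_div_of_le ha hab))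
    fun c _ ↦ ⟨1 / max (K c) 1, by positivity, by rw [one_div_one_div]; exact le_max_left _ _⟩
  obtain ⟨a₃, ha₃, h₃⟩ := exists_normDerivOn_symm_le (d := d) hα₀ hα₁ hf hΛ
  obtain ⟨a₄, ha₄, h₄⟩ := (Z.finite_toSet.prod Z.finite_toSet).exists_pos_forall
    (P := fun a q ↦ ∀ x ∈ Λ ∩ S q.1, f x ∈ Λ ∩ S q.2 →
      IsHolderC1On (α : ℝ) (1 / a) a (inCharts f q.1 q.2) (extChartAt (𝓡 d) q.1 x) ∧
      ∀ z ∈ Metric.ball (extChartAt (𝓡 d) q.1 x) a,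
        f ((extChartAt (𝓡 d) q.1).symm z) ∈ (extChartAt (𝓡 d) q.2).source)
    (fun a b q ha hab h x hx hx' ↦ by
      have hsub := Metric.ball_subset_ball (x := extChartAt (𝓡 d) q.1 x) hab
      exact ⟨(h x hx hx').1.mono (one_div_le_one_div_of_le ha hab) hsub,
        fun z hz ↦ (h x hx hx').2 z (hsub hz)⟩)
    (fun q hq ↦ by
      obtain ⟨a, ha, h⟩ := exists_uniform_holder (d := d) (c := q.1) (c' := q.2) hα₀ hα₁ hf
        (S := (Λ ∩ S q.1) ∩ f ⁻¹' (Λ ∩ S q.2))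
        ((hdomc q.1 hq.1).inter_right
          ((hdomc q.2 hq.2).isClosed.preimage f.contMDiff.continuous))
        (fun x hx ↦ (hmem q.1 hq.1 x hx.1.2).1) (fun x hx ↦ (hmem q.2 hq.2 _ hx.2.2).1)
      exact ⟨a, ha, fun x hx hx' ↦ h x ⟨hx, hx'⟩⟩)
  set r := min a₁ a₄ with hr
  set L := max (max (1 / a₂) 1) (max (1 / a₃) (1 / a₄)) with hL
  have hL2 : ∀ c ∈ Z, K c ≤ L := fun c hc ↦
    (h₂ c hc).trans ((le_max_left _ _).trans (le_max_left _ _))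
  have hL0 : 1 ≤ L := (le_max_right _ _).trans (le_max_left _ _)
  have hsub : ∀ c ∈ Z, ∀ x ∈ Λ ∩ S c, Metric.ball (extChartAt (𝓡 d) c x) r ⊆
      Metric.ball (extChartAt (𝓡 d) c c) (ρ c) := by
    intro c hc x hx
    refine Metric.ball_subset_ball' ?_
    have h1 := Metric.mem_closedBall.1 (hmem c hc x hx.2).2
    have h2 : r ≤ ρ c / 3 := (min_le_left _ _).trans (h₁ c hc)
    have h3 := hρ3 c (hZΛ c hc)
    linarith
  have himg : ∀ c ∈ Z, ∀ x ∈ Λ ∩ S c, x ∈ (extChartAt (𝓡 d) c).symm ''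
      Metric.ball (extChartAt (𝓡 d) c c) (ρ c) := fun c hc x hx ↦
    image_mono (hcb c (hZΛ c hc)) hx.2
  have hsub4 : ∀ c : M, ∀ x, Metric.ball (extChartAt (𝓡 d) c x) r ⊆
      Metric.ball (extChartAt (𝓡 d) c x) a₄ := fun c x ↦
    Metric.ball_subset_ball (min_le_right _ _)
  refine ⟨Z, fun c ↦ Λ ∩ S c, r, L, lt_min ha₁ ha₄, hL0, Z.finite_toSet, fun x hx ↦ ?_, hdomc,
    fun c _ ↦ inter_subset_left, fun c hc x hx ↦ (hmem c hc x hx.2).1, fun c hc x hx ↦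
      (hsub c hc x hx).trans (hK c (hZΛ c hc)).1, fun c hc x hx p hp q hq ↦ ?_,
    fun c hc x hx v ↦ ?_, fun c hc x hx z hz v ↦ ?_, fun c hc x hx v ↦ ?_,
    fun c hc c' hc' x hx hx' ↦ ?_, fun c hc c' hc' x hx hx' z hz ↦ ?_, fun x hx ↦ ?_,
    fun δ hδ ↦ ?_⟩
  · obtain ⟨c, hc, hxc⟩ := mem_iUnion₂.1 (hcover hx)
    exact ⟨c, hc, inter_mem self_mem_nhdsWithin
      (nhdsWithin_le_nhds (mem_interior_iff_mem_nhds.1 hxc))⟩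
  · refine ((hK c (hZΛ c hc)).2.1 p (hsub c hc x hx hp) q (hsub c hc x hx hq)).trans
      (ENNReal.ofReal_le_ofReal ?_)
    exact mul_le_mul_of_nonneg_right (hL2 c hc) (norm_nonneg _)
  · have h := ((hK c (hZΛ c hc)).2.2 x (himg c hc x hx)).1 v
    exact ⟨h.1.trans (mul_le_mul_of_nonneg_right (hL2 c hc) (norm_nonneg _)),
      h.2.trans (mul_le_mul_of_nonneg_right (hL2 c hc) (norm_nonneg _))⟩
  · have h := ((hK c (hZΛ c hc)).2.2 _ (mem_image_of_mem _ (hsub c hc x hx hz))).2.1 v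
    exact ⟨h.1.trans (mul_le_mul_of_nonneg_right (hL2 c hc) (apply_nonneg _ _)),
      h.2.trans (mul_le_mul_of_nonneg_right (hL2 c hc) (norm_nonneg _))⟩
  · exact (((hK c (hZΛ c hc)).2.2 x (himg c hc x hx)).2.2 hx.1 v).trans
      (mul_le_mul_of_nonneg_right (hL2 c hc) (norm_nonneg _))
  · exact (h₄ (c, c') ⟨hc, hc'⟩ x hx hx').1.mono
      ((le_max_right _ _).trans (le_max_right _ _)) (hsub4 c x)
  · exact (h₄ (c, c') ⟨hc, hc'⟩ x hx hx').2 z (hsub4 c x hz)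
  · exact (h₃ x hx).trans ((le_max_left _ _).trans (le_max_right _ _))
  · obtain ⟨η, hη, h⟩ := Z.finite_toSet.exists_pos_forall (P := fun η c ↦ ∀ x ∈ Λ ∩ S c, ∀ y,
      edist y x < ENNReal.ofReal η → y ∈ (extChartAt (𝓡 d) c).source ∧
        ‖extChartAt (𝓡 d) c y - extChartAt (𝓡 d) c x‖ < δ)
      (fun a b c _ hab h x hx y hy ↦ h x hx y (hy.trans_le (ENNReal.ofReal_le_ofReal hab)))
      fun c hc ↦ exists_uniform_close (d := d) (hdomc c hc)
        (fun x hx ↦ (hmem c hc x hx.2).1) hδ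
    exact ⟨η, hη, h⟩

end ChartSystemExistence

/-! ### Coordinates adapted to the splitting -/

section Adapted

variable {d k l : ℕ} {M : Type*} [EMetricSpace M] [ChartedSpace (EuclideanSpace ℝ (Fin d)) M]
  [IsManifold (𝓡 d) ∞ M] [RiemannianBundle (fun x : M ↦ TangentSpace (𝓡 d) x)]

/-- Linear coordinates in the chart at `c` which at the point `x` turn the centre-unstable direction
isometrically into the first, and the centre-stable direction into the second factor. -/
structure IsAdapted (Ecs Ecu : ∀ x : M, Submodule ℝ (TangentSpace (𝓡 d) x)) (L : ℝ) (c x : M)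
    (B : 𝔼[d] ≃L[ℝ] 𝔼[k] × 𝔼[l]) : Prop where
  cu : ∀ v ∈ Ecu x, (B (tangentCoord c x v)).2 = 0 ∧ ‖(B (tangentCoord c x v)).1‖ = ‖v‖
  cs : ∀ v ∈ Ecs x, (B (tangentCoord c x v)).1 = 0 ∧ ‖(B (tangentCoord c x v)).2‖ = ‖v‖
  symm_cu : ∀ u, tangentCoordSymm c x (B.symm (u, 0)) ∈ Ecu x
  symm_cs : ∀ v, tangentCoordSymm c x (B.symm (0, v)) ∈ Ecs x
  norm_le : ∀ ξ, ‖B ξ‖ ≤ L * ‖ξ‖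
  norm_symm_le : ∀ p, ‖B.symm p‖ ≤ L * ‖p‖

variable {f : M ≃ₘ^1⟮𝓡 d, 𝓡 d⟯ M} {Λ : Set M}
  {Ecs Ecu : ∀ x : M, Submodule ℝ (TangentSpace (𝓡 d) x)}
  {N : ∀ x : M, Seminorm ℝ (TangentSpace (𝓡 d) x)} {α : ℝ} {Z : Set M} {dom : M → Set M} {r K : ℝ}

omit [IsManifold (𝓡 d) ∞ M] in
lemma exists_orthonormal_coord {x : M} (F : Submodule ℝ (TangentSpace (𝓡 d) x)) {k : ℕ}
    (hk : Module.finrank ℝ F = k) : 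
    ∃ e : F ≃ₗ[ℝ] 𝔼[k], ∀ v : F, ‖e v‖ = ‖(v : TangentSpace (𝓡 d) x)‖ := by
  subst hk
  have : FiniteDimensional ℝ (TangentSpace (𝓡 d) x) := inferInstanceAs (FiniteDimensional ℝ 𝔼[d])
  exact ⟨(stdOrthonormalBasis ℝ F).repr.toLinearEquiv,
    fun v ↦ (stdOrthonormalBasis ℝ F).repr.norm_map v⟩

namespace IsChartSystem

variable (hCS : IsChartSystem f Λ Ecs Ecu N α Z dom r K)
include hCS

/-- Adapted coordinates from orthonormal bases of the two subspaces. The angle between the subspaces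
is controlled by the bound for the projections in the chart system. -/
lemma exists_isAdapted (hcompl : ∀ x ∈ Λ, IsCompl (Ecs x) (Ecu x)) {c x : M} (hc : c ∈ Z)
    (hx : x ∈ dom c) (hk : Module.finrank ℝ (Ecu x) = k) (hl : Module.finrank ℝ (Ecs x) = l) :
    ∃ B : 𝔼[d] ≃L[ℝ] 𝔼[k] × 𝔼[l], IsAdapted Ecs Ecu (2 * K ^ 3) c x B := by
  have hxs := hCS.subset_source c hc hx
  have hK := hCS.one_le_K
  have hcp := (hcompl x (hCS.subset c hc hx)).symm
  obtain ⟨e₁, he₁⟩ := exists_orthonormal_coord (Ecu x) hk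
  obtain ⟨e₂, he₂⟩ := exists_orthonormal_coord (Ecs x) hl
  let τ : 𝔼[d] ≃ₗ[ℝ] TangentSpace (𝓡 d) x := LinearEquiv.ofLinearMap
    (tangentCoordSymm (d := d) c x).toLinearMap (tangentCoord c x).toLinearMap
    (by ext v; exact tangentCoordSymm_tangentCoord hxs v)
    (by ext1 v; exact tangentCoord_tangentCoordSymm hxs v)
  let Q := (Ecu x).prodEquivOfIsCompl (Ecs x) hcp
  let B₀ : 𝔼[d] ≃ₗ[ℝ] 𝔼[k] × 𝔼[l] := τ.trans (Q.symm.trans (e₁.prodCongr e₂))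
  let B : 𝔼[d] ≃L[ℝ] 𝔼[k] × 𝔼[l] := B₀.toContinuousLinearEquiv
  have hB : ∀ (a : Ecu x) (b : Ecs x),
      B (tangentCoord c x ((a : TangentSpace (𝓡 d) x) + (b : TangentSpace (𝓡 d) x))) =
      (e₁ a, e₂ b) := by
    intro a b
    have h1 :
        τ (tangentCoord c x ((a : TangentSpace (𝓡 d) x) + (b : TangentSpace (𝓡 d) x))) = a + b :=
      tangentCoordSymm_tangentCoord hxs _
    have h2 : Q.symm ((a : TangentSpace (𝓡 d) x) + (b : TangentSpace (𝓡 d) x)) = (a, b) := by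
      rw [LinearEquiv.symm_apply_eq]; rfl
    change (e₁.prodCongr e₂) (Q.symm (τ _)) = _
    rw [h1, h2]; rfl
  have hBs : ∀ (a : Ecu x) (b : Ecs x), tangentCoordSymm c x (B.symm (e₁ a, e₂ b)) =
      (a : TangentSpace (𝓡 d) x) + b := by
    intro a b
    rw [← hB, ContinuousLinearEquiv.symm_apply_apply, tangentCoordSymm_tangentCoord hxs]
  have hsplit : ∀ ξ : 𝔼[d], ∃ (a : Ecu x) (b : Ecs x),
      ξ = tangentCoord c x ((a : TangentSpace (𝓡 d) x) + (b : TangentSpace (𝓡 d) x)) := by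
    intro ξ
    refine ⟨(Q.symm (τ ξ)).1, (Q.symm (τ ξ)).2, ?_⟩
    have h : ((Q.symm (τ ξ)).1 : TangentSpace (𝓡 d) x) +
        ((Q.symm (τ ξ)).2 : TangentSpace (𝓡 d) x) = τ ξ :=
      Q.apply_symm_apply (τ ξ)
    rw [h]
    exact (tangentCoord_tangentCoordSymm hxs ξ).symm
  have hnorm := hCS.norm_le c hc x hx
  have hKK : K ^ 2 ≤ K ^ 3 := pow_le_pow_right₀ hK (by norm_num)
  have hK1 : K ≤ K ^ 3 := le_self_pow₀ hK (by norm_num)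
  refine ⟨B, fun v hv ↦ ?_, fun v hv ↦ ?_, fun u ↦ ?_, fun v ↦ ?_, fun ξ ↦ ?_, fun p ↦ ?_⟩
  · have h := hB ⟨v, hv⟩ 0
    rw [Submodule.coe_zero, add_zero, map_zero] at h
    rw [h]
    exact ⟨rfl, he₁ _⟩
  · have h := hB 0 ⟨v, hv⟩
    rw [Submodule.coe_zero, zero_add, map_zero] at h
    rw [h]
    exact ⟨rfl, he₂ _⟩
  · have h := hBs (e₁.symm u) 0
    rw [Submodule.coe_zero, add_zero, map_zero, e₁.apply_symm_apply] at h
    rw [h]; exact (e₁.symm u).2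
  · have h := hBs 0 (e₂.symm v)
    rw [Submodule.coe_zero, zero_add, map_zero, e₂.apply_symm_apply] at h
    rw [h]; exact (e₂.symm v).2
  · obtain ⟨a, b, rfl⟩ := hsplit ξ
    have h1 : splittingProj Ecu Ecs c x
        (tangentCoord c x ((a : TangentSpace (𝓡 d) x) + (b : TangentSpace (𝓡 d) x))) =
        tangentCoord c x (a : TangentSpace (𝓡 d) x) := by
      rw [map_add, map_add, splittingProj_of_mem hcp hxs a.2,
        splittingProj_of_mem_right hcp hxs b.2, add_zero]
    have h2 := hCS.proj_le c hc x hx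
      (tangentCoord c x ((a : TangentSpace (𝓡 d) x) + (b : TangentSpace (𝓡 d) x)))
    rw [h1] at h2
    set ξ := tangentCoord c x ((a : TangentSpace (𝓡 d) x) + (b : TangentSpace (𝓡 d) x)) with hξ
    have h3 : tangentCoord c x (b : TangentSpace (𝓡 d) x) =
        ξ - tangentCoord c x (a : TangentSpace (𝓡 d) x) := by
      rw [hξ, map_add]; abel
    have ha : ‖e₁ a‖ ≤ K ^ 2 * ‖ξ‖ := by
      rw [he₁]
      calc _ ≤ K * ‖tangentCoord c x (a : TangentSpace (𝓡 d) x)‖ := (hnorm _).2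
        _ ≤ K * (K * ‖ξ‖) := by gcongr
        _ = _ := by ring
    have hb : ‖e₂ b‖ ≤ 2 * K ^ 2 * ‖ξ‖ := by
      rw [he₂]
      calc _ ≤ K * ‖tangentCoord c x (b : TangentSpace (𝓡 d) x)‖ := (hnorm _).2
        _ ≤ K * (‖ξ‖ + K * ‖ξ‖) := by
          gcongr
          rw [h3]
          exact (norm_sub_le _ _).trans (by gcongr)
        _ ≤ K * (K * ‖ξ‖ + K * ‖ξ‖) := by
          gcongr
          exact le_mul_of_one_le_left (norm_nonneg _) hK
        _ = _ := by ring
    rw [hB]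
    have h4 := norm_nonneg ξ
    exact max_le (ha.trans (by nlinarith)) (hb.trans (by nlinarith))
  · have h := hBs (e₁.symm p.1) (e₂.symm p.2)
    rw [e₁.apply_symm_apply, e₂.apply_symm_apply] at h
    have h5 : B.symm p = tangentCoord c x
        ((e₁.symm p.1 : TangentSpace (𝓡 d) x) + (e₂.symm p.2 : TangentSpace (𝓡 d) x)) := by
      rw [← h, tangentCoord_tangentCoordSymm hxs]
    have h6 : ‖(e₁.symm p.1 : TangentSpace (𝓡 d) x)‖ = ‖p.1‖ := by
      rw [← he₁, e₁.apply_symm_apply]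
    have h7 : ‖(e₂.symm p.2 : TangentSpace (𝓡 d) x)‖ = ‖p.2‖ := by
      rw [← he₂, e₂.apply_symm_apply]
    rw [h5]
    have h8 := norm_fst_le p
    have h9 := norm_snd_le p
    calc _ ≤ K * (‖p.1‖ + ‖p.2‖) := by
          refine (hnorm _).1.trans ?_
          gcongr
          exact (norm_add_le _ _).trans_eq (by rw [h6, h7])
      _ ≤ K * (‖p‖ + ‖p‖) := by gcongr
      _ = 2 * K * ‖p‖ := by ring
      _ ≤ _ := by gcongr

end IsChartSystem

end Adapted

/-! ### An orbit as a dominated chain -/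

section OrbitChain

variable {d k l : ℕ} {M : Type*} [EMetricSpace M] [ChartedSpace (EuclideanSpace ℝ (Fin d)) M]
  [IsManifold (𝓡 d) ∞ M] [RiemannianBundle (fun x : M ↦ TangentSpace (𝓡 d) x)]

variable {f : M ≃ₘ^1⟮𝓡 d, 𝓡 d⟯ M} {Λ : Set M}
  {Ecs Ecu : ∀ x : M, Submodule ℝ (TangentSpace (𝓡 d) x)}
  {N : ∀ x : M, Seminorm ℝ (TangentSpace (𝓡 d) x)} {α : ℝ} {Z : Set M} {dom : M → Set M} {r K : ℝ}

omit [IsManifold (𝓡 d) ∞ M] [RiemannianBundle (fun x : M ↦ TangentSpace (𝓡 d) x)] in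
variable (d) in
/-- The point of the manifold with given linear coordinates around `x` in the chart at `c`. -/
def chartPoint (c x : M) (B : 𝔼[d] ≃L[ℝ] 𝔼[k] × 𝔼[l]) (p : 𝔼[k] × 𝔼[l]) : M :=
  (extChartAt (𝓡 d) c).symm (extChartAt (𝓡 d) c x + B.symm p)

lemma IsAdapted.norm_symm_cu {L : ℝ} {c x : M} {B : 𝔼[d] ≃L[ℝ] 𝔼[k] × 𝔼[l]}
    (hB : IsAdapted Ecs Ecu L c x B) (hx : x ∈ (extChartAt (𝓡 d) c).source) (u : 𝔼[k]) :
    ‖tangentCoordSymm c x (B.symm (u, 0))‖ = ‖u‖ := by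
  have h := (hB.cu _ (hB.symm_cu u)).2
  rw [tangentCoord_tangentCoordSymm hx, ContinuousLinearEquiv.apply_symm_apply] at h
  exact h.symm

lemma IsAdapted.norm_symm_cs {L : ℝ} {c x : M} {B : 𝔼[d] ≃L[ℝ] 𝔼[k] × 𝔼[l]}
    (hB : IsAdapted Ecs Ecu L c x B) (hx : x ∈ (extChartAt (𝓡 d) c).source) (v : 𝔼[l]) :
    ‖tangentCoordSymm c x (B.symm (0, v))‖ = ‖v‖ := by
  have h := (hB.cs _ (hB.symm_cs v)).2
  rw [tangentCoord_tangentCoordSymm hx, ContinuousLinearEquiv.apply_symm_apply] at h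
  exact h.symm

/-- The seminorm of the splitting read on the centre-unstable factor. -/
def seminormCu (N : ∀ x : M, Seminorm ℝ (TangentSpace (𝓡 d) x)) (c x : M)
    (B : 𝔼[d] ≃L[ℝ] 𝔼[k] × 𝔼[l]) : Seminorm ℝ 𝔼[k] :=
  (N x).comp ((tangentCoordSymm c x).toLinearMap ∘ₗ B.symm.toLinearMap ∘ₗ LinearMap.inl ℝ _ _)

/-- The seminorm of the splitting read on the centre-stable factor. -/
def seminormCs (N : ∀ x : M, Seminorm ℝ (TangentSpace (𝓡 d) x)) (c x : M)
    (B : 𝔼[d] ≃L[ℝ] 𝔼[k] × 𝔼[l]) : Seminorm ℝ 𝔼[l] :=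
  (N x).comp ((tangentCoordSymm c x).toLinearMap ∘ₗ B.symm.toLinearMap ∘ₗ LinearMap.inr ℝ _ _)

/-- The derivative of `f` at a point near `x`, read in the linear coordinates around `x`
and `f x`. -/
def localDeriv (f : M → M) (c c' x : M) (B B' : 𝔼[d] ≃L[ℝ] 𝔼[k] × 𝔼[l]) (p : 𝔼[k] × 𝔼[l]) :
    𝔼[k] × 𝔼[l] →L[ℝ] 𝔼[k] × 𝔼[l] :=
  (B' : 𝔼[d] →L[ℝ] 𝔼[k] × 𝔼[l]) ∘L
    fderiv ℝ (inCharts f c c') (extChartAt (𝓡 d) c x + B.symm p) ∘L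
      (B.symm : 𝔼[k] × 𝔼[l] →L[ℝ] 𝔼[d])

namespace IsChartSystem

variable (hCS : IsChartSystem f Λ Ecs Ecu N α Z dom r K)
include hCS

lemma one_le_two_mul : 1 ≤ 2 * K ^ 3 := by
  have := one_le_pow₀ hCS.one_le_K (n := 3)
  linarith

lemma le_two_mul : K ≤ 2 * K ^ 3 := by
  have h := le_self_pow₀ hCS.one_le_K (n := 3) (by norm_num)
  have := hCS.one_le_K
  linarith

lemma sq_le_two_mul : K ^ 2 ≤ 2 * K ^ 3 := by
  have h := pow_le_pow_right₀ hCS.one_le_K (m := 2) (n := 3) (by norm_num)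
  have := sq_nonneg K
  linarith

lemma mem_ball_of_norm_lt {c x : M} {B : 𝔼[d] ≃L[ℝ] 𝔼[k] × 𝔼[l]}
    (hB : IsAdapted Ecs Ecu (2 * K ^ 3) c x B) {p : 𝔼[k] × 𝔼[l]} (hp : ‖p‖ < r / (2 * K ^ 3)) :
    extChartAt (𝓡 d) c x + B.symm p ∈ Metric.ball (extChartAt (𝓡 d) c x) r := by
  rw [mem_ball_iff_norm, add_sub_cancel_left]
  have h1 := hCS.one_le_two_mul
  rw [lt_div_iff₀ (by linarith)] at hp
  exact (hB.norm_symm_le p).trans_lt (by linarith)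

section Step

variable {c c' x : M} (hc : c ∈ Z) (hc' : c' ∈ Z) (hx : x ∈ dom c) (hx' : f x ∈ dom c')
  {B B' : 𝔼[d] ≃L[ℝ] 𝔼[k] × 𝔼[l]} (hB : IsAdapted Ecs Ecu (2 * K ^ 3) c x B)
  (hB' : IsAdapted Ecs Ecu (2 * K ^ 3) c' (f x) B')
include hc hc' hx hx' hB hB'

omit hB hB' in
lemma localDeriv_zero_apply (p : 𝔼[k] × 𝔼[l]) :
    localDeriv f c c' x B B' 0 p = B' (tangentCoord c' (f x)
      (mfderiv (𝓡 d) (𝓡 d) f x (tangentCoordSymm c x (B.symm p)))) := by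
  have hxs := hCS.subset_source c hc hx
  have h := fderiv_inCharts_tangentCoord hxs (hCS.subset_source c' hc' hx')
    (f.contMDiff.mdifferentiable one_ne_zero x) (tangentCoordSymm c x (B.symm p))
  rw [tangentCoord_tangentCoordSymm hxs] at h
  simp only [localDeriv, map_zero, add_zero, ContinuousLinearMap.comp_apply,
    ContinuousLinearEquiv.coe_coe]
  rw [h]

omit hB' in
lemma hasFDerivAt_localMap {p : 𝔼[k] × 𝔼[l]} (hp : ‖p‖ < r / (2 * K ^ 3)) :
    HasFDerivAt (fun p ↦ B' (inCharts f c c' (extChartAt (𝓡 d) c x + B.symm p) -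
      extChartAt (𝓡 d) c' (f x))) (localDeriv f c c' x B B' p) p := by
  have h1 := ((hCS.holder c hc c' hc' x hx hx').1 _ (hCS.mem_ball_of_norm_lt hB hp)).hasFDerivAt
  have h2 : HasFDerivAt (fun p ↦ extChartAt (𝓡 d) c x + B.symm p)
      (B.symm : 𝔼[k] × 𝔼[l] →L[ℝ] 𝔼[d]) p := B.symm.hasFDerivAt.const_add _
  exact B'.hasFDerivAt.comp p ((h1.comp p h2).sub_const _)

lemma norm_localDeriv_sub_le (hα₀ : 0 < α) (hα₁ : α ≤ 1) {p q : 𝔼[k] × 𝔼[l]}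
    (hp : ‖p‖ < r / (2 * K ^ 3)) (hq : ‖q‖ < r / (2 * K ^ 3)) :
    ‖localDeriv f c c' x B B' p - localDeriv f c c' x B B' q‖ ≤ (2 * K ^ 3) ^ 4 * ‖p - q‖ ^ α := by
  have h1 := (hCS.holder c hc c' hc' x hx hx').2.2 _ (hCS.mem_ball_of_norm_lt hB hp) _
    (hCS.mem_ball_of_norm_lt hB hq)
  have hK := hCS.le_two_mul
  have hK1 := hCS.one_le_K
  have hL := hCS.one_le_two_mul
  set L := 2 * K ^ 3 with hLdef
  rw [add_sub_add_left_eq_sub, ← map_sub] at h1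
  have h2 : ‖B.symm (p - q)‖ ^ α ≤ L * ‖p - q‖ ^ α := by
    calc ‖B.symm (p - q)‖ ^ α ≤ (L * ‖p - q‖) ^ α := by
          gcongr
          exact hB.norm_symm_le _
      _ = L ^ α * ‖p - q‖ ^ α := Real.mul_rpow (by linarith) (norm_nonneg _)
      _ ≤ L * ‖p - q‖ ^ α := by
          gcongr
          exact Real.rpow_le_self_of_one_le hL hα₁
  have hBn : ‖(B' : 𝔼[d] →L[ℝ] 𝔼[k] × 𝔼[l])‖ ≤ L :=
    ContinuousLinearMap.opNorm_le_bound _ (by linarith) hB'.norm_le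
  have hBs : ‖(B.symm : 𝔼[k] × 𝔼[l] →L[ℝ] 𝔼[d])‖ ≤ L :=
    ContinuousLinearMap.opNorm_le_bound _ (by linarith) hB.norm_symm_le
  have e : localDeriv f c c' x B B' p - localDeriv f c c' x B B' q =
      (B' : 𝔼[d] →L[ℝ] 𝔼[k] × 𝔼[l]) ∘L
        (fderiv ℝ (inCharts f c c') (extChartAt (𝓡 d) c x + B.symm p) -
          fderiv ℝ (inCharts f c c') (extChartAt (𝓡 d) c x + B.symm q)) ∘L
        (B.symm : 𝔼[k] × 𝔼[l] →L[ℝ] 𝔼[d]) := by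
    refine ContinuousLinearMap.ext fun w ↦ ?_
    simp [localDeriv]
  rw [e]
  calc _ ≤ L * ((K * (L * ‖p - q‖ ^ α)) * L) := by
        refine (ContinuousLinearMap.opNorm_comp_le _ _).trans ?_
        refine mul_le_mul hBn ?_ (norm_nonneg _) (by linarith)
        refine (ContinuousLinearMap.opNorm_comp_le _ _).trans ?_
        refine mul_le_mul (h1.trans ?_) hBs (norm_nonneg _) (by positivity)
        gcongr
    _ ≤ L * ((L * (L * ‖p - q‖ ^ α)) * L) := by gcongr
    _ = _ := by ring

variable (hΛ : IsDominatedSplitting f Λ Ecs Ecu)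
include hΛ

lemma localDeriv_inl (u : 𝔼[k]) : (localDeriv f c c' x B B' 0 (u, 0)).2 = 0 ∧
    tangentCoordSymm c' (f x) (B'.symm ((localDeriv f c c' x B B' 0 (u, 0)).1, 0)) =
      mfderiv (𝓡 d) (𝓡 d) f x (tangentCoordSymm c x (B.symm (u, 0))) := by
  have hw : mfderiv (𝓡 d) (𝓡 d) f x (tangentCoordSymm c x (B.symm (u, 0))) ∈ Ecu (f x) := by
    rw [← hΛ.invariant_cu x (hCS.subset c hc hx)]
    exact Submodule.mem_map_of_mem (hB.symm_cu u)
  have h0 := hCS.localDeriv_zero_apply hc hc' hx hx' (B := B) (B' := B') (u, 0)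
  have h1 : (localDeriv f c c' x B B' 0 (u, 0)).2 = 0 := by rw [h0]; exact (hB'.cu _ hw).1
  refine ⟨h1, ?_⟩
  have h2 : ((localDeriv f c c' x B B' 0 (u, 0)).1, (0 : 𝔼[l])) =
      localDeriv f c c' x B B' 0 (u, 0) := Prod.ext rfl h1.symm
  rw [h2, h0, ContinuousLinearEquiv.symm_apply_apply,
    tangentCoordSymm_tangentCoord (hCS.subset_source c' hc' hx')]

lemma localDeriv_inr (v : 𝔼[l]) : (localDeriv f c c' x B B' 0 (0, v)).1 = 0 ∧
    tangentCoordSymm c' (f x) (B'.symm (0, (localDeriv f c c' x B B' 0 (0, v)).2)) =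
      mfderiv (𝓡 d) (𝓡 d) f x (tangentCoordSymm c x (B.symm (0, v))) := by
  have hw : mfderiv (𝓡 d) (𝓡 d) f x (tangentCoordSymm c x (B.symm (0, v))) ∈ Ecs (f x) := by
    rw [← hΛ.invariant_cs x (hCS.subset c hc hx)]
    exact Submodule.mem_map_of_mem (hB.symm_cs v)
  have h0 := hCS.localDeriv_zero_apply hc hc' hx hx' (B := B) (B' := B') (0, v)
  have h1 : (localDeriv f c c' x B B' 0 (0, v)).1 = 0 := by rw [h0]; exact (hB'.cs _ hw).1
  refine ⟨h1, ?_⟩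
  have h2 : ((0 : 𝔼[k]), (localDeriv f c c' x B B' 0 (0, v)).2) =
      localDeriv f c c' x B B' 0 (0, v) := Prod.ext h1.symm rfl
  rw [h2, h0, ContinuousLinearEquiv.symm_apply_apply,
    tangentCoordSymm_tangentCoord (hCS.subset_source c' hc' hx')]

lemma norm_le_localDeriv (u : 𝔼[k]) :
    ‖u‖ ≤ normDerivOn f.symm Ecu (f x) * ‖(localDeriv f c c' x B B' 0 (u, 0)).1‖ := by
  have h := (hCS.localDeriv_inl hc hc' hx hx' hB hB' hΛ u).2
  have hw : mfderiv (𝓡 d) (𝓡 d) f x (tangentCoordSymm c x (B.symm (u, 0))) ∈ Ecu (f x) := by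
    rw [← hΛ.invariant_cu x (hCS.subset c hc hx)]
    exact Submodule.mem_map_of_mem (hB.symm_cu u)
  have h1 := norm_le_normDerivOn_symm hw
  rw [hB.norm_symm_cu (hCS.subset_source c hc hx), ← h,
    hB'.norm_symm_cu (hCS.subset_source c' hc' hx')] at h1
  exact h1

end Step

lemma seminorm_bounds {c x : M} (hc : c ∈ Z) (hx : x ∈ dom c) (ξ : 𝔼[d]) :
    N x (tangentCoordSymm c x ξ) ≤ K * K * ‖tangentCoordSymm c x ξ‖ ∧
      ‖tangentCoordSymm c x ξ‖ ≤ K * K * N x (tangentCoordSymm c x ξ) := by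
  have hxs := hCS.subset_source c hc hx
  have h1 := hCS.norm_le c hc x hx (tangentCoordSymm c x ξ)
  have h2 := hCS.seminorm_le c hc x hx _ (Metric.mem_ball_self hCS.r_pos)
  rw [(extChartAt (𝓡 d) c).left_inv hxs] at h2
  have h3 := h2 (tangentCoordSymm c x ξ)
  have hK := hCS.one_le_K
  rw [mul_assoc, mul_assoc]
  exact ⟨h3.2.trans (by gcongr; exact h1.1), h1.2.trans (by gcongr; exact h3.1)⟩

/-- The orbit of a point of `Λ` is a dominated chain in adapted coordinates. -/
lemma exists_dominatedChain (hα₀ : 0 < α) (hα₁ : α ≤ 1) (hΛ : IsDominatedSplitting f Λ Ecs Ecu)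
    {lam : ℝ} {μ : M → ℝ} (hμ : ∀ x, 0 ≤ μ x)
    (hdom : ∀ x ∈ Λ, (∀ v ∈ Ecs x, N (f x) (mfderiv (𝓡 d) (𝓡 d) f x v) ≤ μ x * N x v) ∧
        (∀ v ∈ Ecu x, μ x * N x v ≤ lam * N (f x) (mfderiv (𝓡 d) (𝓡 d) f x v)))
    [Nontrivial 𝔼[k]] {x : M} {c : ℕ → M} {B : ℕ → 𝔼[d] ≃L[ℝ] 𝔼[k] × 𝔼[l]}
    (hc : ∀ j, c j ∈ Z) (hx : ∀ j, f^[j] x ∈ dom (c j))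
    (hB : ∀ j, IsAdapted Ecs Ecu (2 * K ^ 3) (c j) (f^[j] x) (B j)) :
    ∃ X : DominatedChain 𝔼[k] 𝔼[l] α ((2 * K ^ 3) ^ 4) (2 * K ^ 3) (r / (2 * K ^ 3)) lam,
      (∀ j p, ‖p‖ < r / (2 * K ^ 3) →
        f (chartPoint d (c j) (f^[j] x) (B j) p) ∈ (extChartAt (𝓡 d) (c (j + 1))).source ∧
        X.f j p = B (j + 1) (extChartAt (𝓡 d) (c (j + 1))
          (f (chartPoint d (c j) (f^[j] x) (B j) p)) -
            extChartAt (𝓡 d) (c (j + 1)) (f^[j + 1] x))) ∧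
      (∀ j, X.m j = normDerivOn f.symm Ecu (f^[j + 1] x)) ∧
      (∀ u, X.NU 0 u = N x (tangentCoordSymm (c 0) x ((B 0).symm (u, 0)))) ∧
      (∀ v, X.NV 0 v = N x (tangentCoordSymm (c 0) x ((B 0).symm (0, v)))) := by
  have hxΛ : ∀ j, f^[j] x ∈ Λ := fun j ↦ hCS.subset _ (hc j) (hx j)
  have hsrc : ∀ j, f^[j] x ∈ (extChartAt (𝓡 d) (c j)).source := fun j ↦
    hCS.subset_source _ (hc j) (hx j)
  have hstep : ∀ j, f^[j + 1] x = f (f^[j] x) := fun j ↦ Function.iterate_succ_apply' f j x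
  have hx' : ∀ j, f (f^[j] x) ∈ dom (c (j + 1)) := fun j ↦ hstep j ▸ hx (j + 1)
  have hB' : ∀ j, IsAdapted Ecs Ecu (2 * K ^ 3) (c (j + 1)) (f (f^[j] x)) (B (j + 1)) := fun j ↦
    hstep j ▸ hB (j + 1)
  have hK := hCS.le_two_mul
  have hK2 := hCS.sq_le_two_mul
  rw [sq] at hK2
  have hL := hCS.one_le_two_mul
  set L := 2 * K ^ 3 with hLdef
  set D : ℕ → 𝔼[k] × 𝔼[l] → 𝔼[k] × 𝔼[l] →L[ℝ] 𝔼[k] × 𝔼[l] := fun j ↦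
    localDeriv f (c j) (c (j + 1)) (f^[j] x) (B j) (B (j + 1)) with hD
  have hinl := fun j ↦ hCS.localDeriv_inl (hc j) (hc (j + 1)) (hx j) (hx' j) (hB j) (hB' j) hΛ
  have hinr := fun j ↦ hCS.localDeriv_inr (hc j) (hc (j + 1)) (hx j) (hx' j) (hB j) (hB' j) hΛ
  have hexp := fun j ↦ hCS.norm_le_localDeriv (hc j) (hc (j + 1)) (hx j) (hx' j) (hB j) (hB' j) hΛ
  let A₀ : ℕ → 𝔼[k] →ₗ[ℝ] 𝔼[k] := fun j ↦
    LinearMap.fst ℝ 𝔼[k] 𝔼[l] ∘ₗ (D j 0).toLinearMap ∘ₗ LinearMap.inl ℝ 𝔼[k] 𝔼[l]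
  have hA₀ : ∀ j u, ‖u‖ ≤ normDerivOn f.symm Ecu (f (f^[j] x)) * ‖A₀ j u‖ := hexp
  have hinj : ∀ j, Function.Injective (A₀ j) := fun j ↦ by
    rw [injective_iff_map_eq_zero]
    intro u hu
    have h := hA₀ j u
    rw [hu, norm_zero, mul_zero] at h
    exact norm_le_zero_iff.1 h
  let A : ℕ → 𝔼[k] ≃L[ℝ] 𝔼[k] := fun j ↦
    (LinearEquiv.ofInjectiveEndo (A₀ j) (hinj j)).toContinuousLinearEquiv
  have hA : ∀ j u, A j u = (D j 0 (u, 0)).1 := fun j u ↦ rfl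
  refine ⟨{
    f := fun j p ↦ B (j + 1) (inCharts f (c j) (c (j + 1))
      (extChartAt (𝓡 d) (c j) (f^[j] x) + (B j).symm p) -
        extChartAt (𝓡 d) (c (j + 1)) (f (f^[j] x)))
    f' := D
    A := A
    B := fun j ↦ ContinuousLinearMap.snd ℝ _ _ ∘L D j 0 ∘L ContinuousLinearMap.inr ℝ _ _
    NU := fun j ↦ seminormCu N (c j) (f^[j] x) (B j)
    NV := fun j ↦ seminormCs N (c j) (f^[j] x) (B j)
    m := fun j ↦ normDerivOn f.symm Ecu (f (f^[j] x))
    μ := fun j ↦ μ (f^[j] x)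
    map_zero := fun j ↦ ?_
    hasFDerivAt := fun j p hp ↦ hCS.hasFDerivAt_localMap (hc j) (hc (j + 1)) (hx j) (hx' j) (hB j)
      (mem_ball_zero_iff.1 hp)
    holder := fun j p hp q hq ↦ hCS.norm_localDeriv_sub_le (hc j) (hc (j + 1)) (hx j) (hx' j) (hB j)
      (hB' j) hα₀ hα₁ (mem_ball_zero_iff.1 hp) (mem_ball_zero_iff.1 hq)
    deriv_zero := fun j p ↦ ?_
    norm_symm_le := hA₀
    m_pos := fun j ↦ ?_
    m_le := fun j ↦ (hCS.rate_le _ (hxΛ j)).trans hK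
    NU_le := fun j u ↦ ?_
    le_NU := fun j u ↦ ?_
    NV_le := fun j v ↦ ?_
    le_NV := fun j v ↦ ?_
    μ_nonneg := fun j ↦ hμ _
    NV_map := fun j v ↦ ?_
    NU_map := fun j u ↦ ?_ }, fun j p hp ↦ ?_, fun j ↦ ?_, fun u ↦ rfl, fun v ↦ rfl⟩
  · simp only [map_zero, add_zero, inCharts, Function.comp_apply,
      (extChartAt (𝓡 d) (c j)).left_inv (hsrc j), sub_self]
  · have e : p = (p.1, 0) + (0, p.2) := by simp
    conv_lhs => rw [e, map_add]
    refine Prod.ext ?_ ?_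
    · rw [Prod.fst_add, (hinr j p.2).1, add_zero]; rfl
    · rw [Prod.snd_add, (hinl j p.1).1, zero_add]; rfl
  · obtain ⟨u, hu⟩ := exists_ne (0 : 𝔼[k])
    have h := hA₀ j u
    have h0 := normDerivOn_nonneg f.symm Ecu (f (f^[j] x))
    rcases h0.eq_or_lt with h1 | h1
    · rw [← h1, zero_mul] at h
      exact absurd (norm_le_zero_iff.1 h) hu
    · exact h1
  · have h := (hCS.seminorm_bounds (hc j) (hx j) ((B j).symm (u, 0))).1
    rw [(hB j).norm_symm_cu (hsrc j)] at h
    exact h.trans (by gcongr)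
  · have h := (hCS.seminorm_bounds (hc j) (hx j) ((B j).symm (u, 0))).2
    rw [(hB j).norm_symm_cu (hsrc j)] at h
    exact h.trans (mul_le_mul_of_nonneg_right hK2 (apply_nonneg _ _))
  · have h := (hCS.seminorm_bounds (hc j) (hx j) ((B j).symm (0, v))).1
    rw [(hB j).norm_symm_cs (hsrc j)] at h
    exact h.trans (by gcongr)
  · have h := (hCS.seminorm_bounds (hc j) (hx j) ((B j).symm (0, v))).2
    rw [(hB j).norm_symm_cs (hsrc j)] at h
    exact h.trans (mul_le_mul_of_nonneg_right hK2 (apply_nonneg _ _))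
  · have h := (hdom _ (hxΛ j)).1 _ ((hB j).symm_cs v)
    rw [← (hinr j v).2, ← hstep j] at h
    exact h
  · have h := (hdom _ (hxΛ j)).2 _ ((hB j).symm_cu u)
    rw [← (hinl j u).2, ← hstep j] at h
    exact h
  · have h := hCS.maps _ (hc j) _ (hc (j + 1)) _ (hx j) (hx' j) _
      (hCS.mem_ball_of_norm_lt (hB j) hp)
    refine ⟨h, ?_⟩
    simp only [hstep j, inCharts, Function.comp_apply, chartPoint]
  · rw [hstep j]

end IsChartSystem

end OrbitChain

/-! ### Disks through points of the invariant set and their iterates -/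

section InitialDisk

variable {d k l : ℕ} {M : Type*} [EMetricSpace M] [ChartedSpace (EuclideanSpace ℝ (Fin d)) M]
  [IsManifold (𝓡 d) ∞ M] [RiemannianBundle (fun x : M ↦ TangentSpace (𝓡 d) x)]

variable {f : M ≃ₘ^1⟮𝓡 d, 𝓡 d⟯ M} {Λ : Set M}
  {Ecs Ecu : ∀ x : M, Submodule ℝ (TangentSpace (𝓡 d) x)}
  {N : ∀ x : M, Seminorm ℝ (TangentSpace (𝓡 d) x)} {α : ℝ} {Z : Set M} {dom : M → Set M} {r K : ℝ}

section Splitting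

omit [RiemannianBundle (fun x : M ↦ TangentSpace (𝓡 d) x)] in
lemma tangentCoordSymm_splittingProj_mem {F G : ∀ x : M, Submodule ℝ (TangentSpace (𝓡 d) x)}
    {c x : M} (h : IsCompl (F x) (G x)) (hx : x ∈ (extChartAt (𝓡 d) c).source) (ξ : 𝔼[d]) :
    tangentCoordSymm c x (splittingProj F G c x ξ) ∈ F x ∧
      tangentCoordSymm c x (ξ - splittingProj F G c x ξ) ∈ G x := by
  rw [map_sub, splittingProj_apply h, tangentCoordSymm_tangentCoord hx]
  refine ⟨Subtype.coe_prop _, ?_⟩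
  rw [← Submodule.projectionOnto_apply_eq_zero_iff h, map_sub,
    Submodule.projectionOnto_apply_left, sub_self]

omit [RiemannianBundle (fun x : M ↦ TangentSpace (𝓡 d) x)] in
/-- The derivatives of the iterates contract the cones around the centre-unstable direction. -/
lemma IsDominatedSplitting.seminorm_iterate_le (hΛ : IsDominatedSplitting f Λ Ecs Ecu)
    {lam : ℝ} {μ : M → ℝ} (hlam : 0 ≤ lam) (hμ : ∀ x, 0 ≤ μ x)
    (hdom : ∀ x ∈ Λ, (∀ v ∈ Ecs x, N (f x) (mfderiv (𝓡 d) (𝓡 d) f x v) ≤ μ x * N x v) ∧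
        (∀ v ∈ Ecu x, μ x * N x v ≤ lam * N (f x) (mfderiv (𝓡 d) (𝓡 d) f x v)))
    {z : M} (hz : z ∈ Λ) {a b : TangentSpace (𝓡 d) z} (ha : a ∈ Ecs z) (hb : b ∈ Ecu z)
    (hab : N z a ≤ N z b) (n : ℕ) :
    f^[n] z ∈ Λ ∧ mfderiv (𝓡 d) (𝓡 d) f^[n] z a ∈ Ecs (f^[n] z) ∧
      mfderiv (𝓡 d) (𝓡 d) f^[n] z b ∈ Ecu (f^[n] z) ∧
      N (f^[n] z) (mfderiv (𝓡 d) (𝓡 d) f^[n] z a) ≤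
        lam ^ n * N (f^[n] z) (mfderiv (𝓡 d) (𝓡 d) f^[n] z b) := by
  induction n with
  | zero =>
    have h0 : mfderiv (𝓡 d) (𝓡 d) f^[0] z = ContinuousLinearMap.id ℝ (TangentSpace (𝓡 d) z) :=
      mfderiv_id
    rw [h0]
    simpa using ⟨hz, ha, hb, hab⟩
  | succ n ih =>
    obtain ⟨h1, h2, h3, h4⟩ := ih
    have hfd : MDifferentiable (𝓡 d) (𝓡 d) f := f.contMDiff.mdifferentiable one_ne_zero
    have hfn : MDifferentiable (𝓡 d) (𝓡 d) f^[n] := by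
      clear h1 h2 h3 h4
      induction n with
      | zero => exact mdifferentiable_id
      | succ n ih => rw [Function.iterate_succ']; exact hfd.comp ih
    have e : ∀ v, mfderiv (𝓡 d) (𝓡 d) f^[n + 1] z v =
        mfderiv (𝓡 d) (𝓡 d) f (f^[n] z) (mfderiv (𝓡 d) (𝓡 d) f^[n] z v) := by
      intro v
      have := mfderiv_comp z (hfd (f^[n] z)) (hfn z)
      rw [← Function.iterate_succ' f n] at this
      rw [this]; rfl
    rw [e, e]
    have hs := Function.iterate_succ_apply' f n z
    rw [hs]
    refine ⟨hΛ.mapsTo h1, ?_, ?_, ?_⟩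
    · rw [← hΛ.invariant_cs _ h1]; exact Submodule.mem_map_of_mem h2
    · rw [← hΛ.invariant_cu _ h1]; exact Submodule.mem_map_of_mem h3
    · have h5 := (hdom _ h1).1 _ h2
      have h6 := (hdom _ h1).2 _ h3
      calc _ ≤ μ (f^[n] z) * N (f^[n] z) (mfderiv (𝓡 d) (𝓡 d) f^[n] z a) := h5
        _ ≤ μ (f^[n] z) * (lam ^ n * N (f^[n] z) (mfderiv (𝓡 d) (𝓡 d) f^[n] z b)) :=
          mul_le_mul_of_nonneg_left h4 (hμ _)
        _ = lam ^ n * (μ (f^[n] z) * N (f^[n] z) (mfderiv (𝓡 d) (𝓡 d) f^[n] z b)) := by ring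
        _ ≤ lam ^ n * (lam * _) := mul_le_mul_of_nonneg_left h6 (by positivity)
        _ = _ := by ring

end Splitting

namespace IsChartSystem

variable (hCS : IsChartSystem f Λ Ecs Ecu N α Z dom r K)
include hCS

/-- Vectors which are tangent to the centre-unstable direction at `p` lie in the cone at nearby
points `x`. -/
lemma seminorm_le_of_near {c p x : M} (hc : c ∈ Z)
    (hx : x ∈ dom c) (hnear : ∀ v, ‖splittingProj Ecu Ecs c x v - splittingProj Ecu Ecs c p v‖ ≤
      1 / (2 * K ^ 2) * ‖v‖) {ξ : 𝔼[d]} (hξ : splittingProj Ecu Ecs c p ξ = ξ) :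
    ‖ξ‖ ≤ 2 * ‖splittingProj Ecu Ecs c x ξ‖ ∧
    N x (tangentCoordSymm c x (ξ - splittingProj Ecu Ecs c x ξ)) ≤
      N x (tangentCoordSymm c x (splittingProj Ecu Ecs c x ξ)) := by
  have hxs := hCS.subset_source c hc hx
  have hK := hCS.one_le_K
  have h2 := hCS.seminorm_le c hc x hx _ (Metric.mem_ball_self hCS.r_pos)
  rw [(extChartAt (𝓡 d) c).left_inv hxs] at h2
  have h3 := hnear ξ
  rw [hξ, norm_sub_rev] at h3
  set P := splittingProj Ecu Ecs c x ξ with hP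
  have hle : 1 / (2 * K ^ 2) ≤ 1 / 2 :=
    one_div_le_one_div_of_le (by norm_num) (by nlinarith [one_le_pow₀ hK (n := 2)])
  have h4 : ‖ξ‖ ≤ ‖ξ - P‖ + ‖P‖ := by
    calc ‖ξ‖ = ‖(ξ - P) + P‖ := by simp
      _ ≤ _ := norm_add_le _ _
  have h5 : ‖ξ - P‖ ≤ 1 / 2 * ‖ξ‖ := h3.trans (by gcongr)
  have h6 : ‖ξ‖ ≤ 2 * ‖P‖ := by linarith
  refine ⟨h6, ?_⟩
  have h7 := (h2 (tangentCoordSymm c x (ξ - P))).2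
  have h8 := (h2 (tangentCoordSymm c x P)).1
  rw [tangentCoord_tangentCoordSymm hxs] at h7 h8
  have hK0 : 0 < K := by linarith
  have h9 : K * ‖ξ - P‖ ≤ 1 / K * ‖P‖ := by
    calc K * ‖ξ - P‖ ≤ K * (1 / (2 * K ^ 2) * (2 * ‖P‖)) := by
          gcongr
          exact h3.trans (by gcongr)
      _ = 1 / K * ‖P‖ := by field_simp
  calc _ ≤ K * ‖ξ - P‖ := h7
    _ ≤ 1 / K * ‖P‖ := h9
    _ ≤ 1 / K * (K * N x (tangentCoordSymm c x P)) := by gcongr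
    _ = _ := by field_simp

section Orbit

variable {lam : ℝ} {x : M} {c : ℕ → M} {B : ℕ → 𝔼[d] ≃L[ℝ] 𝔼[k] × 𝔼[l]}
    (hc : ∀ j, c j ∈ Z) (hx : ∀ j, f^[j] x ∈ dom (c j))
    (hB : ∀ j, IsAdapted Ecs Ecu (2 * K ^ 3) (c j) (f^[j] x) (B j))
    {X : DominatedChain 𝔼[k] 𝔼[l] α ((2 * K ^ 3) ^ 4) (2 * K ^ 3) (r / (2 * K ^ 3)) lam}
include hc hx hB

omit hB in
/-- In adapted coordinates, the plane which is centre-unstable at a nearby point `p`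
is an initial plane for the chain of the orbit of `x`. -/
lemma isInitialPlane (hcompl : ∀ x ∈ Λ, IsCompl (Ecs x) (Ecu x))
    (hB0 : IsAdapted Ecs Ecu (2 * K ^ 3) (c 0) x (B 0))
    (hNU : ∀ u, X.NU 0 u = N x (tangentCoordSymm (c 0) x ((B 0).symm (u, 0))))
    (hNV : ∀ v, X.NV 0 v = N x (tangentCoordSymm (c 0) x ((B 0).symm (0, v))))
    {p : M} (hp : p ∈ dom (c 0)) {Bp : 𝔼[d] ≃L[ℝ] 𝔼[k] × 𝔼[l]}
    (hBp : IsAdapted Ecs Ecu (2 * K ^ 3) (c 0) p Bp)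
    (hnear : ∀ v, ‖splittingProj Ecu Ecs (c 0) x v - splittingProj Ecu Ecs (c 0) p v‖ ≤
      1 / (2 * K ^ 2) * ‖v‖) :
    X.IsInitialPlane ((B 0 : 𝔼[d] →L[ℝ] 𝔼[k] × 𝔼[l]) ∘L
      (Bp.symm : 𝔼[k] × 𝔼[l] →L[ℝ] 𝔼[d]) ∘L ContinuousLinearMap.inl ℝ 𝔼[k] 𝔼[l]) := by
  have hx0 : x ∈ dom (c 0) := hx 0
  have hxs := hCS.subset_source _ (hc 0) hx0
  have hps := hCS.subset_source _ (hc 0) hp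
  have hcx := (hcompl x (hCS.subset _ (hc 0) hx0)).symm
  have hcp := (hcompl p (hCS.subset _ (hc 0) hp)).symm
  have key : ∀ u : 𝔼[k], ‖u‖ ≤ 2 * K ^ 3 * ‖(B 0 (Bp.symm (u, 0))).1‖ ∧
      X.NV 0 (B 0 (Bp.symm (u, 0))).2 ≤ X.NU 0 (B 0 (Bp.symm (u, 0))).1 := by
    intro u
    set ξ := Bp.symm (u, 0) with hξdef
    have hξ : splittingProj Ecu Ecs (c 0) p ξ = ξ := by
      have h := splittingProj_of_mem hcp hps (hBp.symm_cu u)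
      rwa [tangentCoord_tangentCoordSymm hps] at h
    have hmem := tangentCoordSymm_splittingProj_mem hcx hxs ξ
    obtain ⟨h1, h2⟩ := hCS.seminorm_le_of_near (hc 0) hx0 hnear hξ
    set P := splittingProj Ecu Ecs (c 0) x ξ with hP
    have h3 := hB0.cu _ hmem.1
    have h4 := hB0.cs _ hmem.2
    rw [tangentCoord_tangentCoordSymm hxs] at h3 h4
    have e1 : (B 0 ξ).1 = (B 0 P).1 := by
      have h5 := h4.1
      rw [map_sub, Prod.fst_sub, sub_eq_zero] at h5
      exact h5
    have e2 : (B 0 ξ).2 = (B 0 (ξ - P)).2 := by rw [map_sub, Prod.snd_sub, h3.1, sub_zero]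
    rw [e1, e2]
    have e3 : (B 0).symm ((B 0 P).1, 0) = P := by
      rw [ContinuousLinearEquiv.symm_apply_eq]; exact Prod.ext rfl h3.1.symm
    have e4 : (B 0).symm (0, (B 0 (ξ - P)).2) = ξ - P := by
      rw [ContinuousLinearEquiv.symm_apply_eq]; exact Prod.ext h4.1.symm rfl
    refine ⟨?_, by rw [hNU, hNV, e3, e4]; exact h2⟩
    have hK := hCS.one_le_K
    have h6 := hCS.norm_le _ (hc 0) p hp (tangentCoordSymm (c 0) p ξ)
    have h7 := hCS.norm_le _ (hc 0) x hx0 (tangentCoordSymm (c 0) x P)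
    rw [tangentCoord_tangentCoordSymm hps, hBp.norm_symm_cu hps] at h6
    rw [tangentCoord_tangentCoordSymm hxs, ← h3.2] at h7
    calc ‖u‖ ≤ K * ‖ξ‖ := h6.2
      _ ≤ K * (2 * (K * ‖(B 0 P).1‖)) := by
        gcongr
        exact h1.trans (by gcongr; exact h7.1)
      _ = 2 * K ^ 2 * ‖(B 0 P).1‖ := by ring
      _ ≤ _ := by
        gcongr
        norm_num
  exact ⟨fun u ↦ (key u).2, fun u ↦ (key u).1⟩

variable (hX : ∀ j p, ‖p‖ < r / (2 * K ^ 3) →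
        f (chartPoint d (c j) (f^[j] x) (B j) p) ∈ (extChartAt (𝓡 d) (c (j + 1))).source ∧
        X.f j p = B (j + 1) (extChartAt (𝓡 d) (c (j + 1))
          (f (chartPoint d (c j) (f^[j] x) (B j) p)) -
            extChartAt (𝓡 d) (c (j + 1)) (f^[j + 1] x)))
include hX

omit [IsManifold (𝓡 d) ∞ M] [RiemannianBundle (fun x : M ↦ TangentSpace (𝓡 d) x)] hCS hB hc hx in
/-- The orbits of the chain are the orbits of `f` in coordinates. -/
lemma orbit_eq {T : 𝔼[k] →L[ℝ] 𝔼[k] × 𝔼[l]} {u : 𝔼[k]}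
    (htar : extChartAt (𝓡 d) (c 0) x + (B 0).symm (T u) ∈ (extChartAt (𝓡 d) (c 0)).target) {j : ℕ}
    (hj : ∀ i < j, ‖X.orbit T i u‖ < r / (2 * K ^ 3)) :
    f^[j] (chartPoint d (c 0) x (B 0) (T u)) ∈ (extChartAt (𝓡 d) (c j)).source ∧
      X.orbit T j u = B j (extChartAt (𝓡 d) (c j) (f^[j] (chartPoint d (c 0) x (B 0) (T u))) -
        extChartAt (𝓡 d) (c j) (f^[j] x)) := by
  induction j with
  | zero =>
    simp only [Function.iterate_zero, id, chartPoint]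
    refine ⟨(extChartAt (𝓡 d) (c 0)).map_target htar, ?_⟩
    rw [(extChartAt (𝓡 d) (c 0)).right_inv htar, add_sub_cancel_left,
      ContinuousLinearEquiv.apply_symm_apply]
    rfl
  | succ j ih =>
    obtain ⟨h1, h2⟩ := ih fun i hi ↦ hj i (hi.trans (Nat.lt_succ_self j))
    obtain ⟨h3, h4⟩ := hX j _ (hj j (Nat.lt_succ_self j))
    have e : chartPoint d (c j) (f^[j] x) (B j) (X.orbit T j u) =
        f^[j] (chartPoint d (c 0) x (B 0) (T u)) := by
      conv_lhs => rw [h2]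
      rw [chartPoint, ContinuousLinearEquiv.symm_apply_apply, add_sub_cancel,
        (extChartAt (𝓡 d) (c j)).left_inv h1]
    rw [e, ← Function.iterate_succ_apply' f j] at h3 h4
    exact ⟨h3, h4⟩

omit [RiemannianBundle (fun x : M ↦ TangentSpace (𝓡 d) x)] hCS hB hc hx in
/-- The derivative of the orbit of the chain is that of the iterate of `f`. -/
lemma tangentCoord_mfderiv_iterate {δ ε : ℝ} (hcc : ChainConstants α ((2 * K ^ 3) ^ 4) (2 * K ^ 3)
      (r / (2 * K ^ 3)) lam δ ε) {T : 𝔼[k] →L[ℝ] 𝔼[k] × 𝔼[l]} (hT : X.IsInitialPlane T) {u : 𝔼[k]}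
    (htar : extChartAt (𝓡 d) (c 0) x + (B 0).symm (T u) ∈ (extChartAt (𝓡 d) (c 0)).target) {n : ℕ}
    (hu : u ∈ X.tube T δ n) {D : 𝔼[k] →L[ℝ] 𝔼[k] × 𝔼[l]} (hD : HasFDerivAt (X.orbit T n) D u)
    (w : 𝔼[k]) :
    (B n).symm (D w) = tangentCoord (c n) (f^[n] (chartPoint d (c 0) x (B 0) (T u)))
      (mfderiv (𝓡 d) (𝓡 d) f^[n] (chartPoint d (c 0) x (B 0) (T u))
        (tangentCoordSymm (c 0) (chartPoint d (c 0) x (B 0) (T u)) ((B 0).symm (T w)))) := by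
  have hδr := hcc.δ_lt
  have hcont : ∀ j ≤ n, ContinuousAt (X.orbit T j) u := fun j hj ↦
    (X.hasFDerivAt_orbit hcc hT fun i hi ↦ hu i (hi.le.trans hj)).continuousAt
  have hev : ∀ᶠ u' in 𝓝 u, (∀ i < n, ‖X.orbit T i u'‖ < r / (2 * K ^ 3)) ∧
      extChartAt (𝓡 d) (c 0) x + (B 0).symm (T u') ∈ (extChartAt (𝓡 d) (c 0)).target := by
    refine Filter.Eventually.and ?_ ?_
    · refine (Filter.eventually_all_finite (Set.finite_lt_nat n)).2 fun i hi ↦ ?_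
      exact (hcont i (le_of_lt hi)).norm.eventually_lt_const ((hu i (le_of_lt hi)).trans_lt hδr)
    · have hct : Continuous fun u' ↦ extChartAt (𝓡 d) (c 0) x + (B 0).symm (T u') := by fun_prop
      exact hct.continuousAt.eventually ((isOpen_extChartAt_target (I := 𝓡 d) (c 0)).mem_nhds htar)
  have hfd : MDifferentiable (𝓡 d) (𝓡 d) f := f.contMDiff.mdifferentiable one_ne_zero
  have hfn : ∀ n, MDifferentiable (𝓡 d) (𝓡 d) f^[n] := fun n ↦ by
    induction n with
    | zero => exact mdifferentiable_id
    | succ n ih => rw [Function.iterate_succ']; exact hfd.comp ih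
  have h0 := (orbit_eq hX htar fun i hi ↦ (hu i hi.le).trans_lt hδr).1
  have hι : HasFDerivAt (fun u' ↦ extChartAt (𝓡 d) (c 0) x + (B 0).symm (T u'))
      (((B 0).symm : 𝔼[k] × 𝔼[l] →L[ℝ] 𝔼[d]) ∘L T) u :=
    (((B 0).symm : 𝔼[k] × 𝔼[l] →L[ℝ] 𝔼[d]) ∘L T).hasFDerivAt.const_add _
  have h1 := (hasMFDerivAt_extChartAt_symm htar).comp u hι.hasMFDerivAt
  have h2 := ((hfn n) (chartPoint d (c 0) x (B 0) (T u))).hasMFDerivAt.comp u h1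
  have h3 := (hasMFDerivAt_extChartAt_tangentCoord h0).comp u h2
  have h4 := h3.hasFDerivAt
  have h5 : HasFDerivAt (fun u' ↦ extChartAt (𝓡 d) (c n) (f^[n] x) + (B n).symm (X.orbit T n u'))
      (((B n).symm : 𝔼[k] × 𝔼[l] →L[ℝ] 𝔼[d]) ∘L D) u :=
    (((B n).symm : 𝔼[k] × 𝔼[l] →L[ℝ] 𝔼[d]).hasFDerivAt.comp u hD).const_add _
  have h6 := h5.unique (h4.congr_of_eventuallyEq ?_)
  · exact DFunLike.congr_fun h6 w
  · filter_upwards [hev] with u' hu'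
    obtain ⟨h7, h8⟩ := orbit_eq hX hu'.2 hu'.1
    rw [h8, ContinuousLinearEquiv.symm_apply_apply, add_sub_cancel]
    rfl

end Orbit

end IsChartSystem

end InitialDisk

/-! ### Hyperbolic balls -/

/-- The radius `δ` can be chosen so small that the nonlinearity costs at most `c` in the logarithms
of the rates. -/
lemma exists_chainConstants {α C K r lam c : ℝ} (hα : 0 < α) (hC : 0 ≤ C) (hK : 1 ≤ K) (hr : 0 < r)
    (hlam : 0 < lam) (hlam1 : lam < 1) (hc : 0 < c) :
    ∃ δ ε, ChainConstants α C K r lam δ ε ∧ Real.log (1 - ε * K)⁻¹ ≤ c := by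
  have hK0 : 0 < K := by linarith
  have hexp : 0 < 1 - Real.exp (-c) := by
    have : Real.exp (-c) < 1 := by
      rw [← Real.exp_zero]
      exact Real.exp_lt_exp.2 (by linarith)
    linarith
  have h1l : 0 < 1 - lam := by linarith
  set ε := min (1 / (2 * K)) (min ((1 - lam) / (12 * K ^ 3)) ((1 - Real.exp (-c)) / K)) with hε
  have hε0 : 0 < ε := by positivity
  have hε1 : ε * K ≤ 1 / 2 := by
    have h : ε ≤ 1 / (2 * K) := min_le_left _ _
    calc ε * K ≤ 1 / (2 * K) * K := by gcongr
      _ = 1 / 2 := by field_simp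
  have hε2 : 6 * K ^ 3 * ε ≤ (1 - lam) / 2 := by
    have h : ε ≤ (1 - lam) / (12 * K ^ 3) := (min_le_right _ _).trans (min_le_left _ _)
    calc 6 * K ^ 3 * ε ≤ 6 * K ^ 3 * ((1 - lam) / (12 * K ^ 3)) := by gcongr
      _ = (1 - lam) / 2 := by field_simp; norm_num
  have hε3 : ε * K ≤ 1 - Real.exp (-c) := by
    have h : ε ≤ (1 - Real.exp (-c)) / K := (min_le_right _ _).trans (min_le_right _ _)
    rwa [le_div_iff₀ hK0] at h
  set q := ε / (K ^ 2 * (C + 1)) with hq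
  have hq0 : 0 < q := by positivity
  have hδ0 : 0 < min (r / 2) (q ^ (1 / α)) := by positivity
  refine ⟨min (r / 2) (q ^ (1 / α)), ε, ⟨hα, hC, hK, hlam, hδ0,
    (min_le_left _ _).trans_lt (by linarith), hε0, ?_, hε1, by linarith⟩, ?_⟩
  · have h1 : min (r / 2) (q ^ (1 / α)) ^ α ≤ q := by
      calc min (r / 2) (q ^ (1 / α)) ^ α ≤ (q ^ (1 / α)) ^ α := by
            gcongr
            exact min_le_right _ _
        _ = q := by rw [← Real.rpow_mul hq0.le, one_div_mul_cancel hα.ne', Real.rpow_one]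
    calc K ^ 2 * (C * min (r / 2) (q ^ (1 / α)) ^ α) ≤ K ^ 2 * ((C + 1) * q) := by
          gcongr
          linarith
      _ = ε := by rw [hq]; field_simp
  · rw [Real.log_inv]
    have h1 : -c ≤ Real.log (1 - ε * K) := by
      rw [Real.le_log_iff_exp_le (by linarith)]
      linarith
    linarith

namespace DominatedChain

section HypBall

variable {U V : Type*} [NormedAddCommGroup U] [NormedSpace ℝ U]
    [NormedAddCommGroup V] [NormedSpace ℝ V] {α C K r lam δ ε σ ρ : ℝ}
    (X : DominatedChain U V α C K r lam)

/-- The set of points of the initial plane whose orbits of length `n` stay in the tube and end over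
the ball of radius `ρ`. At a hyperbolic time this is a neighbourhood of the origin whose size is
exponentially small, and which is mapped with bounded distortion onto that ball. -/
def hypBall (T : U →L[ℝ] U × V) (δ : ℝ) (n : ℕ) (ρ : ℝ) : Set U :=
  {u ∈ X.tube T δ n | ‖(X.orbit T n u).1‖ ≤ ρ}

variable {X} {T : U →L[ℝ] U × V} (hc : ChainConstants α C K r lam δ ε) (hT : X.IsInitialPlane T)
include hc hT

omit hT in
lemma zero_mem_hypBall (hρ : 0 ≤ ρ) (n : ℕ) : 0 ∈ X.hypBall T δ n ρ := by
  refine ⟨X.zero_mem_tube T hc.δ_pos.le n, ?_⟩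
  rw [X.orbit_apply_zero]
  simpa using hρ

lemma norm_le_of_mem_hypBall {n : ℕ} (hn : X.IsHyperbolicTime ε σ n) (hσ0 : 0 ≤ σ) {u : U}
    (hu : u ∈ X.hypBall T δ n ρ) : ‖u‖ ≤ K * ρ * σ ^ n := by
  have h := norm_sub_le_of_mem_tube hc hT hn hu.1 (X.zero_mem_tube T hc.δ_pos.le n)
  rw [sub_zero, X.orbit_apply_zero, sub_zero] at h
  have hK := hc.one_le_K
  calc ‖u‖ ≤ K * (σ ^ n * ‖(X.orbit T n u).1‖) := h
    _ ≤ K * (σ ^ n * ρ) := by gcongr; exact hu.2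
    _ = _ := by ring

variable [FiniteDimensional ℝ U]

lemma hasFDerivAt_fst_orbit {n : ℕ} {u : U} (hu : u ∈ X.tube T δ n) :
    HasFDerivAt (fun u ↦ (X.orbit T n u).1) (X.jac T n u) u := by
  have h := X.hasFDerivAt_orbit hc hT fun j hj ↦ hu j hj.le
  exact ((ContinuousLinearMap.fst ℝ U V).hasFDerivAt.comp u h)

variable [Nontrivial U] (hσ0 : 0 < σ) (hσ1 : σ < 1)
include hσ0 hσ1

omit hc hT [FiniteDimensional ℝ U] [Nontrivial U] hσ0 hσ1 in
lemma image_closedBall_eq_hypBall {n : ℕ} {ψ : U → U} (hρ : ρ ≤ δ / K ^ 2)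
    (h1 : ∀ w ∈ Metric.closedBall (0 : U) (δ / K ^ 2),
        ψ w ∈ X.tube T δ n ∧ (X.orbit T n (ψ w)).1 = w)
    (h2 : ∀ u ∈ X.tube T δ n, ‖(X.orbit T n u).1‖ ≤ δ / K ^ 2 → ψ (X.orbit T n u).1 = u) :
    ψ '' Metric.closedBall 0 ρ = X.hypBall T δ n ρ := by
  ext u
  constructor
  · rintro ⟨w, hw, rfl⟩
    obtain ⟨h3, h4⟩ := h1 w (Metric.closedBall_subset_closedBall hρ hw)
    exact ⟨h3, by rw [h4]; exact mem_closedBall_zero_iff.1 hw⟩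
  · rintro ⟨h3, h4⟩
    exact ⟨(X.orbit T n u).1, mem_closedBall_zero_iff.2 h4, h2 u h3 (h4.trans hρ)⟩

lemma isCompact_hypBall {n : ℕ} (hn : X.IsHyperbolicTime ε σ n) (hρ : ρ ≤ δ / K ^ 2) :
    IsCompact (X.hypBall T δ n ρ) := by
  obtain ⟨ψ, -, h1, h2, h3, -⟩ := exists_inverse_branch hc hT hσ0 hσ1 hn
  rw [← image_closedBall_eq_hypBall hρ h1 h2]
  have hlip : LipschitzOnWith (K * σ ^ n).toNNReal ψ (Metric.closedBall 0 (δ / K ^ 2)) := by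
    refine LipschitzOnWith.of_dist_le_mul fun w hw w' hw' ↦ ?_
    have hK := hc.one_le_K
    rw [dist_eq_norm, dist_eq_norm, Real.coe_toNNReal _ (by positivity)]
    exact h3 w hw w' hw'
  exact (isCompact_closedBall _ _).image_of_continuousOn
    (hlip.continuousOn.mono (Metric.closedBall_subset_closedBall hρ))

/-- At a hyperbolic time, a hyperbolic ball is mapped onto a full ball of the base. -/
lemma image_hypBall {n : ℕ} (hn : X.IsHyperbolicTime ε σ n) (hρ : ρ ≤ δ / K ^ 2) :
    (fun u ↦ (X.orbit T n u).1) '' X.hypBall T δ n ρ = Metric.closedBall 0 ρ := by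
  obtain ⟨ψ, -, h1, h2, -⟩ := exists_inverse_branch hc hT hσ0 hσ1 hn
  ext w
  constructor
  · rintro ⟨u, hu, rfl⟩
    exact mem_closedBall_zero_iff.2 hu.2
  · intro hw
    obtain ⟨h3, h4⟩ := h1 w (Metric.closedBall_subset_closedBall hρ hw)
    exact ⟨ψ w, ⟨h3, by rw [h4]; exact mem_closedBall_zero_iff.1 hw⟩, h4⟩

variable [MeasurableSpace U] [BorelSpace U] (ν : Measure U) [ν.IsAddHaarMeasure]

omit hT [Nontrivial U] in
/-- Bounded distortion at hyperbolic times: the images under the iterates distort ratios of volumes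
by at most a constant factor. -/
lemma exists_distortion_bound :
    ∃ Q : ℝ≥0∞, Q ≠ 0 ∧ Q ≠ ⊤ ∧ ∀ (X : DominatedChain U V α C K r lam) (T : U →L[ℝ] U × V) (n : ℕ),
      X.IsInitialPlane T → X.IsHyperbolicTime ε σ n →
      ∀ s t : Set U, MeasurableSet s → MeasurableSet t → s ⊆ X.tube T δ n → t ⊆ X.tube T δ n →
        ν ((fun u ↦ (X.orbit T n u).1) '' s) * ν t ≤
          Q * (ν ((fun u ↦ (X.orbit T n u).1) '' t) * ν s) := by
  refine ⟨ENNReal.ofReal (Real.exp (Module.finrank ℝ U * (2 * K *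
      ((1 - (lam + 6 * K ^ 3 * ε))⁻¹ *
        (4 * K ^ 5 * variationConst α C K (2 * δ) * (1 - σ ^ α)⁻¹) +
        K ^ 2 * (variationConst α C K (2 * δ) * (1 - σ ^ α)⁻¹))))),
    (ENNReal.ofReal_pos.2 (Real.exp_pos _)).ne', ENNReal.ofReal_ne_top,
    fun X T n hT hn s t hs ht hsn htn ↦ ?_⟩
  exact measure_image_mul_le ν hs ht
    (fun x hx ↦ (hasFDerivAt_fst_orbit hc hT (hsn hx)).hasFDerivWithinAt)
    (fun x hx ↦ (hasFDerivAt_fst_orbit hc hT (htn hx)).hasFDerivWithinAt)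
    ((fst_orbit_injOn hc hT n).mono hsn) ((fst_orbit_injOn hc hT n).mono htn)
    fun x hx y hy ↦ abs_det_jac_le_mul hc hT hσ0 hσ1 hn (hsn hx) (htn hy)

lemma measure_hypBall_pos {n : ℕ} (hn : X.IsHyperbolicTime ε σ n) (hρ0 : 0 < ρ)
    (hρ : ρ ≤ δ / K ^ 2) : 0 < ν (X.hypBall T δ n ρ) := by
  refine pos_iff_ne_zero.2 fun h0 ↦ ?_
  have h1 : ν ((fun u ↦ (X.orbit T n u).1) '' X.hypBall T δ n ρ) = 0 :=
    addHaar_image_eq_zero_of_differentiableOn_of_addHaar_eq_zero ν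
      (fun u hu ↦ (hasFDerivAt_fst_orbit hc hT hu.1).differentiableAt.differentiableWithinAt) h0
  rw [image_hypBall hc hT hσ0 hσ1 hn hρ] at h1
  exact (Metric.measure_closedBall_pos ν _ hρ0).ne' h1

end HypBall

end DominatedChain

/-! ### Disks and the chains of their points -/

section OrbitChainStructure

variable {d : ℕ} {M : Type*} [EMetricSpace M] [ChartedSpace (EuclideanSpace ℝ (Fin d)) M]
  [IsManifold (𝓡 d) ∞ M] [RiemannianBundle (fun x : M ↦ TangentSpace (𝓡 d) x)]

/-- Charts and adapted coordinates along the orbit of `x`, starting with the chart at `c₀`, together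
with the dominated chain of that orbit in these coordinates. -/
structure OrbitChain (f : M ≃ₘ^1⟮𝓡 d, 𝓡 d⟯ M)
    (Ecs Ecu : ∀ x : M, Submodule ℝ (TangentSpace (𝓡 d) x))
    (N : ∀ x : M, Seminorm ℝ (TangentSpace (𝓡 d) x)) (α : ℝ) (Z : Set M) (dom : M → Set M)
    (r K lam : ℝ) (k l : ℕ) (c₀ x : M) where
  c : ℕ → M
  B : ℕ → 𝔼[d] ≃L[ℝ] 𝔼[k] × 𝔼[l]
  X : DominatedChain 𝔼[k] 𝔼[l] α ((2 * K ^ 3) ^ 4) (2 * K ^ 3) (r / (2 * K ^ 3)) lam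
  c_zero : c 0 = c₀
  mem : ∀ j, c j ∈ Z
  mem_dom : ∀ j, f^[j] x ∈ dom (c j)
  adapted : ∀ j, IsAdapted Ecs Ecu (2 * K ^ 3) (c j) (f^[j] x) (B j)
  semiconj : ∀ j p, ‖p‖ < r / (2 * K ^ 3) →
        f (chartPoint d (c j) (f^[j] x) (B j) p) ∈ (extChartAt (𝓡 d) (c (j + 1))).source ∧
        X.f j p = B (j + 1) (extChartAt (𝓡 d) (c (j + 1))
          (f (chartPoint d (c j) (f^[j] x) (B j) p)) -
            extChartAt (𝓡 d) (c (j + 1)) (f^[j + 1] x))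
  rate : ∀ j, X.m j = normDerivOn f.symm Ecu (f^[j + 1] x)
  NU_zero : ∀ u, X.NU 0 u = N x (tangentCoordSymm (c 0) x ((B 0).symm (u, 0)))
  NV_zero : ∀ v, X.NV 0 v = N x (tangentCoordSymm (c 0) x ((B 0).symm (0, v)))

variable {k l : ℕ} {f : M ≃ₘ^1⟮𝓡 d, 𝓡 d⟯ M} {Λ : Set M}
  {Ecs Ecu : ∀ x : M, Submodule ℝ (TangentSpace (𝓡 d) x)}
  {N : ∀ x : M, Seminorm ℝ (TangentSpace (𝓡 d) x)} {α : ℝ} {Z : Set M} {dom : M → Set M}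
  {r K lam : ℝ}

omit [RiemannianBundle (fun x : M ↦ TangentSpace (𝓡 d) x)] in
lemma IsDominatedSplitting.finrank_iterate (hΛ : IsDominatedSplitting f Λ Ecs Ecu) {x : M}
    (hx : x ∈ Λ) (j : ℕ) : f^[j] x ∈ Λ ∧
      Module.finrank ℝ (Ecu (f^[j] x)) = Module.finrank ℝ (Ecu x) ∧
      Module.finrank ℝ (Ecs (f^[j] x)) = Module.finrank ℝ (Ecs x) := by
  induction j with
  | zero => exact ⟨hx, rfl, rfl⟩
  | succ j ih =>
    obtain ⟨h1, h2, h3⟩ := ih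
    have hinj : Function.Injective (mfderiv (𝓡 d) (𝓡 d) f (f^[j] x)) := by
      rw [injective_iff_map_eq_zero]
      intro v hv
      have h := seminorm_mfderiv_symm_mfderiv f
        (fun y ↦ normSeminorm ℝ 𝔼[d]) (f^[j] x) v
      rw [hv, map_zero] at h
      exact (norm_eq_zero (E := 𝔼[d]) (a := v)).1 (h.symm.trans (norm_zero (E := 𝔼[d])))
    rw [Function.iterate_succ_apply', ← hΛ.invariant_cu _ h1, ← hΛ.invariant_cs _ h1, ← h2, ← h3]
    exact ⟨hΛ.mapsTo h1, (Submodule.equivMapOfInjective _ hinj _).finrank_eq.symm,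
      (Submodule.equivMapOfInjective _ hinj _).finrank_eq.symm⟩

lemma IsChartSystem.exists_orbitChain (hCS : IsChartSystem f Λ Ecs Ecu N α Z dom r K)
    (hα₀ : 0 < α) (hα₁ : α ≤ 1) (hΛ : IsDominatedSplitting f Λ Ecs Ecu)
    {μ : M → ℝ} (hμ : ∀ x, 0 ≤ μ x)
    (hdom : ∀ x ∈ Λ, (∀ v ∈ Ecs x, N (f x) (mfderiv (𝓡 d) (𝓡 d) f x v) ≤ μ x * N x v) ∧
        (∀ v ∈ Ecu x, μ x * N x v ≤ lam * N (f x) (mfderiv (𝓡 d) (𝓡 d) f x v)))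
    [Nontrivial 𝔼[k]] {c₀ x : M} (hc₀ : c₀ ∈ Z) (hx : x ∈ dom c₀)
    (hk : Module.finrank ℝ (Ecu x) = k) (hl : Module.finrank ℝ (Ecs x) = l) :
    Nonempty (OrbitChain f Ecs Ecu N α Z dom r K lam k l c₀ x) := by
  have hxΛ := hCS.subset c₀ hc₀ hx
  have H : ∀ j, ∃ c, (j = 0 → c = c₀) ∧ c ∈ Z ∧ f^[j] x ∈ dom c := by
    intro j
    rcases Nat.eq_zero_or_pos j with rfl | hj
    · exact ⟨c₀, fun _ ↦ rfl, hc₀, hx⟩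
    · have hj' := (hΛ.finrank_iterate hxΛ j).1
      obtain ⟨c, hc, h⟩ := hCS.exists_center _ hj'
      exact ⟨c, fun h0 ↦ absurd h0 hj.ne', hc, mem_of_mem_nhdsWithin hj' h⟩
  choose c h0 hc hcx using H
  choose B hB using fun j ↦ hCS.exists_isAdapted (k := k) (l := l) hΛ.isCompl (hc j) (hcx j)
    ((hΛ.finrank_iterate hxΛ j).2.1.trans hk) ((hΛ.finrank_iterate hxΛ j).2.2.trans hl)
  obtain ⟨X, h1, h2, h3, h4⟩ := hCS.exists_dominatedChain hα₀ hα₁ hΛ hμ hdom hc hcx hB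
  exact ⟨⟨c, B, X, h0 0 rfl, hc, hcx, hB, h1, h2, h3, h4⟩⟩

namespace OrbitChain

variable {c₀ p : M} {Bp : 𝔼[d] ≃L[ℝ] 𝔼[k] × 𝔼[l]} {v₀ : 𝔼[l]} {u₀ : 𝔼[k]}

/-- The centre-unstable plane of the coordinates `Bp`, in the initial coordinates of the chain. -/
def plane {x : M} (O : OrbitChain f Ecs Ecu N α Z dom r K lam k l c₀ x)
    (Bp : 𝔼[d] ≃L[ℝ] 𝔼[k] × 𝔼[l]) : 𝔼[k] →L[ℝ] 𝔼[k] × 𝔼[l] :=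
  (O.B 0 : 𝔼[d] →L[ℝ] 𝔼[k] × 𝔼[l]) ∘L
      (Bp.symm : 𝔼[k] × 𝔼[l] →L[ℝ] 𝔼[d]) ∘L ContinuousLinearMap.inl ℝ 𝔼[k] 𝔼[l]

lemma symm_plane {x : M} (O : OrbitChain f Ecs Ecu N α Z dom r K lam k l c₀ x) (u : 𝔼[k]) :
    (O.B 0).symm (O.plane Bp u) = Bp.symm (u, 0) :=
  (O.B 0).symm_apply_apply _

variable (O : OrbitChain f Ecs Ecu N α Z dom r K lam k l c₀ (chartPoint d c₀ p Bp (u₀, v₀)))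

section Basic

variable (hu₀ : extChartAt (𝓡 d) c₀ p + Bp.symm (u₀, v₀) ∈ (extChartAt (𝓡 d) c₀).target)
include hu₀

lemma extChartAt_add_symm_plane (u : 𝔼[k]) :
    extChartAt (𝓡 d) (O.c 0) (chartPoint d c₀ p Bp (u₀, v₀)) + (O.B 0).symm (O.plane Bp (u - u₀)) =
      extChartAt (𝓡 d) c₀ p + Bp.symm (u, v₀) := by
  rw [O.c_zero, symm_plane, chartPoint, (extChartAt (𝓡 d) c₀).right_inv hu₀, add_assoc, ← map_add]
  simp

lemma chartPoint_plane (u : 𝔼[k]) :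
    chartPoint d (O.c 0) (chartPoint d c₀ p Bp (u₀, v₀)) (O.B 0) (O.plane Bp (u - u₀)) =
      chartPoint d c₀ p Bp (u, v₀) := by
  conv_lhs => rw [chartPoint, O.extChartAt_add_symm_plane hu₀, O.c_zero]
  rfl

lemma mem_target_of_norm_lt (hCS : IsChartSystem f Λ Ecs Ecu N α Z dom r K) {u : 𝔼[k]}
    (hu : ‖O.plane Bp (u - u₀)‖ < r / (2 * K ^ 3)) :
    extChartAt (𝓡 d) c₀ p + Bp.symm (u, v₀) ∈ (extChartAt (𝓡 d) c₀).target := by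
  have h := hCS.ball_subset _ (O.mem 0) _ (O.mem_dom 0) (hCS.mem_ball_of_norm_lt (O.adapted 0) hu)
  rw [Function.iterate_zero, id, O.extChartAt_add_symm_plane hu₀, O.c_zero] at h
  exact h

/-- The orbit of a point of the disk in the coordinates along the orbit of another point. -/
lemma iterate_eq {u : 𝔼[k]}
    (hu : extChartAt (𝓡 d) c₀ p + Bp.symm (u, v₀) ∈ (extChartAt (𝓡 d) c₀).target) {j : ℕ}
    (hj : ∀ i < j, ‖O.X.orbit (O.plane Bp) i (u - u₀)‖ < r / (2 * K ^ 3)) :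
    f^[j] (chartPoint d c₀ p Bp (u, v₀)) ∈ (extChartAt (𝓡 d) (O.c j)).source ∧
    O.X.orbit (O.plane Bp) j (u - u₀) =
      O.B j (extChartAt (𝓡 d) (O.c j) (f^[j] (chartPoint d c₀ p Bp (u, v₀))) -
        extChartAt (𝓡 d) (O.c j) (f^[j] (chartPoint d c₀ p Bp (u₀, v₀)))) := by
  have htar : extChartAt (𝓡 d) (O.c 0) (chartPoint d c₀ p Bp (u₀, v₀)) +
      (O.B 0).symm (O.plane Bp (u - u₀)) ∈ (extChartAt (𝓡 d) (O.c 0)).target := by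
    rw [O.extChartAt_add_symm_plane hu₀, O.c_zero]; exact hu
  have h := IsChartSystem.orbit_eq O.semiconj htar hj
  rwa [O.chartPoint_plane hu₀] at h

lemma chartPoint_orbit {u : 𝔼[k]}
    (hu : extChartAt (𝓡 d) c₀ p + Bp.symm (u, v₀) ∈ (extChartAt (𝓡 d) c₀).target) {j : ℕ}
    (hj : ∀ i < j, ‖O.X.orbit (O.plane Bp) i (u - u₀)‖ < r / (2 * K ^ 3)) :
    chartPoint d (O.c j) (f^[j] (chartPoint d c₀ p Bp (u₀, v₀))) (O.B j)
      (O.X.orbit (O.plane Bp) j (u - u₀)) = f^[j] (chartPoint d c₀ p Bp (u, v₀)) := by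
  obtain ⟨h1, h2⟩ := O.iterate_eq hu₀ hu hj
  conv_lhs => rw [h2]
  rw [chartPoint, ContinuousLinearEquiv.symm_apply_apply, add_sub_cancel,
    (extChartAt (𝓡 d) (O.c j)).left_inv h1]

end Basic

variable (hCS : IsChartSystem f Λ Ecs Ecu N α Z dom r K)
include hCS

section Tube

variable {δ ε σ : ℝ} (hcc : ChainConstants α ((2 * K ^ 3) ^ 4) (2 * K ^ 3) (r / (2 * K ^ 3)) lam δ ε)
  (hu₀ : extChartAt (𝓡 d) c₀ p + Bp.symm (u₀, v₀) ∈ (extChartAt (𝓡 d) c₀).target)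
include hcc hu₀

lemma mem_target_of_mem_tube {u : 𝔼[k]} {n : ℕ} (hu : u - u₀ ∈ O.X.tube (O.plane Bp) δ n) :
    extChartAt (𝓡 d) c₀ p + Bp.symm (u, v₀) ∈ (extChartAt (𝓡 d) c₀).target :=
  O.mem_target_of_norm_lt hu₀ hCS ((hu 0 (Nat.zero_le _)).trans_lt hcc.δ_lt)

lemma chartPoint_orbit_of_mem_tube {u : 𝔼[k]} {n j : ℕ} (hj : j ≤ n)
    (hu : u - u₀ ∈ O.X.tube (O.plane Bp) δ n) :
    chartPoint d (O.c j) (f^[j] (chartPoint d c₀ p Bp (u₀, v₀))) (O.B j)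
      (O.X.orbit (O.plane Bp) j (u - u₀)) = f^[j] (chartPoint d c₀ p Bp (u, v₀)) :=
  O.chartPoint_orbit hu₀ (O.mem_target_of_mem_tube hCS hcc hu₀ hu) fun i hi ↦
    (hu i (hi.le.trans hj)).trans_lt hcc.δ_lt

/-- Before a hyperbolic time, the distances between the points of a hyperbolic ball contract
exponentially in the past. -/
lemma edist_iterate_le (hT : O.X.IsInitialPlane (O.plane Bp)) {n j : ℕ}
    (hn : O.X.IsHyperbolicTime ε σ n) (hσ0 : 0 ≤ σ) (hj : j ≤ n) {ρ : ℝ} {u u' : 𝔼[k]}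
    (hu : u - u₀ ∈ O.X.hypBall (O.plane Bp) δ n ρ)
    (hu' : u' - u₀ ∈ O.X.hypBall (O.plane Bp) δ n ρ) :
    edist (f^[j] (chartPoint d c₀ p Bp (u, v₀))) (f^[j] (chartPoint d c₀ p Bp (u', v₀))) ≤
      ENNReal.ofReal (2 * (2 * K ^ 3) ^ 4 * ρ * σ ^ (n - j)) := by
  rw [← O.chartPoint_orbit_of_mem_tube hCS hcc hu₀ hj hu.1,
    ← O.chartPoint_orbit_of_mem_tube hCS hcc hu₀ hj hu'.1]
  have hball : ∀ {v : 𝔼[k]}, v ∈ O.X.hypBall (O.plane Bp) δ n ρ → _ := fun {v} hv ↦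
    hCS.mem_ball_of_norm_lt (O.adapted j) ((hv.1 j hj).trans_lt hcc.δ_lt)
  refine (hCS.edist_le _ (O.mem j) _ (O.mem_dom j) _ (hball hu) _ (hball hu')).trans
    (ENNReal.ofReal_le_ofReal ?_)
  rw [add_sub_add_left_eq_sub, ← map_sub]
  have hL := hcc.one_le_K
  have hK := hCS.le_two_mul
  have hK1 := hCS.one_le_K
  set L := 2 * K ^ 3
  have h1 := DominatedChain.norm_orbit_sub_le hcc hT hn hj hu.1 hu'.1
  have h2 : ‖(O.X.orbit (O.plane Bp) n (u - u₀) - O.X.orbit (O.plane Bp) n (u' - u₀)).1‖ ≤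
      2 * ρ := by
    rw [Prod.fst_sub]
    refine (norm_sub_le _ _).trans ?_
    have h3 := hu.2
    have h4 := hu'.2
    linarith
  calc _ ≤ L * (L * (L ^ 2 * (σ ^ (n - j) * (2 * ρ)))) := by
        gcongr
        exact ((O.adapted j).norm_symm_le _).trans (by gcongr; exact h1.trans (by gcongr))
    _ = _ := by ring

omit hcc hu₀ in
lemma isInitialPlane (hΛ : IsDominatedSplitting f Λ Ecs Ecu) (hp : p ∈ dom c₀)
    (hBp : IsAdapted Ecs Ecu (2 * K ^ 3) c₀ p Bp)
    (hnear : ∀ v, ‖splittingProj Ecu Ecs c₀ (chartPoint d c₀ p Bp (u₀, v₀)) v -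
      splittingProj Ecu Ecs c₀ p v‖ ≤ 1 / (2 * K ^ 2) * ‖v‖) :
    O.X.IsInitialPlane (O.plane Bp) := by
  have e := O.c_zero
  exact hCS.isInitialPlane O.mem O.mem_dom hΛ.isCompl (O.adapted 0) O.NU_zero O.NV_zero
    (p := p) (by rwa [e]) (Bp := Bp) (by rwa [e]) (by rwa [e])

end Tube

end OrbitChain

end OrbitChainStructure

/-! ### Measures and tangent planes along hyperbolic balls -/

namespace DominatedChain

section Volume

variable {U V : Type*} [NormedAddCommGroup U] [NormedSpace ℝ U]
    [NormedAddCommGroup V] [NormedSpace ℝ V] {α C K r lam δ ε σ ρ : ℝ}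
    {X : DominatedChain U V α C K r lam} {T : U →L[ℝ] U × V}
    (hc : ChainConstants α C K r lam δ ε) (hT : X.IsInitialPlane T)
    [FiniteDimensional ℝ U] [Nontrivial U] [MeasurableSpace U] [BorelSpace U] (ν : Measure U)
    [ν.IsAddHaarMeasure] (hσ0 : 0 < σ) (hσ1 : σ < 1) {n : ℕ} (hn : X.IsHyperbolicTime ε σ n)
    {Q : ℝ≥0∞}
    (hQ : ∀ s t : Set U, MeasurableSet s → MeasurableSet t → s ⊆ X.tube T δ n → t ⊆ X.tube T δ n →
        ν ((fun u ↦ (X.orbit T n u).1) '' s) * ν t ≤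
          Q * (ν ((fun u ↦ (X.orbit T n u).1) '' t) * ν s))
include hc hT hσ0 hσ1 hn hQ

/-- By bounded distortion, enlarging a hyperbolic ball multiplies its measure by a bounded factor. -/
lemma measure_hypBall_le {ρ' : ℝ} (hρ : ρ ≤ δ / K ^ 2) (hρ0 : 0 < ρ) (hρ' : ρ' ≤ δ / K ^ 2) :
    ν (X.hypBall T δ n ρ') ≤
      Q * ν (Metric.closedBall 0 ρ') * (ν (Metric.closedBall 0 ρ))⁻¹ * ν (X.hypBall T δ n ρ) := by
  have h := hQ (X.hypBall T δ n ρ) (X.hypBall T δ n ρ')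
    (isCompact_hypBall hc hT hσ0 hσ1 hn hρ).measurableSet
    (isCompact_hypBall hc hT hσ0 hσ1 hn hρ').measurableSet (fun u hu ↦ hu.1) (fun u hu ↦ hu.1)
  rw [image_hypBall hc hT hσ0 hσ1 hn hρ, image_hypBall hc hT hσ0 hσ1 hn hρ'] at h
  have h1 : ν (Metric.closedBall (0 : U) ρ) ≠ 0 := (Metric.measure_closedBall_pos ν _ hρ0).ne'
  have h2 : ν (Metric.closedBall (0 : U) ρ) ≠ ⊤ := measure_closedBall_lt_top.ne
  calc ν (X.hypBall T δ n ρ') = (ν (Metric.closedBall 0 ρ))⁻¹ *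
        (ν (Metric.closedBall 0 ρ) * ν (X.hypBall T δ n ρ')) := by
        rw [← mul_assoc, ENNReal.inv_mul_cancel h1 h2, one_mul]
    _ ≤ (ν (Metric.closedBall 0 ρ))⁻¹ *
        (Q * (ν (Metric.closedBall 0 ρ') * ν (X.hypBall T δ n ρ))) := by gcongr
    _ = _ := by ring

/-- By bounded distortion, a subset of small relative measure of a hyperbolic ball has an image of
small measure. -/
lemma measure_image_le (hρ : ρ ≤ δ / K ^ 2) (hρ0 : 0 < ρ) {η : ℝ≥0∞} {s : Set U}
    (hs : MeasurableSet s) (hsub : s ⊆ X.hypBall T δ n ρ)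
    (hη : ν s ≤ η * ν (X.hypBall T δ n ρ)) :
    ν ((fun u ↦ (X.orbit T n u).1) '' s) ≤ Q * ν (Metric.closedBall 0 ρ) * η := by
  have hcomp := isCompact_hypBall hc hT hσ0 hσ1 hn hρ
  have h := hQ s (X.hypBall T δ n ρ) hs hcomp.measurableSet (fun u hu ↦ (hsub hu).1)
    (fun u hu ↦ hu.1)
  rw [image_hypBall hc hT hσ0 hσ1 hn hρ] at h
  have h1 : ν (X.hypBall T δ n ρ) ≠ 0 := (measure_hypBall_pos hc hT hσ0 hσ1 ν hn hρ0 hρ).ne'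
  have h2 : ν (X.hypBall T δ n ρ) ≠ ⊤ := hcomp.measure_lt_top.ne
  refine (ENNReal.mul_le_mul_iff_left h1 h2).1 (h.trans ?_)
  calc _ ≤ Q * (ν (Metric.closedBall 0 ρ) * (η * ν (X.hypBall T δ n ρ))) := by gcongr
    _ = _ := by ring

end Volume

end DominatedChain

section Nesting

variable {d : ℕ} {M : Type*} [EMetricSpace M] [ChartedSpace (EuclideanSpace ℝ (Fin d)) M]
  [IsManifold (𝓡 d) ∞ M] [RiemannianBundle (fun x : M ↦ TangentSpace (𝓡 d) x)]

variable {k l : ℕ} {f : M ≃ₘ^1⟮𝓡 d, 𝓡 d⟯ M} {Λ : Set M}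
  {Ecs Ecu : ∀ x : M, Submodule ℝ (TangentSpace (𝓡 d) x)}
  {N : ∀ x : M, Seminorm ℝ (TangentSpace (𝓡 d) x)} {α : ℝ} {Z : Set M} {dom : M → Set M}
  {r K lam : ℝ}

namespace OrbitChain

variable {c₀ p : M} {Bp : 𝔼[d] ≃L[ℝ] 𝔼[k] × 𝔼[l]} {v₀ : 𝔼[l]} {u₀ u₁ : 𝔼[k]}

variable (O : OrbitChain f Ecs Ecu N α Z dom r K lam k l c₀ (chartPoint d c₀ p Bp (u₀, v₀)))
  (O' : OrbitChain f Ecs Ecu N α Z dom r K lam k l c₀ (chartPoint d c₀ p Bp (u₁, v₀)))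
  (hCS : IsChartSystem f Λ Ecs Ecu N α Z dom r K)
  {δ ε σ : ℝ} (hcc : ChainConstants α ((2 * K ^ 3) ^ 4) (2 * K ^ 3) (r / (2 * K ^ 3)) lam δ ε)
  (hu₀ : extChartAt (𝓡 d) c₀ p + Bp.symm (u₀, v₀) ∈ (extChartAt (𝓡 d) c₀).target)
  (hu₁ : extChartAt (𝓡 d) c₀ p + Bp.symm (u₁, v₀) ∈ (extChartAt (𝓡 d) c₀).target)
include hCS hcc hu₀

include hu₁ in
/-- Small hyperbolic balls of later times which meet a small hyperbolic ball are contained in the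
large hyperbolic ball. -/
lemma mem_hypBall_of_inter (hT : O.X.IsInitialPlane (O.plane Bp))
    (hT' : O'.X.IsInitialPlane (O'.plane Bp)) (hσ0 : 0 ≤ σ) (hσ1 : σ ≤ 1) {n m : ℕ}
    (hn : O.X.IsHyperbolicTime ε σ n) (hm : O'.X.IsHyperbolicTime ε σ m) (hmn : m ≤ n)
    {ρ η : ℝ} (hρ0 : 0 ≤ ρ) (hρη : 4 * (2 * K ^ 3) ^ 4 * ρ < η)
    (hη : ∀ c ∈ Z, ∀ x ∈ dom c, ∀ y, edist y x < ENNReal.ofReal η →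
      y ∈ (extChartAt (𝓡 d) c).source ∧ ‖extChartAt (𝓡 d) c y - extChartAt (𝓡 d) c x‖ <
        δ / (2 * K ^ 3) ^ 2 / (2 * K ^ 3))
    {u u' : 𝔼[k]} (hu : u - u₀ ∈ O.X.hypBall (O.plane Bp) δ n ρ)
    (hu1 : u - u₁ ∈ O'.X.hypBall (O'.plane Bp) δ m ρ)
    (hu' : u' - u₀ ∈ O.X.hypBall (O.plane Bp) δ n ρ) :
    u' - u₁ ∈ O'.X.hypBall (O'.plane Bp) δ m (δ / (2 * K ^ 3) ^ 2) := by
  have hL := hcc.one_le_K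
  have hδr := hcc.δ_lt
  have hδ0 := hcc.δ_pos
  have htar := O.mem_target_of_mem_tube hCS hcc hu₀ hu'.1
  have hdist : ∀ s ≤ m, edist (f^[s] (chartPoint d c₀ p Bp (u', v₀)))
      (f^[s] (chartPoint d c₀ p Bp (u₁, v₀))) < ENNReal.ofReal η := by
    intro s hs
    have h1 := O.edist_iterate_le hCS hcc hu₀ hT hn hσ0 (hs.trans hmn) hu' hu
    have h0 : u₁ - u₁ ∈ O'.X.hypBall (O'.plane Bp) δ m ρ := by
      rw [sub_self]; exact DominatedChain.zero_mem_hypBall hcc hρ0 m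
    have h2 := O'.edist_iterate_le hCS hcc hu₁ hT' hm hσ0 hs hu1 h0
    have h3 : ∀ i, 2 * (2 * K ^ 3) ^ 4 * ρ * σ ^ i ≤ 2 * (2 * K ^ 3) ^ 4 * ρ := fun i ↦
      mul_le_of_le_one_right (by positivity) (pow_le_one₀ hσ0 hσ1)
    refine (edist_triangle _ (f^[s] (chartPoint d c₀ p Bp (u, v₀))) _).trans_lt ?_
    refine (add_le_add (h1.trans (ENNReal.ofReal_le_ofReal (h3 _)))
      (h2.trans (ENNReal.ofReal_le_ofReal (h3 _)))).trans_lt ?_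
    rw [← ENNReal.ofReal_add (by positivity) (by positivity)]
    refine (ENNReal.ofReal_lt_ofReal_iff (lt_of_le_of_lt (by positivity) hρη)).2 ?_
    linarith
  set L := 2 * K ^ 3 with hLdef
  have hδ1 : δ / L ^ 2 ≤ δ := div_le_self hδ0.le (one_le_pow₀ hL)
  have horb : ∀ s ≤ m, ‖O'.X.orbit (O'.plane Bp) s (u' - u₁)‖ ≤ δ / L ^ 2 := by
    intro s
    induction s using Nat.strong_induction_on with
    | _ s ih =>
      intro hs
      obtain ⟨-, h2⟩ := O'.iterate_eq hu₁ htar (j := s)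
        fun i hi ↦ ((ih i hi (hi.le.trans hs)).trans hδ1).trans_lt hδr
      have h3 := (hη _ (O'.mem s) _ (O'.mem_dom s) _ (hdist s hs)).2
      rw [h2]
      calc _ ≤ L * (δ / L ^ 2 / L) := ((O'.adapted s).norm_le _).trans (by gcongr)
        _ = _ := by field_simp
  exact ⟨fun j hj ↦ (horb j hj).trans hδ1, (norm_fst_le _).trans (horb m le_rfl)⟩

/-- At the iterates of the points of `Λ` on the disk, the tangent spaces of the images of the disk
are close to the centre-unstable direction. -/
lemma norm_sub_splittingProj_le (hΛ : IsDominatedSplitting f Λ Ecs Ecu) (hlam : 0 ≤ lam)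
    {μ : M → ℝ} (hμ : ∀ x, 0 ≤ μ x)
    (hdom : ∀ x ∈ Λ, (∀ v ∈ Ecs x, N (f x) (mfderiv (𝓡 d) (𝓡 d) f x v) ≤ μ x * N x v) ∧
        (∀ v ∈ Ecu x, μ x * N x v ≤ lam * N (f x) (mfderiv (𝓡 d) (𝓡 d) f x v)))
    (hp : p ∈ dom c₀) (hBp : IsAdapted Ecs Ecu (2 * K ^ 3) c₀ p Bp)
    (hT : O.X.IsInitialPlane (O.plane Bp)) {n : ℕ} (hnlam : lam ^ n * K ^ 2 ≤ 1 / 2)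
    {u : 𝔼[k]} (hu : u - u₀ ∈ O.X.tube (O.plane Bp) δ n)
    (huΛ : chartPoint d c₀ p Bp (u, v₀) ∈ dom c₀)
    (hnear : ∀ v, ‖splittingProj Ecu Ecs c₀ (chartPoint d c₀ p Bp (u, v₀)) v -
      splittingProj Ecu Ecs c₀ p v‖ ≤ 1 / (2 * K ^ 2) * ‖v‖) (ξ : 𝔼[k]) :
    f^[n] (chartPoint d c₀ p Bp (u, v₀)) ∈ Λ ∧
    ‖(O.B n).symm (ξ, O.X.slope (O.plane Bp) n (u - u₀) ξ) -
      splittingProj Ecu Ecs (O.c n) (f^[n] (chartPoint d c₀ p Bp (u, v₀)))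
        ((O.B n).symm (ξ, O.X.slope (O.plane Bp) n (u - u₀) ξ))‖ ≤
      2 * K ^ 2 * lam ^ n * ‖(O.B n).symm (ξ, O.X.slope (O.plane Bp) n (u - u₀) ξ)‖ := by
  have hδr := hcc.δ_lt
  have hc₀ : c₀ ∈ Z := O.c_zero ▸ O.mem 0
  have hjac : ∀ j < n, ‖O.X.orbit (O.plane Bp) j (u - u₀)‖ ≤ δ := fun j hj ↦ hu j hj.le
  obtain ⟨w, rfl⟩ := (LinearMap.injective_iff_surjective
    (f := (O.X.jac (O.plane Bp) n (u - u₀)).toLinearMap)).1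
      (DominatedChain.jac_injective hcc hT hjac) ξ
  have htar := O.mem_target_of_mem_tube hCS hcc hu₀ hu
  have htar' : extChartAt (𝓡 d) (O.c 0) (chartPoint d c₀ p Bp (u₀, v₀)) +
      (O.B 0).symm (O.plane Bp (u - u₀)) ∈ (extChartAt (𝓡 d) (O.c 0)).target := by
    rw [O.extChartAt_add_symm_plane hu₀, O.c_zero]; exact htar
  have hD := DominatedChain.hasFDerivAt_orbit hcc hT hjac
  have key := IsChartSystem.tangentCoord_mfderiv_iterate O.semiconj hcc hT htar' hu hD w
  rw [O.chartPoint_plane hu₀, symm_plane, O.c_zero] at key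
  change (O.B n).symm (O.X.jac (O.plane Bp) n (u - u₀) w, O.X.slope (O.plane Bp) n (u - u₀)
    (O.X.jac (O.plane Bp) n (u - u₀) w)) = _ at key
  set z := chartPoint d c₀ p Bp (u, v₀) with hz
  set ξ₀ := Bp.symm (w, 0) with hξ₀
  have hzs := hCS.subset_source _ hc₀ huΛ
  have hps := hCS.subset_source _ hc₀ hp
  have hzΛ := hCS.subset _ hc₀ huΛ
  have hξ : splittingProj Ecu Ecs c₀ p ξ₀ = ξ₀ := by
    have h := splittingProj_of_mem (hΛ.isCompl p (hCS.subset _ hc₀ hp)).symm hps (hBp.symm_cu w)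
    rwa [tangentCoord_tangentCoordSymm hps] at h
  have hmem := tangentCoordSymm_splittingProj_mem (hΛ.isCompl z hzΛ).symm hzs ξ₀
  have hab := (hCS.seminorm_le_of_near hc₀ huΛ hnear hξ).2
  obtain ⟨h1, h2, h3, h4⟩ := hΛ.seminorm_iterate_le hlam hμ hdom hzΛ hmem.2 hmem.1 hab n
  refine ⟨h1, ?_⟩
  have hpt := O.chartPoint_orbit_of_mem_tube hCS hcc hu₀ le_rfl hu
  have hsn := hCS.seminorm_le _ (O.mem n) _ (O.mem_dom n) _
    (hCS.mem_ball_of_norm_lt (O.adapted n) ((hu n le_rfl).trans_lt hδr))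
  change ∀ v : TangentSpace (𝓡 d) (chartPoint d (O.c n) (f^[n] (chartPoint d c₀ p Bp (u₀, v₀)))
    (O.B n) (O.X.orbit (O.plane Bp) n (u - u₀))), ‖tangentCoord (O.c n) (chartPoint d (O.c n)
      (f^[n] (chartPoint d c₀ p Bp (u₀, v₀))) (O.B n) (O.X.orbit (O.plane Bp) n (u - u₀))) v‖ ≤
    K * N (chartPoint d (O.c n) (f^[n] (chartPoint d c₀ p Bp (u₀, v₀)))
    (O.B n) (O.X.orbit (O.plane Bp) n (u - u₀))) v ∧ N (chartPoint d (O.c n)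
      (f^[n] (chartPoint d c₀ p Bp (u₀, v₀)))
    (O.B n) (O.X.orbit (O.plane Bp) n (u - u₀))) v ≤ K * ‖tangentCoord (O.c n) (chartPoint d (O.c n)
      (f^[n] (chartPoint d c₀ p Bp (u₀, v₀))) (O.B n) (O.X.orbit (O.plane Bp) n (u - u₀))) v‖ at hsn
  rw [hpt] at hsn
  have hsrc : f^[n] z ∈ (extChartAt (𝓡 d) (O.c n)).source :=
    (O.iterate_eq hu₀ htar fun i hi ↦ (hu i hi.le).trans_lt hδr).1
  set a := mfderiv (𝓡 d) (𝓡 d) f^[n] z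
    (tangentCoordSymm c₀ z (ξ₀ - splittingProj Ecu Ecs c₀ z ξ₀)) with ha
  set b := mfderiv (𝓡 d) (𝓡 d) f^[n] z
    (tangentCoordSymm c₀ z (splittingProj Ecu Ecs c₀ z ξ₀)) with hb
  have hsum : mfderiv (𝓡 d) (𝓡 d) f^[n] z (tangentCoordSymm c₀ z ξ₀) = a + b := by
    rw [ha, hb, ← map_add, ← map_add, sub_add_cancel]
  have hcompl := (hΛ.isCompl _ h1).symm
  have hP : splittingProj Ecu Ecs (O.c n) (f^[n] z) (tangentCoord (O.c n) (f^[n] z) (a + b)) =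
      tangentCoord (O.c n) (f^[n] z) b := by
    rw [map_add, map_add, splittingProj_of_mem hcompl hsrc h3,
      splittingProj_of_mem_right hcompl hsrc h2, zero_add]
  rw [hsum] at key
  change ‖(O.B n).symm (O.X.jac (O.plane Bp) n (u - u₀) w, O.X.slope (O.plane Bp) n (u - u₀)
    (O.X.jac (O.plane Bp) n (u - u₀) w)) - splittingProj Ecu Ecs (O.c n) (f^[n] z)
    ((O.B n).symm (O.X.jac (O.plane Bp) n (u - u₀) w, O.X.slope (O.plane Bp) n (u - u₀)
    (O.X.jac (O.plane Bp) n (u - u₀) w)))‖ ≤ 2 * K ^ 2 * lam ^ n *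
    ‖(O.B n).symm (O.X.jac (O.plane Bp) n (u - u₀) w, O.X.slope (O.plane Bp) n (u - u₀)
    (O.X.jac (O.plane Bp) n (u - u₀) w))‖
  rw [key, hP, map_add, add_sub_cancel_right]
  set ta := tangentCoord (O.c n) (f^[n] z) a
  set tb := tangentCoord (O.c n) (f^[n] z) b
  have hK := hCS.one_le_K
  have h5 : ‖ta‖ ≤ lam ^ n * K ^ 2 * ‖tb‖ := by
    calc ‖ta‖ ≤ K * N (f^[n] z) a := (hsn a).1
      _ ≤ K * (lam ^ n * (K * ‖tb‖)) := by
        gcongr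
        refine h4.trans ?_
        gcongr
        exact (hsn b).2
      _ = _ := by ring
  have h6 : ‖tb‖ ≤ ‖ta + tb‖ + ‖ta‖ := by
    calc ‖tb‖ = ‖(ta + tb) - ta‖ := by simp
      _ ≤ _ := norm_sub_le _ _
  have h7 : ‖ta‖ ≤ 1 / 2 * ‖tb‖ := h5.trans (by gcongr)
  calc ‖ta‖ ≤ lam ^ n * K ^ 2 * ‖tb‖ := h5
    _ ≤ lam ^ n * K ^ 2 * (2 * ‖ta + tb‖) := by gcongr; linarith
    _ = _ := by ring

end OrbitChain

end Nesting

/-! ### Large disks filled by the invariant set up to small measure -/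

section GoodDisk

variable {d : ℕ} {M : Type*} [EMetricSpace M] [ChartedSpace (EuclideanSpace ℝ (Fin d)) M]
  [IsManifold (𝓡 d) ∞ M] [RiemannianBundle (fun x : M ↦ TangentSpace (𝓡 d) x)]

/-- A disk `e`, read in the chart at `c` around the point `y`, of uniform size `R` and with uniform
`C^{1+α}` bounds, which is contracted by the first `n` backward iterates of `f` and which, up to a
set of measure at most `1 / (n + 1)`, consists of points of `Λ` at which it is almost tangent to
the centre-unstable direction. -/
structure IsGoodDisk {k : ℕ} (f : M ≃ₘ^1⟮𝓡 d, 𝓡 d⟯ M) (Λ : Set M)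
    (Ecs Ecu : ∀ x : M, Submodule ℝ (TangentSpace (𝓡 d) x)) (α ρ A R σ lam : ℝ) (n : ℕ)
    (c y : M) (e : 𝔼[k] → 𝔼[d]) (e' : 𝔼[k] → 𝔼[k] →L[ℝ] 𝔼[d]) : Prop where
  hasFDerivAt : ∀ w ∈ Metric.ball (0 : 𝔼[k]) R, HasFDerivAt e (e' w) w
  norm_sub_le : ∀ w ∈ Metric.ball (0 : 𝔼[k]) R, ‖e w - extChartAt (𝓡 d) c y‖ ≤ ρ
  norm_deriv_le : ∀ w ∈ Metric.ball (0 : 𝔼[k]) R, ‖e' w‖ ≤ A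
  holder : ∀ w ∈ Metric.ball (0 : 𝔼[k]) R, ∀ w' ∈ Metric.ball (0 : 𝔼[k]) R,
    ‖e' w - e' w'‖ ≤ A * ‖w - w'‖ ^ α
  le_norm_sub : ∀ w ∈ Metric.ball (0 : 𝔼[k]) R, ∀ w' ∈ Metric.ball (0 : 𝔼[k]) R,
    ‖w - w'‖ ≤ A * ‖e w - e w'‖
  le_norm_deriv : ∀ w ∈ Metric.ball (0 : 𝔼[k]) R, ∀ ξ, ‖ξ‖ ≤ A * ‖e' w ξ‖
  edist_le : ∀ w ∈ Metric.ball (0 : 𝔼[k]) R, ∀ w' ∈ Metric.ball (0 : 𝔼[k]) R, ∀ j ≤ n,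
    edist (f.symm^[j] ((extChartAt (𝓡 d) c).symm (e w)))
      (f.symm^[j] ((extChartAt (𝓡 d) c).symm (e w'))) ≤ ENNReal.ofReal (A * σ ^ j)
  measure_le : volume (Metric.ball (0 : 𝔼[k]) R \ {w | (extChartAt (𝓡 d) c).symm (e w) ∈ Λ ∧
    Module.finrank ℝ (Ecu ((extChartAt (𝓡 d) c).symm (e w))) = k ∧
    ∀ ξ, ‖e' w ξ - splittingProj Ecu Ecs c ((extChartAt (𝓡 d) c).symm (e w)) (e' w ξ)‖ ≤
      A * lam ^ n * ‖e' w ξ‖}) ≤ ENNReal.ofReal (1 / (n + 1))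

variable {k l : ℕ} {f : M ≃ₘ^1⟮𝓡 d, 𝓡 d⟯ M} {Λ : Set M}
  {Ecs Ecu : ∀ x : M, Submodule ℝ (TangentSpace (𝓡 d) x)}
  {N : ∀ x : M, Seminorm ℝ (TangentSpace (𝓡 d) x)} {α : ℝ} {Z : Set M} {dom : M → Set M}
  {r K lam : ℝ}

omit [IsManifold (𝓡 d) ∞ M] [RiemannianBundle (fun x : M ↦ TangentSpace (𝓡 d) x)] in
lemma symm_iterate_iterate {n j : ℕ} (hj : j ≤ n) (x : M) : f.symm^[j] (f^[n] x) = f^[n - j] x := by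
  obtain ⟨i, rfl⟩ := Nat.exists_eq_add_of_le hj
  rw [Function.iterate_add_apply, Nat.add_sub_cancel_left]
  exact (Function.LeftInverse.iterate f.symm_apply_apply j) _

namespace OrbitChain

variable {c₀ p : M} {Bp : 𝔼[d] ≃L[ℝ] 𝔼[k] × 𝔼[l]} {v₀ : 𝔼[l]} {u₀ : 𝔼[k]}

variable (O : OrbitChain f Ecs Ecu N α Z dom r K lam k l c₀ (chartPoint d c₀ p Bp (u₀, v₀)))
  (hCS : IsChartSystem f Λ Ecs Ecu N α Z dom r K)
  {δ ε σ : ℝ} (hcc : ChainConstants α ((2 * K ^ 3) ^ 4) (2 * K ^ 3) (r / (2 * K ^ 3)) lam δ ε)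
  (hu₀ : extChartAt (𝓡 d) c₀ p + Bp.symm (u₀, v₀) ∈ (extChartAt (𝓡 d) c₀).target)
include hCS hcc hu₀

/-- The image of a hyperbolic ball is a good disk if most of its points belong to `Λ`. The
constant `A` depends only on the constants of the chain. -/
lemma isGoodDisk [Nontrivial 𝔼[k]] (hΛ : IsDominatedSplitting f Λ Ecs Ecu) (hlam : 0 ≤ lam)
    (hlam1 : lam ≤ 1) {μ : M → ℝ} (hμ : ∀ x, 0 ≤ μ x)
    (hdom : ∀ x ∈ Λ, (∀ v ∈ Ecs x, N (f x) (mfderiv (𝓡 d) (𝓡 d) f x v) ≤ μ x * N x v) ∧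
        (∀ v ∈ Ecu x, μ x * N x v ≤ lam * N (f x) (mfderiv (𝓡 d) (𝓡 d) f x v)))
    (hp : p ∈ dom c₀) (hBp : IsAdapted Ecs Ecu (2 * K ^ 3) c₀ p Bp)
    (hT : O.X.IsInitialPlane (O.plane Bp)) (hσ0 : 0 < σ) (hσ1 : σ < 1) {n m : ℕ} (hmn : m ≤ n)
    (hnlam : lam ^ n * K ^ 2 ≤ 1 / 2) (hn : O.X.IsHyperbolicTime ε σ n)
    {R : ℝ} (hR : R ≤ δ / (2 * K ^ 3) ^ 2) {A : ℝ}
    (hA1 : (2 * K ^ 3) ^ 3 ≤ A) (hA2 : 2 * (2 * K ^ 3) ^ 4 * R ≤ A)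
    (hA3 : (2 * K ^ 3) ^ 3 * (4 * (2 * K ^ 3) ^ 5 *
      ((2 * K ^ 3) ^ 4 * ((2 * K ^ 3) ^ 2) ^ α) * (1 - σ ^ α)⁻¹) ≤ A)
    {G : Set 𝔼[k]} (hGΛ : ∀ u ∈ G, chartPoint d c₀ p Bp (u, v₀) ∈ dom c₀ ∧
      Module.finrank ℝ (Ecu (chartPoint d c₀ p Bp (u, v₀))) = k ∧
      ∀ v, ‖splittingProj Ecu Ecs c₀ (chartPoint d c₀ p Bp (u, v₀)) v -
        splittingProj Ecu Ecs c₀ p v‖ ≤ 1 / (2 * K ^ 2) * ‖v‖)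
    (hmeas : volume ((fun u ↦ (O.X.orbit (O.plane Bp) n u).1) ''
      {u ∈ O.X.hypBall (O.plane Bp) δ n R | u + u₀ ∉ G}) ≤ ENNReal.ofReal (1 / (m + 1))) :
    ∃ (e : 𝔼[k] → 𝔼[d]) (e' : 𝔼[k] → 𝔼[k] →L[ℝ] 𝔼[d]),
      IsGoodDisk f Λ Ecs Ecu α (2 * K ^ 3 * δ) A R σ lam m (O.c n)
        (f^[n] (chartPoint d c₀ p Bp (u₀, v₀))) e e' := by
  -- the disk is parametrized over the base by the inverse branch `ψ` of the `n`-th iterate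
  obtain ⟨ψ, -, h1, h2, -, h4⟩ := DominatedChain.exists_inverse_branch hcc hT hσ0 hσ1 hn
  have hL := hcc.one_le_K
  have hδr := hcc.δ_lt
  have hα := hcc.α_pos
  set L := 2 * K ^ 3 with hLdef
  have hL0 : 0 < L := by linarith
  have hA0 : 0 ≤ A := le_trans (by positivity) hA1
  have hL1A : L ≤ A := (le_self_pow₀ hL (by norm_num)).trans hA1
  have hmem : ∀ w ∈ Metric.ball (0 : 𝔼[k]) R, w ∈ Metric.closedBall (0 : 𝔼[k]) (δ / L ^ 2) :=
    fun w hw ↦ Metric.closedBall_subset_closedBall hR (Metric.ball_subset_closedBall hw)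
  have hψ : ∀ w ∈ Metric.ball (0 : 𝔼[k]) R, ψ w ∈ O.X.hypBall (O.plane Bp) δ n R := by
    intro w hw
    refine ⟨(h1 w (hmem w hw)).1, ?_⟩
    rw [(h1 w (hmem w hw)).2]
    exact (mem_ball_zero_iff.1 hw).le
  have hψ' : ∀ w ∈ Metric.ball (0 : 𝔼[k]) R, (u₀ + ψ w) - u₀ ∈ O.X.hypBall (O.plane Bp) δ n R := by
    intro w hw
    rw [add_sub_cancel_left]; exact hψ w hw
  have hpt : ∀ w ∈ Metric.ball (0 : 𝔼[k]) R,
      (extChartAt (𝓡 d) (O.c n)).symm (extChartAt (𝓡 d) (O.c n)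
        (f^[n] (chartPoint d c₀ p Bp (u₀, v₀))) + (O.B n).symm (O.X.orbit (O.plane Bp) n (ψ w))) =
      f^[n] (chartPoint d c₀ p Bp (u₀ + ψ w, v₀)) := by
    intro w hw
    have h := O.chartPoint_orbit_of_mem_tube hCS hcc hu₀ le_rfl (hψ' w hw).1
    rw [add_sub_cancel_left] at h
    exact h
  have hBn : ‖(O.B n : 𝔼[d] →L[ℝ] 𝔼[k] × 𝔼[l])‖ ≤ L :=
    ContinuousLinearMap.opNorm_le_bound _ hL0.le (O.adapted n).norm_le
  have hBs : ‖((O.B n).symm : 𝔼[k] × 𝔼[l] →L[ℝ] 𝔼[d])‖ ≤ L :=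
    ContinuousLinearMap.opNorm_le_bound _ hL0.le (O.adapted n).norm_symm_le
  have hfst : ∀ q : 𝔼[k] × 𝔼[l], ‖q.1‖ ≤ L * ‖(O.B n).symm q‖ := by
    intro q
    have h := (O.adapted n).norm_le ((O.B n).symm q)
    rw [ContinuousLinearEquiv.apply_symm_apply] at h
    exact (norm_fst_le q).trans h
  refine ⟨fun w ↦ extChartAt (𝓡 d) (O.c n) (f^[n] (chartPoint d c₀ p Bp (u₀, v₀))) +
      (O.B n).symm (O.X.orbit (O.plane Bp) n (ψ w)),
    fun w ↦ ((O.B n).symm : 𝔼[k] × 𝔼[l] →L[ℝ] 𝔼[d]) ∘L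
      (ContinuousLinearMap.id ℝ 𝔼[k]).prod (O.X.slope (O.plane Bp) n (ψ w)),
    fun w hw ↦ ?_, fun w hw ↦ ?_, fun w hw ↦ ?_, fun w hw w' hw' ↦ ?_, fun w hw w' hw' ↦ ?_,
    fun w hw ξ ↦ ?_, fun w hw w' hw' j hj ↦ ?_, ?_⟩
  · exact (((O.B n).symm : 𝔼[k] × 𝔼[l] →L[ℝ] 𝔼[d]).hasFDerivAt.comp w
      (h4 w (Metric.ball_subset_ball hR hw))).const_add _
  · rw [add_sub_cancel_left]
    exact ((O.adapted n).norm_symm_le _).trans (by gcongr; exact (hψ w hw).1 n le_rfl)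
  · have h5 := DominatedChain.norm_slope_le hcc hT (hψ w hw).1
    refine (ContinuousLinearMap.opNorm_comp_le _ _).trans (le_trans ?_ hA1)
    calc _ ≤ L * L ^ 2 := by
          gcongr
          rw [ContinuousLinearMap.opNorm_prod]
          refine max_le (ContinuousLinearMap.norm_id_le.trans (one_le_pow₀ hL)) h5
      _ = L ^ 3 := by ring
  · have h5 := DominatedChain.norm_slope_sub_le hcc hT hσ0 hσ1 hn (hψ w hw).1 (hψ w' hw').1
    rw [Prod.fst_sub, (h1 w (hmem w hw)).2, (h1 w' (hmem w' hw')).2] at h5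
    have e1 : ∀ S S' : 𝔼[k] →L[ℝ] 𝔼[l], ((O.B n).symm : 𝔼[k] × 𝔼[l] →L[ℝ] 𝔼[d]) ∘L
        (ContinuousLinearMap.id ℝ 𝔼[k]).prod S - ((O.B n).symm : 𝔼[k] × 𝔼[l] →L[ℝ] 𝔼[d]) ∘L
        (ContinuousLinearMap.id ℝ 𝔼[k]).prod S' = ((O.B n).symm : 𝔼[k] × 𝔼[l] →L[ℝ] 𝔼[d]) ∘L
        (0 : 𝔼[k] →L[ℝ] 𝔼[k]).prod (S - S') := by
      intro S S'
      refine ContinuousLinearMap.ext fun ξ ↦ ?_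
      simp only [sub_apply, ContinuousLinearMap.comp_apply,
        ContinuousLinearMap.prod_apply, ContinuousLinearMap.id_apply,
        ContinuousLinearEquiv.coe_coe, zero_apply]
      rw [← map_sub, Prod.mk_sub_mk, sub_self]
    rw [e1]
    refine (ContinuousLinearMap.opNorm_comp_le _ _).trans ?_
    rw [ContinuousLinearMap.opNorm_prod, Prod.norm_mk, norm_zero,
      max_eq_right (norm_nonneg _)] at *
    have hsα : 0 ≤ (1 - σ ^ α)⁻¹ := by
      rw [inv_nonneg, sub_nonneg]
      exact Real.rpow_le_one hσ0.le hσ1.le hα.le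
    calc _ ≤ L * (L ^ 2 * (4 * L ^ 5 * DominatedChain.variationConst α (L ^ 4) L ‖w - w'‖ *
          (1 - σ ^ α)⁻¹)) := mul_le_mul hBs h5 (norm_nonneg _) hL0.le
      _ = L ^ 3 * (4 * L ^ 5 * (L ^ 4 * (L ^ 2) ^ α) * (1 - σ ^ α)⁻¹) * ‖w - w'‖ ^ α := by
          rw [DominatedChain.variationConst, Real.mul_rpow (by positivity) (norm_nonneg _)]; ring
      _ ≤ A * ‖w - w'‖ ^ α := by gcongr
  · rw [add_sub_add_left_eq_sub, ← map_sub]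
    have h5 := hfst (O.X.orbit (O.plane Bp) n (ψ w) - O.X.orbit (O.plane Bp) n (ψ w'))
    rw [Prod.fst_sub, (h1 w (hmem w hw)).2, (h1 w' (hmem w' hw')).2] at h5
    exact h5.trans (by gcongr)
  · have h5 := hfst (ξ, O.X.slope (O.plane Bp) n (ψ w) ξ)
    exact h5.trans (mul_le_mul_of_nonneg_right hL1A (norm_nonneg _))
  · rw [hpt w hw, hpt w' hw', symm_iterate_iterate (hj.trans hmn),
      symm_iterate_iterate (hj.trans hmn)]
    refine (O.edist_iterate_le hCS hcc hu₀ hT hn hσ0.le (Nat.sub_le n j) (hψ' w hw)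
      (hψ' w' hw')).trans (ENNReal.ofReal_le_ofReal ?_)
    rw [Nat.sub_sub_self (hj.trans hmn)]
    gcongr
  · refine (measure_mono ?_).trans hmeas
    rintro w ⟨hw, hbad⟩
    refine ⟨ψ w, ⟨hψ w hw, fun hG ↦ hbad ?_⟩, (h1 w (hmem w hw)).2⟩
    rw [add_comm] at hG
    obtain ⟨h5, h6, h7⟩ := hGΛ _ hG
    rw [Set.mem_ofPred_eq, hpt w hw]
    have h8 := fun ξ ↦ O.norm_sub_splittingProj_le hCS hcc hu₀ hΛ hlam hμ hdom hp hBp hT hnlam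
      (hψ' w hw).1 h5 h7 ξ
    rw [add_sub_cancel_left] at h8
    have h9 := hΛ.finrank_iterate (hCS.subset _ (O.c_zero ▸ O.mem 0) h5) n
    refine ⟨h9.1, h9.2.1.trans h6, fun ξ ↦ (h8 ξ).2.trans ?_⟩
    have hK := hCS.one_le_K
    have h10 : 2 * K ^ 2 ≤ A := by
      refine le_trans ?_ hL1A
      rw [hLdef]
      gcongr
      norm_num
    have h11 : lam ^ n ≤ lam ^ m := pow_le_pow_of_le_one hlam hlam1 hmn
    exact mul_le_mul_of_nonneg_right (by gcongr) (norm_nonneg _)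

end OrbitChain

end GoodDisk

section Covering

lemma MeasureTheory.measure_preimage_sub_right {G : Type*} [AddGroup G] [MeasurableSpace G]
    [MeasurableAdd G] (ν : Measure G) [ν.IsAddRightInvariant] (a : G) (s : Set G) :
    ν ((fun x ↦ x - a) ⁻¹' s) = ν s := by
  simp_rw [sub_eq_add_neg]
  exact measure_preimage_add_right ν (-a) s

variable {d : ℕ} {M : Type*} [EMetricSpace M] [ChartedSpace (EuclideanSpace ℝ (Fin d)) M]
  [IsManifold (𝓡 d) ∞ M] [RiemannianBundle (fun x : M ↦ TangentSpace (𝓡 d) x)]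

variable {k l : ℕ} {f : M ≃ₘ^1⟮𝓡 d, 𝓡 d⟯ M} {Λ : Set M}
  {Ecs Ecu : ∀ x : M, Submodule ℝ (TangentSpace (𝓡 d) x)}
  {N : ∀ x : M, Seminorm ℝ (TangentSpace (𝓡 d) x)} {α : ℝ} {Z : Set M} {dom : M → Set M}
  {r K lam : ℝ}

/-- If the points of `Λ` with non-uniform expansion have positive outer measure on a disk, then
the iterates of the disk contain good disks of a uniform size. -/
theorem IsChartSystem.exists_isGoodDisk (hCS : IsChartSystem f Λ Ecs Ecu N α Z dom r K)
    (hα₀ : 0 < α) (hα₁ : α ≤ 1) (hΛ : IsDominatedSplitting f Λ Ecs Ecu) (hlam : 0 < lam)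
    (hlam1 : lam < 1) {μ : M → ℝ} (hμ : ∀ x, 0 ≤ μ x)
    (hdom : ∀ x ∈ Λ, (∀ v ∈ Ecs x, N (f x) (mfderiv (𝓡 d) (𝓡 d) f x v) ≤ μ x * N x v) ∧
        (∀ v ∈ Ecu x, μ x * N x v ≤ lam * N (f x) (mfderiv (𝓡 d) (𝓡 d) f x v)))
    [Nontrivial 𝔼[k]] {c₀ p : M} {Bp : 𝔼[d] ≃L[ℝ] 𝔼[k] × 𝔼[l]} {v₀ : 𝔼[l]} (hc₀ : c₀ ∈ Z)
    (hp : p ∈ dom c₀) (hBp : IsAdapted Ecs Ecu (2 * K ^ 3) c₀ p Bp) {s : ℝ}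
    (hreg : ∀ u ∈ Metric.closedBall (0 : 𝔼[k]) s,
      extChartAt (𝓡 d) c₀ p + Bp.symm (u, v₀) ∈ (extChartAt (𝓡 d) c₀).target ∧
      (chartPoint d c₀ p Bp (u, v₀) ∈ Λ → chartPoint d c₀ p Bp (u, v₀) ∈ dom c₀ ∧
        Module.finrank ℝ (Ecu (chartPoint d c₀ p Bp (u, v₀))) = k ∧
        Module.finrank ℝ (Ecs (chartPoint d c₀ p Bp (u, v₀))) = l ∧
        ∀ v, ‖splittingProj Ecu Ecs c₀ (chartPoint d c₀ p Bp (u, v₀)) v -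
          splittingProj Ecu Ecs c₀ p v‖ ≤ 1 / (2 * K ^ 2) * ‖v‖))
    {A : Set 𝔼[k]} (hAs : A ⊆ Metric.closedBall 0 s) (hA0 : volume A ≠ 0) {b : ℝ} (hb : 0 < b)
    (hAΛ : ∀ u ∈ A, chartPoint d c₀ p Bp (u, v₀) ∈ Λ)
    (hfreq : ∀ u ∈ A, ∃ᶠ n : ℕ in atTop, (1 / (n : ℝ)) * ∑ i ∈ Finset.range n,
      Real.log (normDerivOn f.symm Ecu (f^[i + 1] (chartPoint d c₀ p Bp (u, v₀)))) < -b) :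
    ∃ ρ C R σ : ℝ, ρ < r ∧ 0 ≤ C ∧ 0 < R ∧ 0 < σ ∧ σ < 1 ∧ ∀ n : ℕ, ∃ c ∈ Z, ∃ y ∈ dom c,
      ∃ (e : 𝔼[k] → 𝔼[d]) (e' : 𝔼[k] → 𝔼[k] →L[ℝ] 𝔼[d]),
        IsGoodDisk f Λ Ecs Ecu α ρ C R σ lam n c y e e' := by
  have hL := hCS.one_le_two_mul
  have hr := hCS.r_pos
  have hK1 := hCS.one_le_K
  -- Of the expansion rate `b`, the nonlinearity may cost `b / 2`; the rate `b / 4` of `σ` remains.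
  obtain ⟨δ, ε, hcc, hlog⟩ := exists_chainConstants (C := (2 * K ^ 3) ^ 4) (c := b / 2)
    hα₀ (by positivity) hL (show 0 < r / (2 * K ^ 3) by positivity) hlam hlam1 (by positivity)
  have hδ0 := hcc.δ_pos
  have hεK := hcc.ε_mul_le
  set L := 2 * K ^ 3 with hLdef
  set σ := Real.exp (-(b / 4)) with hσ
  have hσ0 : 0 < σ := Real.exp_pos _
  have hσ1 : σ < 1 := by
    rw [hσ, ← Real.exp_zero]
    exact Real.exp_lt_exp.2 (by linarith)
  set δ₁ := δ / L ^ 2 with hδ₁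
  have hδ₁0 : 0 < δ₁ := by positivity
  obtain ⟨η, hη0, hη⟩ := hCS.close (δ₁ / L) (by positivity)
  set R := min δ₁ (η / (8 * L ^ 4)) with hR
  have hR0 : 0 < R := by positivity
  have hRδ : R ≤ δ₁ := min_le_left _ _
  have hRη : 4 * L ^ 4 * R < η := by
    calc 4 * L ^ 4 * R ≤ 4 * L ^ 4 * (η / (8 * L ^ 4)) := by gcongr; exact min_le_right _ _
      _ = η / 2 := by field_simp; norm_num
      _ < η := by linarith
  set C := max (L ^ 3) (max (2 * L ^ 4 * R) (L ^ 3 * (4 * L ^ 5 *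
      (L ^ 4 * (L ^ 2) ^ α) * (1 - σ ^ α)⁻¹))) with hC
  have hC1 : L ^ 3 ≤ C := le_max_left _ _
  refine ⟨L * δ, C, R, σ, ?_, le_trans (by positivity) hC1, hR0, hσ0, hσ1, fun m ↦ ?_⟩
  · have := hcc.δ_lt
    rw [lt_div_iff₀ (by positivity)] at this
    linarith
  -- the chains of the points of `A`
  have hO : ∀ u : A, Nonempty (OrbitChain f Ecs Ecu N α Z dom r K lam k l c₀
      (chartPoint d c₀ p Bp (u.1, v₀))) := fun u ↦ by
    obtain ⟨h1, h2, h3, -⟩ := (hreg u.1 (hAs u.2)).2 (hAΛ u.1 u.2)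
    exact hCS.exists_orbitChain hα₀ hα₁ hΛ hμ hdom hc₀ h1 h2 h3
  let O := fun u : A ↦ Classical.choice (hO u)
  have hu₀ : ∀ u : A, extChartAt (𝓡 d) c₀ p + Bp.symm (u.1, v₀) ∈ (extChartAt (𝓡 d) c₀).target :=
    fun u ↦ (hreg u.1 (hAs u.2)).1
  have hT : ∀ u : A, (O u).X.IsInitialPlane ((O u).plane Bp) := fun u ↦
    (O u).isInitialPlane hCS hΛ hp hBp ((hreg u.1 (hAs u.2)).2 (hAΛ u.1 u.2)).2.2.2
  obtain ⟨Q, hQ0, hQt, hQ⟩ := DominatedChain.exists_distortion_bound (V := 𝔼[l]) hcc hσ0 hσ1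
    (volume : Measure 𝔼[k])
  have hQ' := fun (u : A) n hn ↦ hQ (O u).X ((O u).plane Bp) n (hT u) hn
  -- only large times matter
  obtain ⟨n₀, hn₀⟩ : ∃ n₀, ∀ n ≥ n₀, lam ^ n * K ^ 2 ≤ 1 / 2 := by
    have h := (tendsto_pow_atTop_nhds_zero_of_lt_one hlam.le hlam1).mul_const (K ^ 2)
    rw [zero_mul] at h
    exact eventually_atTop.1 (h.eventually_le_const (by norm_num))
  -- the points of the disk which belong to `Λ`
  set ι : 𝔼[k] → M := fun u ↦ chartPoint d c₀ p Bp (u, v₀) with hι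
  have hιc : ContinuousOn ι (Metric.closedBall 0 s) := by
    refine (continuousOn_extChartAt_symm (I := 𝓡 d) c₀).comp ?_ fun u hu ↦ (hreg u hu).1
    fun_prop
  set G := Metric.closedBall (0 : 𝔼[k]) s ∩ ι ⁻¹' Λ with hG
  have hGm : MeasurableSet G :=
    (hιc.preimage_isClosed_of_isClosed Metric.isClosed_closedBall hΛ.isCompact.isClosed).measurableSet
  have hvolR : volume (Metric.closedBall (0 : 𝔼[k]) R) ≠ 0 :=
    (Metric.measure_closedBall_pos _ _ hR0).ne'
  have hvolR' : volume (Metric.closedBall (0 : 𝔼[k]) R) ≠ ⊤ := measure_closedBall_lt_top.ne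
  have hvolδ : volume (Metric.closedBall (0 : 𝔼[k]) δ₁) ≠ 0 :=
    (Metric.measure_closedBall_pos _ _ hδ₁0).ne'
  have hvolδ' : volume (Metric.closedBall (0 : 𝔼[k]) δ₁) ≠ ⊤ := measure_closedBall_lt_top.ne
  set η' : ℝ≥0∞ := ENNReal.ofReal (1 / (m + 1)) / (Q * volume (Metric.closedBall (0 : 𝔼[k]) R))
    with hη'
  have hη'0 : η' ≠ 0 := ENNReal.div_ne_zero.2
    ⟨(ENNReal.ofReal_pos.2 (by positivity)).ne', ENNReal.mul_ne_top hQt hvolR'⟩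
  -- hyperbolic balls play the role of the balls in the density point argument
  refine Exists.elim (exists_measure_diff_le (volume : Measure 𝔼[k])
    (ι := A × ℕ) (t := {i | (O i.1).X.IsHyperbolicTime ε σ i.2 ∧ n₀ ≤ i.2})
    (ctr := fun i ↦ i.1.1) (n := fun i ↦ i.2)
    (W := fun i ↦ (fun u ↦ u - i.1.1) ⁻¹' (O i.1).X.hypBall ((O i.1).plane Bp) δ i.2 R)
    (P := fun i ↦ (fun u ↦ u - i.1.1) ⁻¹' (O i.1).X.hypBall ((O i.1).plane Bp) δ i.2 δ₁)
    (R := fun n ↦ L * δ₁ * σ ^ n) (A := A) (G := G)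
    (by simpa using (tendsto_pow_atTop_nhds_zero_of_lt_one hσ0.le hσ1).const_mul (L * δ₁))
    hA0 ((measure_mono hAs).trans_lt measure_closedBall_lt_top).ne
    (fun u hu ↦ ⟨hAs hu, hAΛ u hu⟩) hGm (fun u hu n ↦ ?_) (fun i hi u hu ↦ ?_) (fun i hi ↦ ?_)
    (fun i hi ↦ ?_) (fun i hi ↦ ?_)
    (Q := Q * volume (Metric.closedBall (0 : 𝔼[k]) δ₁) *
      (volume (Metric.closedBall (0 : 𝔼[k]) R))⁻¹) (mul_ne_zero (mul_ne_zero hQ0 hvolδ)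
        (ENNReal.inv_ne_zero.2 hvolR')) (ENNReal.mul_ne_top (ENNReal.mul_ne_top hQt hvolδ')
        (ENNReal.inv_ne_top.2 hvolR)) (fun i hi ↦ ?_) (fun i hi j hj hij hne ↦ ?_) hη'0 m) ?_
  · -- hyperbolic times
    have hx := hAΛ u hu
    obtain ⟨n', hn', h⟩ := exists_prod_le_pow (m := (O ⟨u, hu⟩).X.m) (c := b)
      (θ := (1 - ε * L)⁻¹) (σ := σ) (O ⟨u, hu⟩).X.m_pos (by
        rw [inv_pos]; linarith) hσ0 (by rw [hσ, Real.log_exp]; linarith)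
      (by simp_rw [(O ⟨u, hu⟩).rate]; exact hfreq u hu) (max n n₀)
    exact ⟨(⟨u, hu⟩, n'), ⟨h, (le_max_right _ _).trans hn'⟩, rfl, (le_max_left _ _).trans hn'⟩
  · rw [mem_closedBall_iff_norm]
    exact DominatedChain.norm_le_of_mem_hypBall hcc (hT i.1) hi.1 hσ0.le hu
  · rw [mem_preimage, sub_self]
    exact DominatedChain.zero_mem_hypBall hcc hR0.le _
  · exact (measurable_sub_const _)
      (DominatedChain.isCompact_hypBall hcc (hT i.1) hσ0 hσ1 hi.1 hRδ).measurableSet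
  · rw [measure_preimage_sub_right]
    exact DominatedChain.measure_hypBall_pos hcc (hT i.1) hσ0 hσ1 _ hi.1 hR0 hRδ
  · rw [measure_preimage_sub_right, measure_preimage_sub_right]
    exact DominatedChain.measure_hypBall_le hcc (hT i.1) volume hσ0 hσ1 hi.1 (hQ' i.1 i.2 hi.1)
      hRδ hR0 le_rfl
  · obtain ⟨v, hv, hv'⟩ := hne
    intro v' hv''
    exact (O i.1).mem_hypBall_of_inter (O j.1) hCS hcc (hu₀ i.1) (hu₀ j.1) (hT i.1) (hT j.1)
      hσ0.le hσ1.le hi.1 hj.1 hij hR0.le hRη hη hv hv' hv''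
  · rintro ⟨u, n⟩ ⟨⟨hn, hnn₀⟩, hmn, hmeas⟩
    refine Exists.elim ((O u).isGoodDisk hCS hcc (hu₀ u) hΛ hlam.le hlam1.le hμ hdom hp hBp (hT u)
      hσ0 hσ1 hmn (hn₀ n hnn₀) hn hRδ (A := C) hC1 ((le_max_left _ _).trans (le_max_right _ _))
      ((le_max_right _ _).trans (le_max_right _ _)) (G := G)
      (fun u hu ↦ by
        obtain ⟨h1, h2, -, h3⟩ := (hreg u hu.1).2 hu.2
        exact ⟨h1, h2, h3⟩) ?_) fun e ⟨e', he⟩ ↦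
        ⟨_, (O u).mem n, _, (O u).mem_dom n, e, e', he⟩
    · have hcomp := DominatedChain.isCompact_hypBall hcc (hT u) hσ0 hσ1 hn hRδ
      have e1 : (fun v ↦ v - u.1) ⁻¹' (O u).X.hypBall ((O u).plane Bp) δ n R \ G =
          (fun v ↦ v - u.1) ⁻¹'
            {v ∈ (O u).X.hypBall ((O u).plane Bp) δ n R | v + u.1 ∉ G} := by
        ext v
        simp [sub_add_cancel]
      rw [e1, measure_preimage_sub_right, measure_preimage_sub_right] at hmeas
      refine (DominatedChain.measure_image_le hcc (hT u) volume hσ0 hσ1 hn (hQ' u n hn) hRδ hR0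
        (hcomp.measurableSet.inter ((measurable_add_const u.1) hGm.compl)) (fun v hv ↦ hv.1)
        hmeas).trans ?_
      exact ENNReal.mul_div_le

end Covering

/-! ### The limit of the good disks -/

section LimitDisk

lemma Filter.Tendsto.clm_apply_of_tendsto {ι E F : Type*} [NormedAddCommGroup E] [NormedSpace ℝ E]
    [NormedAddCommGroup F] [NormedSpace ℝ F] {l : Filter ι} {L : ι → E →L[ℝ] F} {L₀ : E →L[ℝ] F}
    {v : ι → E} {v₀ : E} (hL : Tendsto L l (𝓝 L₀)) (hv : Tendsto v l (𝓝 v₀)) :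
    Tendsto (fun i ↦ L i (v i)) l (𝓝 (L₀ v₀)) :=
  ((isBoundedBilinearMap_apply (𝕜 := ℝ) (E := E) (F := F)).continuous.tendsto (L₀, v₀)).comp
    (hL.prodMk_nhds hv)

variable {d : ℕ} {M : Type*} [EMetricSpace M] [ChartedSpace (EuclideanSpace ℝ (Fin d)) M]
  [IsManifold (𝓡 d) ∞ M] [RiemannianBundle (fun x : M ↦ TangentSpace (𝓡 d) x)]

variable {k : ℕ} {f : M ≃ₘ^1⟮𝓡 d, 𝓡 d⟯ M} {Λ : Set M}
  {Ecs Ecu : ∀ x : M, Submodule ℝ (TangentSpace (𝓡 d) x)}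
  {N : ∀ x : M, Seminorm ℝ (TangentSpace (𝓡 d) x)} {α : ℝ} {Z : Set M} {dom : M → Set M}
  {r K lam ρ C R σ : ℝ}

omit [RiemannianBundle (fun x : M ↦ TangentSpace (𝓡 d) x)] in
/-- A good disk of generation `n` is good for all smaller generations. -/
lemma IsGoodDisk.mono {m n : ℕ} {c y : M} {e : 𝔼[k] → 𝔼[d]} {e' : 𝔼[k] → 𝔼[k] →L[ℝ] 𝔼[d]}
    (h : IsGoodDisk f Λ Ecs Ecu α ρ C R σ lam n c y e e') (hlam : 0 ≤ lam) (hlam1 : lam ≤ 1)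
    (hC : 0 ≤ C) (hmn : m ≤ n) : IsGoodDisk f Λ Ecs Ecu α ρ C R σ lam m c y e e' := by
  refine ⟨h.hasFDerivAt, h.norm_sub_le, h.norm_deriv_le, h.holder, h.le_norm_sub, h.le_norm_deriv,
    fun w hw w' hw' j hj ↦ h.edist_le w hw w' hw' j (hj.trans hmn), ?_⟩
  refine (measure_mono (sdiff_subset_sdiff_right ?_)).trans (h.measure_le.trans
    (ENNReal.ofReal_le_ofReal ?_))
  · rintro w ⟨h1, h2, h3⟩
    refine ⟨h1, h2, fun ξ ↦ (h3 ξ).trans ?_⟩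
    have := pow_le_pow_of_le_one hlam hlam1 hmn
    gcongr
  · gcongr

omit [RiemannianBundle (fun x : M ↦ TangentSpace (𝓡 d) x)] in
/-- By the pigeonhole principle, good disks of all generations exist in one and the same chart. -/
lemma exists_center_isGoodDisk (hZ : Z.Finite) (hlam : 0 ≤ lam) (hlam1 : lam ≤ 1) (hC : 0 ≤ C)
    (h : ∀ n : ℕ, ∃ c ∈ Z, ∃ y ∈ dom c, ∃ (e : 𝔼[k] → 𝔼[d]) (e' : 𝔼[k] → 𝔼[k] →L[ℝ] 𝔼[d]),
      IsGoodDisk f Λ Ecs Ecu α ρ C R σ lam n c y e e') :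
    ∃ c ∈ Z, ∀ n : ℕ, ∃ y ∈ dom c, ∃ (e : 𝔼[k] → 𝔼[d]) (e' : 𝔼[k] → 𝔼[k] →L[ℝ] 𝔼[d]),
      IsGoodDisk f Λ Ecs Ecu α ρ C R σ lam n c y e e' := by
  by_contra! hcon
  choose! n hn using hcon
  obtain ⟨b, hb⟩ := (hZ.image n).bddAbove
  obtain ⟨c, hc, y, hy, e, e', he⟩ := h b
  exact hn c hc y hy e e' (he.mono hlam hlam1 hC (hb (mem_image_of_mem n hc)))

/-- Limits of good disks which become better and better are contained in `Λ`, and they are tangent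
to the centre-unstable direction. -/
theorem IsChartSystem.exists_limitDisk (hCS : IsChartSystem f Λ Ecs Ecu N α Z dom r K)
    (hα₀ : 0 < α) (hΛ : IsDominatedSplitting f Λ Ecs Ecu) (hlam : 0 ≤ lam) (hlam1 : lam < 1)
    (hρ : ρ < r) (hC : 0 ≤ C) {c : M} (hc : c ∈ Z)
    (h : ∀ n : ℕ, ∃ y ∈ dom c, ∃ (e : 𝔼[k] → 𝔼[d]) (e' : 𝔼[k] → 𝔼[k] →L[ℝ] 𝔼[d]),
      IsGoodDisk f Λ Ecs Ecu α ρ C R σ lam n c y e e') :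
    ∃ (g : 𝔼[k] → 𝔼[d]) (g' : 𝔼[k] → 𝔼[k] →L[ℝ] 𝔼[d]),
      ContinuousOn g' (Metric.ball 0 R) ∧ ∀ w ∈ Metric.ball (0 : 𝔼[k]) R,
        HasFDerivAt g (g' w) w ∧ g w ∈ (extChartAt (𝓡 d) c).target ∧
        (extChartAt (𝓡 d) c).symm (g w) ∈ Λ ∧
        Module.finrank ℝ (Ecu ((extChartAt (𝓡 d) c).symm (g w))) = k ∧
        (∀ ξ, tangentCoordSymm c ((extChartAt (𝓡 d) c).symm (g w)) (g' w ξ) ∈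
          Ecu ((extChartAt (𝓡 d) c).symm (g w))) ∧
        (∀ ξ, ‖ξ‖ ≤ C * ‖g' w ξ‖) ∧
        ∀ w' ∈ Metric.ball (0 : 𝔼[k]) R, ‖w - w'‖ ≤ C * ‖g w - g w'‖ ∧
          ∀ j, edist (f.symm^[j] ((extChartAt (𝓡 d) c).symm (g w)))
            (f.symm^[j] ((extChartAt (𝓡 d) c).symm (g w'))) ≤ ENNReal.ofReal (C * σ ^ j) := by
  choose y hy e e' he using h
  set κ := extChartAt (𝓡 d) c with hκ
  set l : Ultrafilter ℕ := hyperfilter ℕ with hl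
  have hlat : (l : Filter ℕ) ≤ atTop := by
    rw [← Nat.cofinite_eq_atTop]; exact hyperfilter_le_cofinite
  -- the centres converge
  obtain ⟨y₀, hy₀, hy₀l⟩ := (hCS.isCompact c hc).ultrafilter_le_nhds (l.map y)
    (le_principal_iff.2 (Eventually.of_forall hy : ∀ᶠ n in (l : Filter ℕ), y n ∈ dom c))
  have hκy : Tendsto (fun n ↦ κ (y n)) l (𝓝 (κ y₀)) :=
    (continuousAt_extChartAt' (hCS.subset_source c hc hy₀)).tendsto.comp hy₀l
  obtain ⟨b, hb⟩ : ∃ b, ∀ x ∈ dom c, ‖κ x‖ ≤ b := by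
    obtain ⟨b, hb⟩ := ((hCS.isCompact c hc).image_of_continuousOn ((continuousOn_extChartAt c).mono
      (hCS.subset_source c hc))).isBounded.exists_norm_le
    exact ⟨b, fun x hx ↦ hb _ (mem_image_of_mem _ hx)⟩
  obtain ⟨g, g', hg, hg', hgd, hg'c⟩ := exists_ultrafilter_limit l (A := max C (ρ + b)) hα₀ hC
    (fun n ↦ (he n).hasFDerivAt) (fun n w hw ↦ by
      have h1 := (he n).norm_sub_le w hw
      have h2 := hb _ (hy n)
      have h3 := norm_le_norm_add_norm_sub' (e n w) (κ (y n))
      exact le_trans (by linarith) (le_max_right _ _))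
    (fun n w hw ↦ ((he n).norm_deriv_le w hw).trans (le_max_left _ _)) (fun n ↦ (he n).holder)
  have hclose : ∀ w ∈ Metric.ball (0 : 𝔼[k]) R, g w ∈ Metric.ball (κ y₀) r := by
    intro w hw
    rw [mem_ball_iff_norm]
    exact (le_of_tendsto ((hg w hw).sub hκy).norm
      (Eventually.of_forall fun n ↦ (he n).norm_sub_le w hw)).trans_lt hρ
  have htar : ∀ w ∈ Metric.ball (0 : 𝔼[k]) R, g w ∈ κ.target := fun w hw ↦
    hCS.ball_subset c hc y₀ hy₀ (hclose w hw)
  have hsymm : ∀ w ∈ Metric.ball (0 : 𝔼[k]) R, ContinuousAt κ.symm (g w) := fun w hw ↦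
    continuousAt_extChartAt_symm'' (htar w hw)
  have hlip : ∀ n, ∀ w ∈ Metric.ball (0 : 𝔼[k]) R, ∀ w' ∈ Metric.ball (0 : 𝔼[k]) R,
      ‖e n w' - e n w‖ ≤ C * ‖w' - w‖ := fun n w hw w' hw' ↦
    (convex_ball (0 : 𝔼[k]) R).norm_image_sub_le_of_norm_hasFDerivWithin_le
      (fun x hx ↦ ((he n).hasFDerivAt x hx).hasFDerivWithinAt) (he n).norm_deriv_le hw hw'
  -- the pairs of indices and of points at which the disks are good
  set S : Set (ℕ × 𝔼[k]) := {q | q.2 ∈ Metric.ball 0 R ∧ κ.symm (e q.1 q.2) ∈ Λ ∧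
    Module.finrank ℝ (Ecu (κ.symm (e q.1 q.2))) = k ∧
    ∀ ξ, ‖e' q.1 q.2 ξ - splittingProj Ecu Ecs c (κ.symm (e q.1 q.2)) (e' q.1 q.2 ξ)‖ ≤
      C * lam ^ q.1 * ‖e' q.1 q.2 ξ‖} with hS
  -- the good points become dense, as their complement has measure tending to zero
  have hne : ∀ w ∈ Metric.ball (0 : 𝔼[k]) R, (((l : Filter ℕ) ×ˢ 𝓝 w) ⊓ 𝓟 S).NeBot := by
    intro w hw
    rw [inf_principal_neBot_iff]
    intro s hs
    obtain ⟨t₁, ht₁, t₂, ht₂, hts⟩ := mem_prod_iff.1 hs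
    obtain ⟨a, ha, hat⟩ := Metric.mem_nhds_iff.1 (inter_mem ht₂ (Metric.isOpen_ball.mem_nhds hw))
    have hv : 0 < volume (Metric.ball w a) := Metric.measure_ball_pos _ _ ha
    have hev : ∀ᶠ n : ℕ in l, ENNReal.ofReal (1 / (n + 1)) < volume (Metric.ball w a) := by
      refine hlat ?_
      have h1 := (ENNReal.continuous_ofReal.tendsto 0).comp
        (tendsto_one_div_add_atTop_nhds_zero_nat (𝕜 := ℝ))
      rw [ENNReal.ofReal_zero] at h1
      exact h1.eventually_lt_const hv
    obtain ⟨n, hn, hn'⟩ := l.nonempty_of_mem (inter_mem ht₁ hev)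
    obtain ⟨w', hw', hgood⟩ : ∃ w' ∈ Metric.ball w a, (n, w') ∈ S := by
      by_contra! hcon
      refine absurd hn' (not_lt.2 (le_trans (measure_mono ?_) (he n).measure_le))
      exact fun w' hw' ↦ ⟨(hat hw').2, fun hg ↦ hcon w' hw' ⟨(hat hw').2, hg⟩⟩
    exact ⟨(n, w'), hts ⟨hn, (hat hw').1⟩, hgood⟩
  refine ⟨g, g', hg'c, fun w hw ↦ ?_⟩
  have := hne w hw
  -- along `F`, good points of the disks tend to the point with parameter `w` of the limit
  set F := ((l : Filter ℕ) ×ˢ 𝓝 w) ⊓ 𝓟 S with hF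
  have hFS : ∀ᶠ q in F, q ∈ S := mem_inf_of_right (mem_principal_self S)
  have hF1 : Tendsto Prod.fst F l := tendsto_fst.mono_left inf_le_left
  have hF2 : Tendsto Prod.snd F (𝓝 w) := tendsto_snd.mono_left inf_le_left
  have hF20 : Tendsto (fun q : ℕ × 𝔼[k] ↦ ‖q.2 - w‖) F (𝓝 0) :=
    tendsto_iff_norm_sub_tendsto_zero.1 hF2
  have hFe : Tendsto (fun q : ℕ × 𝔼[k] ↦ e q.1 q.2) F (𝓝 (g w)) := by
    have h1 : Tendsto (fun q : ℕ × 𝔼[k] ↦ e q.1 q.2 - e q.1 w) F (𝓝 0) := by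
      refine squeeze_zero_norm' (hFS.mono fun q hq ↦ hlip q.1 w hw q.2 hq.1) ?_
      simpa using hF20.const_mul C
    simpa using h1.add ((hg w hw).comp hF1)
  have hFe' : Tendsto (fun q : ℕ × 𝔼[k] ↦ e' q.1 q.2) F (𝓝 (g' w)) := by
    have h1 : Tendsto (fun q : ℕ × 𝔼[k] ↦ e' q.1 q.2 - e' q.1 w) F (𝓝 0) := by
      refine squeeze_zero_norm' (hFS.mono fun q hq ↦ (he q.1).holder q.2 hq.1 w hw) ?_
      have h2 := (hF20.rpow_const (p := α) (Or.inr hα₀.le)).const_mul C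
      simpa [Real.zero_rpow hα₀.ne'] using h2
    simpa using h1.add ((hg' w hw).comp hF1)
  have hFz : Tendsto (fun q : ℕ × 𝔼[k] ↦ κ.symm (e q.1 q.2)) F (𝓝 (κ.symm (g w))) :=
    (hsymm w hw).tendsto.comp hFe
  have hzΛ : κ.symm (g w) ∈ Λ :=
    hΛ.isCompact.isClosed.mem_of_tendsto hFz (hFS.mono fun q hq ↦ hq.2.1)
  have hFz' : Tendsto (fun q : ℕ × 𝔼[k] ↦ κ.symm (e q.1 q.2)) F (𝓝[Λ] (κ.symm (g w))) :=
    tendsto_nhdsWithin_iff.2 ⟨hFz, hFS.mono fun q hq ↦ hq.2.1⟩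
  have hzs : κ.symm (g w) ∈ κ.source := κ.map_target (htar w hw)
  have hcompl := fun x hx ↦ (hΛ.isCompl x hx).symm
  refine ⟨hgd w hw, htar w hw, hzΛ, ?_, fun ξ ↦ ?_, fun ξ ↦ ?_, fun w' hw' ↦ ⟨?_, fun j ↦ ?_⟩⟩
  · obtain ⟨q, hq, hq'⟩ := ((hFz'.eventually
      (eventually_finrank_eq hΛ.continuous_cu hzΛ)).and hFS).exists
    exact hq.symm.trans hq'.2.2.1
  · refine mem_of_splittingProj_eq (hcompl _ hzΛ) hzs ?_
    have hP := (continuousWithinAt_splittingProj hΛ.continuous_cu hΛ.continuous_cs hcompl hzΛ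
      hzs).tendsto.comp hFz'
    have hξ : Tendsto (fun q : ℕ × 𝔼[k] ↦ e' q.1 q.2 ξ) F (𝓝 (g' w ξ)) :=
      hFe'.clm_apply_of_tendsto tendsto_const_nhds
    have h1 := hξ.sub (hP.clm_apply_of_tendsto hξ)
    have h2 : Tendsto (fun q : ℕ × 𝔼[k] ↦ e' q.1 q.2 ξ -
        splittingProj Ecu Ecs c (κ.symm (e q.1 q.2)) (e' q.1 q.2 ξ)) F (𝓝 0) := by
      refine squeeze_zero_norm' (hFS.mono fun q hq ↦ hq.2.2.2 ξ) ?_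
      have h3 : Tendsto (fun q : ℕ × 𝔼[k] ↦ lam ^ q.1) F (𝓝 0) :=
        (tendsto_pow_atTop_nhds_zero_of_lt_one hlam hlam1).comp (hF1.mono_right hlat)
      simpa using (h3.const_mul C).mul hξ.norm
    have h4 := tendsto_nhds_unique h1 h2
    exact (sub_eq_zero.1 h4).symm
  · exact ge_of_tendsto ((((hg' w hw).clm_apply_of_tendsto tendsto_const_nhds).norm).const_mul C)
      (Eventually.of_forall fun n ↦ (he n).le_norm_deriv w hw ξ)
  · exact ge_of_tendsto ((((hg w hw).sub (hg w' hw')).norm).const_mul C)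
      (Eventually.of_forall fun n ↦ (he n).le_norm_sub w hw w' hw')
  · have hcont : Continuous f.symm^[j] := f.symm.contMDiff.continuous.iterate j
    have h1 := (hcont.tendsto _).comp ((hsymm w hw).tendsto.comp (hg w hw))
    have h2 := (hcont.tendsto _).comp ((hsymm w' hw').tendsto.comp (hg w' hw'))
    refine le_of_tendsto (h1.edist h2) (hlat ?_)
    filter_upwards [eventually_ge_atTop j] with n hn
    exact (he n).edist_le w hw w' hw' j hn

omit [RiemannianBundle (fun x : M ↦ TangentSpace (𝓡 d) x)] in
/-- A limit disk in a chart gives a local unstable disk. -/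
theorem exists_isLocalUnstableDisk (hk : 0 < k) (hR : 0 < R) (hC : 0 ≤ C) (hσ0 : 0 < σ)
    (hσ1 : σ < 1) {c : M} {g : 𝔼[k] → 𝔼[d]} {g' : 𝔼[k] → 𝔼[k] →L[ℝ] 𝔼[d]}
    (hg'c : ContinuousOn g' (Metric.ball 0 R))
    (h : ∀ w ∈ Metric.ball (0 : 𝔼[k]) R,
        HasFDerivAt g (g' w) w ∧ g w ∈ (extChartAt (𝓡 d) c).target ∧
        (extChartAt (𝓡 d) c).symm (g w) ∈ Λ ∧
        Module.finrank ℝ (Ecu ((extChartAt (𝓡 d) c).symm (g w))) = k ∧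
        (∀ ξ, tangentCoordSymm c ((extChartAt (𝓡 d) c).symm (g w)) (g' w ξ) ∈
          Ecu ((extChartAt (𝓡 d) c).symm (g w))) ∧
        (∀ ξ, ‖ξ‖ ≤ C * ‖g' w ξ‖) ∧
        ∀ w' ∈ Metric.ball (0 : 𝔼[k]) R, ‖w - w'‖ ≤ C * ‖g w - g w'‖ ∧
          ∀ j, edist (f.symm^[j] ((extChartAt (𝓡 d) c).symm (g w)))
            (f.symm^[j] ((extChartAt (𝓡 d) c).symm (g w'))) ≤ ENNReal.ofReal (C * σ ^ j)) :
    ∃ γ ⊆ Λ, IsLocalUnstableDisk f Ecu γ := by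
  set κ := extChartAt (𝓡 d) c with hκ
  set φ : 𝔼[k] → M := fun z ↦ κ.symm (g ((R / 2) • z)) with hφ
  have hmem : ∀ z ∈ Metric.closedBall (0 : 𝔼[k]) 1, (R / 2) • z ∈ Metric.ball (0 : 𝔼[k]) R := by
    intro z hz
    rw [mem_ball_zero_iff, norm_smul, Real.norm_of_nonneg (by positivity)]
    have := mem_closedBall_zero_iff.1 hz
    nlinarith
  have hder : ∀ z ∈ Metric.closedBall (0 : 𝔼[k]) 1, HasMFDerivAt (𝓡 k) (𝓡 d) φ z
      (tangentCoordSymm c (φ z) ∘L (g' ((R / 2) • z) ∘L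
        ((R / 2) • ContinuousLinearMap.id ℝ 𝔼[k]))) := by
    intro z hz
    obtain ⟨h1, h2, -⟩ := h _ (hmem z hz)
    have h3 : HasFDerivAt (fun z : 𝔼[k] ↦ (R / 2) • z) ((R / 2) • ContinuousLinearMap.id ℝ 𝔼[k]) z :=
      (hasFDerivAt_id z).const_smul (R / 2)
    exact (hasMFDerivAt_extChartAt_symm h2).comp z (h1.comp z h3).hasMFDerivAt
  have hker : ∀ z ∈ Metric.closedBall (0 : 𝔼[k]) 1, Function.Injective
      (mfderiv (𝓡 k) (𝓡 d) φ z) := by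
    intro z hz
    obtain ⟨h1, h2, -, -, -, h3, -⟩ := h _ (hmem z hz)
    rw [(hder z hz).mfderiv, injective_iff_map_eq_zero]
    intro ξ hξ
    have h4 : g' ((R / 2) • z) ((R / 2) • ξ) = 0 := by
      have h5 := congrArg (tangentCoord c (φ z)) hξ
      rw [map_zero] at h5
      exact (tangentCoord_tangentCoordSymm (κ.map_target h2) _).symm.trans h5
    have h6 := h3 ((R / 2) • ξ)
    rw [h4, norm_zero, mul_zero] at h6
    exact (smul_eq_zero.1 (norm_le_zero_iff.1 h6)).resolve_left (by positivity)
  refine ⟨φ '' Metric.closedBall 0 1, ?_, ⟨C + 1, σ, by positivity, hσ0, hσ1, ?_⟩, k, φ, hk,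
    ⟨fun z hz ↦ ?_, ?_, hker⟩, rfl, fun z hz ↦ ?_⟩
  · rintro _ ⟨z, hz, rfl⟩
    exact (h _ (hmem z hz)).2.2.1
  · rintro _ ⟨z, hz, rfl⟩ _ ⟨z', hz', rfl⟩ n
    refine (((h _ (hmem z hz)).2.2.2.2.2.2 _ (hmem z' hz')).2 n).trans
      (ENNReal.ofReal_le_ofReal ?_)
    gcongr
    linarith
  · have hgC : ContDiffAt ℝ 1 g ((R / 2) • z) := contDiffAt_one_iff.2
      ⟨g', _, Metric.isOpen_ball.mem_nhds (hmem z hz), hg'c, fun w hw ↦ (h w hw).1⟩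
    have h1 : ContDiffAt ℝ 1 (fun z : 𝔼[k] ↦ g ((R / 2) • z)) z :=
      hgC.comp z (contDiffAt_id.const_smul (R / 2))
    have h2 : ContMDiffAt (𝓡 d) (𝓡 d) 1 κ.symm (g ((R / 2) • z)) :=
      ((contMDiffOn_extChartAt_symm (n := ∞) c).contMDiffAt
        ((isOpen_extChartAt_target c).mem_nhds (h _ (hmem z hz)).2.1)).of_le ENat.LEInfty.out
    exact h2.comp z h1.contMDiffAt
  · intro z hz z' hz' hzz
    obtain ⟨h1, h2, h3⟩ := h _ (hmem z hz)
    have h4 := h _ (hmem z' hz')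
    have h5 := κ.symm.injOn h2 h4.2.1 hzz
    have h6 := (h3.2.2.2.2 _ (hmem z' hz')).1
    rw [h5, sub_self, norm_zero, mul_zero] at h6
    have h7 := sub_eq_zero.1 (norm_le_zero_iff.1 h6)
    exact smul_right_injective _ (by positivity : R / 2 ≠ 0) h7
  · have : FiniteDimensional ℝ (TangentSpace (𝓡 d) (φ z)) :=
      inferInstanceAs (FiniteDimensional ℝ 𝔼[d])
    obtain ⟨h1, h2, h3, h4, h5, -⟩ := h _ (hmem z hz)
    refine Submodule.eq_of_le_of_finrank_eq ?_ ?_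
    · rintro _ ⟨ξ, rfl⟩
      have h6 := h5 ((R / 2) • ξ)
      change mfderiv (𝓡 k) (𝓡 d) φ z ξ ∈ _
      rw [(hder z hz).mfderiv]
      exact h6
    · rw [LinearMap.finrank_range_of_inj (hker z hz)]
      exact finrank_euclideanSpace_fin.trans h4.symm

end LimitDisk

/-! ### Slices of a set of positive volume -/

section Slices

/-- Every set of positive Lebesgue measure has a slice of positive measure, for any splitting of
the coordinates into two groups. -/
lemma exists_slice_volume_ne_zero {d k l : ℕ} (B : 𝔼[d] ≃L[ℝ] 𝔼[k] × 𝔼[l]) (x : 𝔼[d])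
    {E : Set 𝔼[d]} (hE : MeasurableSet E) (hE0 : volume E ≠ 0) :
    ∃ v : 𝔼[l], volume {u : 𝔼[k] | x + B.symm (u, v) ∈ E} ≠ 0 := by
  by_contra! hcon
  have hT : MeasurableSet {w : 𝔼[k] × 𝔼[l] | x + B.symm w ∈ E} :=
    (continuous_const.add B.symm.continuous).measurable hE
  have h0 : ((volume : Measure 𝔼[k]).prod (volume : Measure 𝔼[l]))
      {w : 𝔼[k] × 𝔼[l] | x + B.symm w ∈ E} = 0 := by
    rw [Measure.prod_apply_symm hT]
    exact lintegral_eq_zero_of_ae_eq_zero (Eventually.of_forall fun v ↦ hcon v)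
  have h1 : (Measure.map B (volume : Measure 𝔼[d])) {w : 𝔼[k] × 𝔼[l] | x + B.symm w ∈ E} = 0 :=
    Measure.absolutelyContinuous_isAddHaarMeasure _ _ h0
  rw [Measure.map_apply B.continuous.measurable hT] at h1
  refine hE0 ?_
  rw [← measure_preimage_add volume x E, ← h1]
  congr 1
  ext ξ
  simp

end Slices

section VolumeInCharts

variable {d : ℕ} {M : Type*} [EMetricSpace M] [MeasurableSpace M] [BorelSpace M]
  [ChartedSpace (EuclideanSpace ℝ (Fin d)) M]

lemma measurableSet_chart_preimage {c : M} {H : Set M} (hH : MeasurableSet H) {V : Set 𝔼[d]}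
    (hV : MeasurableSet V) (hVc : V ⊆ (extChartAt (𝓡 d) c).target) :
    MeasurableSet {z | z ∈ V ∧ (extChartAt (𝓡 d) c).symm z ∈ H} := by
  have hc : Continuous (V.domRestrict (extChartAt (𝓡 d) c).symm) :=
    continuousOn_iff_continuous_domRestrict.mp ((continuousOn_extChartAt_symm c).mono hVc)
  have h := hV.subtype_image (hc.measurable hH)
  convert h using 1
  ext z
  simp [and_comm, Set.domRestrict_apply]

variable [IsManifold (𝓡 d) ∞ M] [RiemannianBundle (fun x : M ↦ TangentSpace (𝓡 d) x)]

omit [BorelSpace M] in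
/-- A measurable subset of a chart domain whose image in the chart is Lebesgue null has no
Riemannian volume. -/
lemma riemannianVolume_eq_zero {c₀ : M} {S : Set M} (hS : MeasurableSet S)
    (hSc : S ⊆ (extChartAt (𝓡 d) c₀).source) (h0 : volume (extChartAt (𝓡 d) c₀ '' S) = 0) :
    riemannianVolume d M S = 0 := by
  have hchart : ∀ c : M, chartVolume (d := d) c S = 0 := by
    intro c
    by_cases hm : AEMeasurable (extChartAt (𝓡 d) c).symm
        (((volume : Measure 𝔼[d]).withDensity (chartVolumeDensity c)).restrict
          (extChartAt (𝓡 d) c).target)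
    swap
    · rw [chartVolume, Measure.map_of_not_aemeasurable hm]
      rfl
    rw [chartVolume, Measure.map_apply_of_aemeasurable hm hS,
      Measure.restrict_apply' (isOpen_extChartAt_target c).measurableSet]
    refine withDensity_absolutelyContinuous _ _ ?_
    have himg : volume ((extChartAt (𝓡 d) c ∘ (extChartAt (𝓡 d) c₀).symm) ''
        (extChartAt (𝓡 d) c₀ '' (S ∩ (extChartAt (𝓡 d) c).source))) = 0 := by
      refine addHaar_image_eq_zero_of_differentiableOn_of_addHaar_eq_zero _ ?_
        (measure_mono_null (image_mono inter_subset_left) h0)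
      rintro _ ⟨x, hx, rfl⟩
      exact ((contDiffAt_chart_transition (hSc hx.1) hx.2).differentiableAt
        (by simp)).differentiableWithinAt
    refine measure_mono_null ?_ himg
    rintro z ⟨hz1, hz2⟩
    have hz3 := (extChartAt (𝓡 d) c).map_target hz2
    refine ⟨_, ⟨_, ⟨hz1, hz3⟩, rfl⟩, ?_⟩
    rw [Function.comp_apply, (extChartAt (𝓡 d) c₀).left_inv (hSc hz1),
      (extChartAt (𝓡 d) c).right_inv hz2]
  have hle : riemannianVolume d M ≤ (riemannianVolume d M).restrict Sᶜ := by
    refine iSup_le fun c ↦ ?_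
    have h1 : chartVolume (d := d) c ≤ riemannianVolume d M :=
      le_iSup (fun c : M ↦ chartVolume (d := d) c) c
    calc chartVolume (d := d) c = (chartVolume (d := d) c).restrict Sᶜ := by
          refine (Measure.restrict_eq_self_of_ae_mem ?_).symm
          rw [ae_iff]
          simpa using hchart c
      _ ≤ (riemannianVolume d M).restrict Sᶜ := Measure.restrict_mono subset_rfl h1
  refine le_antisymm ((hle S).trans ?_) bot_le
  rw [Measure.restrict_apply hS, inter_compl_self, measure_empty]

end VolumeInCharts

/-! ### A centre-unstable plaque with a positive set of expanding points -/

section ExpandingPlaque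

lemma exists_frequently_lt_of_liminf_lt {a : ℕ → ℝ}
    (h : liminf (fun n ↦ (a n : EReal)) atTop < 0) :
    ∃ q : ℕ, ∃ᶠ n in atTop, a n < -(1 / ((q : ℝ) + 1)) := by
  obtain ⟨x, hx1, hx2⟩ := EReal.lt_iff_exists_real_btwn.mp h
  have hx0 : x < 0 := by exact_mod_cast hx2
  obtain ⟨q, hq⟩ := exists_nat_one_div_lt (neg_pos.mpr hx0)
  refine ⟨q, (frequently_lt_of_liminf_lt (by isBoundedDefault) hx1).mono fun n hn ↦ ?_⟩
  have : a n < x := by exact_mod_cast hn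
  linarith

variable {d : ℕ} {M : Type*} [EMetricSpace M] [ChartedSpace (EuclideanSpace ℝ (Fin d)) M]
  [RiemannianBundle (fun x : M ↦ TangentSpace (𝓡 d) x)]

lemma IsNonUniformlyExpandingAt.exists_frequently_lt {f : M ≃ₘ^1⟮𝓡 d, 𝓡 d⟯ M}
    {Ecu : ∀ x : M, Submodule ℝ (TangentSpace (𝓡 d) x)} {x : M}
    (h : IsNonUniformlyExpandingAt f Ecu x) :
    ∃ q : ℕ, ∃ᶠ n : ℕ in atTop, (1 / (n : ℝ)) * ∑ i ∈ Finset.range n,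
      Real.log (normDerivOn f.symm Ecu (f^[i + 1] x)) < -(1 / ((q : ℝ) + 1)) := by
  obtain ⟨q, hq⟩ := exists_frequently_lt_of_liminf_lt h.2
  refine ⟨q, hq.mono fun n hn ↦ ?_⟩
  rwa [← Finset.Ico_add_one_right_eq_Icc, Finset.sum_Ico_eq_sum_range, Nat.add_sub_cancel,
    Finset.sum_congr rfl fun i _ ↦ by rw [add_comm 1 i]] at hn

variable [SecondCountableTopology M] [MeasurableSpace M] [BorelSpace M] [IsManifold (𝓡 d) ∞ M]
  {f : M ≃ₘ^1⟮𝓡 d, 𝓡 d⟯ M} {Λ : Set M} {Ecs Ecu : ∀ x : M, Submodule ℝ (TangentSpace (𝓡 d) x)}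
  {N : ∀ x : M, Seminorm ℝ (TangentSpace (𝓡 d) x)} {α : ℝ} {Z : Set M} {dom : M → Set M}
  {r K : ℝ}

/-- Near a density point of the set of expanding points, some flat plaque parallel to the
centre-unstable plane meets the expanding points in a set of positive measure on which the
averages are infinitely often below one and the same negative bound. -/
lemma IsChartSystem.exists_expanding_plaque (hCS : IsChartSystem f Λ Ecs Ecu N α Z dom r K)
    (hΛ : IsDominatedSplitting f Λ Ecs Ecu) {H : Set M} (hHΛ : H ⊆ Λ) (hHm : MeasurableSet H)
    (hH : 0 < riemannianVolume d M H) (hNUE : ∀ x ∈ H, IsNonUniformlyExpandingAt f Ecu x) :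
    ∃ c ∈ Z, ∃ p ∈ dom c, ∃ (k l : ℕ) (B : 𝔼[d] ≃L[ℝ] 𝔼[k] × 𝔼[l]) (v₀ : 𝔼[l]) (s b : ℝ)
      (A : Set 𝔼[k]), 0 < k ∧ IsAdapted Ecs Ecu (2 * K ^ 3) c p B ∧ 0 < b ∧
      (∀ u ∈ Metric.closedBall (0 : 𝔼[k]) s,
        extChartAt (𝓡 d) c p + B.symm (u, v₀) ∈ (extChartAt (𝓡 d) c).target ∧
        (chartPoint d c p B (u, v₀) ∈ Λ → chartPoint d c p B (u, v₀) ∈ dom c ∧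
          Module.finrank ℝ (Ecu (chartPoint d c p B (u, v₀))) = k ∧
          Module.finrank ℝ (Ecs (chartPoint d c p B (u, v₀))) = l ∧
          ∀ v, ‖splittingProj Ecu Ecs c (chartPoint d c p B (u, v₀)) v -
            splittingProj Ecu Ecs c p v‖ ≤ 1 / (2 * K ^ 2) * ‖v‖)) ∧
      A ⊆ Metric.closedBall 0 s ∧ volume A ≠ 0 ∧
      ∀ u ∈ A, chartPoint d c p B (u, v₀) ∈ Λ ∧ ∃ᶠ n : ℕ in atTop,
        (1 / (n : ℝ)) * ∑ i ∈ Finset.range n,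
          Real.log (normDerivOn f.symm Ecu (f^[i + 1] (chartPoint d c p B (u, v₀)))) < -b := by
  have hK : 0 < K := zero_lt_one.trans_le hCS.one_le_K
  obtain ⟨p, hpH, hp⟩ := exists_mem_forall_mem_nhdsWithin_pos_measure hH.ne'
  have hpΛ := hHΛ hpH
  obtain ⟨c, hc, hcp⟩ := hCS.exists_center p hpΛ
  have hpc : p ∈ dom c := mem_of_mem_nhdsWithin hpΛ hcp
  have hps := hCS.subset_source c hc hpc
  obtain ⟨k, hpk⟩ : ∃ k, Module.finrank ℝ (Ecu p) = k := ⟨_, rfl⟩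
  obtain ⟨l, hpl⟩ : ∃ l, Module.finrank ℝ (Ecs p) = l := ⟨_, rfl⟩
  obtain ⟨B, hB⟩ := hCS.exists_isAdapted hΛ.isCompl hc hpc hpk hpl
  have hk : 0 < k := by
    have : FiniteDimensional ℝ (TangentSpace (𝓡 d) p) :=
      inferInstanceAs (FiniteDimensional ℝ 𝔼[d])
    exact Nat.pos_of_ne_zero fun h ↦ (hNUE p hpH).1 (Submodule.finrank_eq_zero.mp (hpk.trans h))
  have hev : ∀ᶠ y in 𝓝[Λ] p, y ∈ dom c ∧ Module.finrank ℝ (Ecu y) = k ∧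
      Module.finrank ℝ (Ecs y) = l ∧
      ∀ v, ‖splittingProj Ecu Ecs c y v - splittingProj Ecu Ecs c p v‖ ≤
        1 / (2 * K ^ 2) * ‖v‖ := by
    have hproj := continuousWithinAt_splittingProj hΛ.continuous_cu hΛ.continuous_cs
      (fun x hx ↦ (hΛ.isCompl x hx).symm) hpΛ hps
    have hpos : 0 < 1 / (2 * K ^ 2) := by positivity
    filter_upwards [hcp, eventually_finrank_eq hΛ.continuous_cu hpΛ,
      eventually_finrank_eq hΛ.continuous_cs hpΛ,
      hproj.eventually (Metric.ball_mem_nhds _ hpos)] with y h1 h2 h3 h4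
    refine ⟨h1, h2.trans hpk, h3.trans hpl, fun v ↦ ?_⟩
    rw [dist_eq_norm] at h4
    exact ((splittingProj Ecu Ecs c y).toContinuousLinearMap -
      (splittingProj Ecu Ecs c p).toContinuousLinearMap).le_of_opNorm_le h4.le v
  rw [eventually_nhdsWithin_iff] at hev
  obtain ⟨ρ₀, hρ₀, hball⟩ := Metric.eventually_nhds_iff_ball.mp
    (((tendsto_extChartAt_symm hps).eventually hev).and
      ((isOpen_extChartAt_target c).mem_nhds ((extChartAt (𝓡 d) c).map_source hps)))
  -- The plaque has size `s` and the expanding points are taken in the chart ball of radius `ε`.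
  obtain ⟨s, hs, hsB⟩ : ∃ s > 0, ‖(B.symm : 𝔼[k] × 𝔼[l] →L[ℝ] 𝔼[d])‖ * s < ρ₀ :=
    ⟨ρ₀ / (‖(B.symm : 𝔼[k] × 𝔼[l] →L[ℝ] 𝔼[d])‖ + 1), by positivity, by
      rw [mul_div_assoc', div_lt_iff₀ (by positivity)]
      nlinarith [norm_nonneg (B.symm : 𝔼[k] × 𝔼[l] →L[ℝ] 𝔼[d])]⟩
  obtain ⟨ε, hε, hεB⟩ : ∃ ε > 0, ‖(B : 𝔼[d] →L[ℝ] 𝔼[k] × 𝔼[l])‖ * ε < s :=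
    ⟨s / (‖(B : 𝔼[d] →L[ℝ] 𝔼[k] × 𝔼[l])‖ + 1), by positivity, by
      rw [mul_div_assoc', div_lt_iff₀ (by positivity)]
      nlinarith [norm_nonneg (B : 𝔼[d] →L[ℝ] 𝔼[k] × 𝔼[l])]⟩
  set V : Set 𝔼[d] := Metric.ball (extChartAt (𝓡 d) c p) (min ε ρ₀)
  have hVt : V ⊆ (extChartAt (𝓡 d) c).target := fun z hz ↦
    (hball z (Metric.ball_subset_ball (min_le_right _ _) hz)).2
  set E : Set 𝔼[d] := {z | z ∈ V ∧ (extChartAt (𝓡 d) c).symm z ∈ H}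
  have hEm : MeasurableSet E := measurableSet_chart_preimage hHm Metric.isOpen_ball.measurableSet hVt
  have hE0 : volume E ≠ 0 := by
    intro h0
    set O : Set M := (extChartAt (𝓡 d) c).source ∩ extChartAt (𝓡 d) c ⁻¹' V
    have hO : IsOpen O := (continuousOn_extChartAt c).isOpen_inter_preimage
      (isOpen_extChartAt_source c) Metric.isOpen_ball
    have hpO : p ∈ O := ⟨hps, Metric.mem_ball_self (lt_min hε hρ₀)⟩
    refine (hp (H ∩ O) (inter_mem_nhdsWithin _ (hO.mem_nhds hpO))).ne' ?_
    refine riemannianVolume_eq_zero (hHm.inter hO.measurableSet) (fun x hx ↦ hx.2.1)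
      (measure_mono_null ?_ h0)
    rintro _ ⟨x, hx, rfl⟩
    refine ⟨hx.2.2, ?_⟩
    rw [(extChartAt (𝓡 d) c).left_inv hx.2.1]
    exact hx.1
  obtain ⟨v₀, hv₀⟩ := exists_slice_volume_ne_zero B (extChartAt (𝓡 d) c p) hEm hE0
  have hsmall : ∀ u, extChartAt (𝓡 d) c p + B.symm (u, v₀) ∈ E → ‖(u, v₀)‖ ≤ s := by
    intro u hu
    have h1 : ‖B.symm (u, v₀)‖ < min ε ρ₀ := by
      simpa [V, dist_eq_norm] using hu.1
    calc ‖(u, v₀)‖ = ‖B (B.symm (u, v₀))‖ := by rw [B.apply_symm_apply]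
      _ ≤ ‖(B : 𝔼[d] →L[ℝ] 𝔼[k] × 𝔼[l])‖ * ‖B.symm (u, v₀)‖ :=
        (B : 𝔼[d] →L[ℝ] 𝔼[k] × 𝔼[l]).le_opNorm _
      _ ≤ ‖(B : 𝔼[d] →L[ℝ] 𝔼[k] × 𝔼[l])‖ * ε := by
        gcongr
        exact h1.le.trans (min_le_left _ _)
      _ ≤ s := hεB.le
  have hv₀s : ‖v₀‖ ≤ s := by
    obtain ⟨u, hu⟩ := nonempty_of_measure_ne_zero hv₀
    exact (norm_snd_le (u, v₀)).trans (hsmall u hu)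
  -- The slice is the union over `q` of the points with averages below `-1 / (q + 1)`.
  obtain ⟨q, hq⟩ : ∃ q : ℕ, volume {u : 𝔼[k] | extChartAt (𝓡 d) c p + B.symm (u, v₀) ∈ E ∧
      ∃ᶠ n : ℕ in atTop, (1 / (n : ℝ)) * ∑ i ∈ Finset.range n,
        Real.log (normDerivOn f.symm Ecu (f^[i + 1] (chartPoint d c p B (u, v₀)))) <
          -(1 / ((q : ℝ) + 1))} ≠ 0 := by
    by_contra! hcon
    refine hv₀ (measure_mono_null (fun u hu ↦ ?_) (measure_iUnion_null hcon))
    obtain ⟨q, hq⟩ := (hNUE _ hu.2).exists_frequently_lt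
    exact mem_iUnion.mpr ⟨q, hu, hq⟩
  refine ⟨c, hc, p, hpc, k, l, B, v₀, s, 1 / ((q : ℝ) + 1), _, hk, hB, by positivity, ?_, ?_, hq,
    fun u hu ↦ ⟨hHΛ hu.1.2, hu.2⟩⟩
  · intro u hu
    rw [mem_closedBall_zero_iff] at hu
    have hz : extChartAt (𝓡 d) c p + B.symm (u, v₀) ∈
        Metric.ball (extChartAt (𝓡 d) c p) ρ₀ := by
      rw [mem_ball_iff_norm, add_sub_cancel_left]
      refine ((B.symm : 𝔼[k] × 𝔼[l] →L[ℝ] 𝔼[d]).le_opNorm _).trans_lt (lt_of_le_of_lt ?_ hsB)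
      gcongr
      exact max_le hu hv₀s
    exact ⟨(hball _ hz).2, (hball _ hz).1⟩
  · intro u hu
    rw [mem_closedBall_zero_iff]
    exact (norm_fst_le (u, v₀)).trans (hsmall u hu.1)

end ExpandingPlaque

end

theorem theoremA {d : ℕ} {M : Type*} [EMetricSpace M] [SecondCountableTopology M]
    [MeasurableSpace M] [BorelSpace M]
    [ChartedSpace (EuclideanSpace ℝ (Fin d)) M] [IsManifold (𝓡 d) ∞ M]
    [RiemannianBundle (fun x : M ↦ TangentSpace (𝓡 d) x)]
    [IsContMDiffRiemannianBundle (𝓡 d) ∞ (EuclideanSpace ℝ (Fin d))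
      (fun x : M ↦ TangentSpace (𝓡 d) x)]
    [IsRiemannianManifold (𝓡 d) M]
    (α : ℝ≥0) (hα₀ : 0 < α) (hα₁ : α ≤ 1)
    (f : M ≃ₘ^1⟮𝓡 d, 𝓡 d⟯ M) (hf : HasLocallyHolderDerivative (d := d) α f)
    (Λ : Set M) (Ecs Ecu : ∀ x : M, Submodule ℝ (TangentSpace (𝓡 d) x))
    (hΛ : IsDominatedSplitting f Λ Ecs Ecu)
    (H : Set M) (hHΛ : H ⊆ Λ) (hHm : MeasurableSet H) (hH : 0 < riemannianVolume d M H)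
    (hNUE : ∀ x ∈ H, IsNonUniformlyExpandingAt f Ecu x) :
    ∃ γ ⊆ Λ, IsLocalUnstableDisk f Ecu γ := by
  obtain ⟨N, lam, μ, hN, hlam, hlam1, hμ, hdom⟩ := hΛ.exists_seminorms
  obtain ⟨Z, dom, r, K, hCS⟩ := exists_isChartSystem hα₀ hα₁ hf hΛ hN
  obtain ⟨c₀, hc₀, p, hp, k, l, B, v₀, s, b, A, hk, hB, hb, hreg, hAs, hA0, hA⟩ :=
    hCS.exists_expanding_plaque hΛ hHΛ hHm hH hNUE
  have : Nonempty (Fin k) := ⟨⟨0, hk⟩⟩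
  obtain ⟨ρ, C, R, σ, hρ, hC, hR, hσ0, hσ1, hgood⟩ :=
    hCS.exists_isGoodDisk (NNReal.coe_pos.mpr hα₀) (NNReal.coe_le_one.mpr hα₁) hΛ hlam hlam1 hμ
      hdom hc₀ hp hB hreg hAs hA0 hb (fun u hu ↦ (hA u hu).1) (fun u hu ↦ (hA u hu).2)
  obtain ⟨c, hc, hdisk⟩ := exists_center_isGoodDisk hCS.finite hlam.le hlam1.le hC hgood
  obtain ⟨g, g', hg'c, hg⟩ :=
    hCS.exists_limitDisk (NNReal.coe_pos.mpr hα₀) hΛ hlam.le hlam1 hρ hC hc hdisk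
  exact exists_isLocalUnstableDisk hk hR hC hσ0 hσ1 hg'c hg
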